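/- Let $\Omega=(0,1)^2$, let $\varepsilon,\kappa,T>0$, $\theta_0\in\mathbb R$, and let $F(s)=(1+s)\ln(1+s)+(1-s)\ln(1-s)-\frac{\theta_0}{2}s^2$. Let $\Phi(t,x,y)$ be $1$-periodic in $x$ and solve on $(0,T)$ $$\partial_t\Phi=\Delta\mu,\quad \mu=F'(\Phi)-\varepsilon^2\Delta\Phi\ \text{ in }\Omega,\qquad \partial_{n}\mu=0\ \text{ at } y=0,1,$$ $$\partial_t\Phi^{B}=\partial_x^2\mu_{B},\quad \mu_{B}=F'(\Phi^{B})-\kappa\varepsilon\,\partial_x^2\Phi^{B}+\varepsilon^2\partial_{n}\Phi|_{y=0},\qquad \partial_t\Phi^{T}=\partial_x^2\mu_{T},\quad \mu_{T}=F'(\Phi^{T})-\kappa\varepsilon\,\partial_x^2\Phi^{T}+\varepsilon^2\partial_{n}\Phi|_{y=1},$$ where $n$ is the outward normal and superscripts $B,T$ denote the traces on $y=0$ and $y=1$. Assume that $\Phi\in H^2(0,T;C_{\rm per,x}(\overline\Omega))\cap H^1(0,T;C^2_{\rm per,x}(\overline\Omega))\cap L^\infty(0,T;C^6_{\rm per,x}(\overline\Omega))$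 and that, for some $\epsilon_0>0$, $1\pm\Phi\ge\epsilon_0$ for all $t\in[0,T]$. *Discretization.* Let $N=2K+1$, $h=1/N$. Grid functions $f_{i,j}$, located at $((i+\frac12)h,jh)$, are $N$-periodic in $i$; the nodes are $0\le j\le N$, and $j=-1,N+1$ are ghost points. Let $D_x^2$ be the centred second difference, $\Delta_h$ the five-point Laplacian, $\tilde D_yf_{i,j}=\frac{f_{i,j+1}-f_{i,j-1}}{2h}$, $(f,g)=h^2\sum_{i=0}^{N-1}\sum_{j=0}^{N}\omega_jf_{i,j}g_{i,j}$ with $\omega_0=\omega_N=\frac12$ and $\omega_j=1$ otherwise, $\overline f=(f,1)$, and $(f,g)_\Gamma=h\sum_{i=0}^{N-1}f_ig_i$, $\overline f^\Gamma=(f,1)_\Gamma$ on each boundary section. Let $\|\nabla_hf\|_2^2=h^2\sum_{i=0}^{N-1}\sum_{j=0}^N\omega_j\big(\tfrac{f_{i+1,j}-f_{i,j}}h\big)^2+h^2\sum_{i=0}^{N-1}\sum_{j=0}^{N-1}\big(\tfrac{f_{i,j+1}-f_{i,j}}h\big)^2$, and $\|D_xf\|_{2,\Gamma}^2=h\sum_{j\in\{0,N\}}\sum_{i=0}^{N-1}\big(\tfrac{f_{i+1,j}-f_{i,j}}h\big)^2$.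 Let $L_h=-\Delta_h$ for $0<j<N$, $L_h\psi_{i,0}=-D_x^2\psi_{i,0}-\frac{2}{h^2}(\psi_{i,1}-\psi_{i,0})$, $L_h\psi_{i,N}=-D_x^2\psi_{i,N}-\frac2{h^2}(\psi_{i,N-1}-\psi_{i,N})$. For mean-zero $f$ let $\|f\|_{-1}^2=(f,\psi)$, where $\psi$ is the mean-zero solution of $L_h\psi=f$; on a boundary section $\|\cdot\|_{-1,\Gamma}$ is defined in the same way with $-D_x^2$, and for bulk grid functions $\|f\|_{-1,\Gamma}^2=\|f^T\|_{-1,\Gamma}^2+\|f^B\|_{-1,\Gamma}^2$ with $f^B=f_{\cdot,0}$, $f^T=f_{\cdot,N}$. *Scheme.* Given $\phi^n$, the next iterate $\phi^{n+1}$, with $-1<\phi^{n+1}<1$ at the nodes, satisfies together with discrete chemical potentials $\mu^{n+1},\mu_B^{n+1},\mu_T^{n+1}$, at all nodes including $j=0,N$, $$\tfrac{\phi^{n+1}-\phi^n}{\Delta t}=\Delta_h\mu^{n+1},\quad \mu^{n+1}=\ln(1+\phi^{n+1})-\ln(1-\phi^{n+1})-\theta_0\phi^n-\varepsilon^2\Delta_h\phi^{n+1},\quad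 \tilde D_y\mu^{n+1}_{\cdot,0}=\tilde D_y\mu^{n+1}_{\cdot,N}=0,$$ $$\tfrac{\phi^{B,n+1}-\phi^{B,n}}{\Delta t}=D_x^2\mu_B^{n+1},\quad \mu_B^{n+1}=\ln(1+\phi^{B,n+1})-\ln(1-\phi^{B,n+1})-\theta_0\phi^{B,n}-\kappa\varepsilon D_x^2\phi^{B,n+1}-\varepsilon^2\tilde D_y\phi^{n+1}_{\cdot,0},$$ $$\tfrac{\phi^{T,n+1}-\phi^{T,n}}{\Delta t}=D_x^2\mu_T^{n+1},\quad \mu_T^{n+1}=\ln(1+\phi^{T,n+1})-\ln(1-\phi^{T,n+1})-\theta_0\phi^{T,n}-\kappa\varepsilon D_x^2\phi^{T,n+1}+\varepsilon^2\tilde D_y\phi^{n+1}_{\cdot,N}.$$ *Error.* Let $\Phi_N(t)$ be the Fourier projection of $\Phi(t)$ in $x$ onto trigonometric polynomials of degree $\le K$, let $\delta\Phi(t,y)=(\overline{\Phi_N(t)}-\overline{\Phi_N(0)})(1-\cos2\pi y)$, where the bars are discrete means of grid values, and let $\tilde\phi^n$ be the grid function $(\Phi_N-\delta\Phi)(n\Delta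 t)-\phi^n$. **Theorem.** For every $C_0$ there are positive constants $C,\Delta t_0,h_0$, depending only on $\Phi$, $\Omega$, $T$, the parameters $\varepsilon,\kappa,\theta_0,\epsilon_0$ and $C_0$, such that the following holds for all odd $N$ with $h\le h_0$, all $0<\Delta t\le\Delta t_0$, all $M$ with $M\Delta t\le T$ and every numerical solution $\phi^0,\dots,\phi^M$ of the scheme whose initial datum satisfies $\overline{\phi^0}=\overline{\Phi_N(0)}$, $\overline{\phi^{B,0}}^\Gamma=\overline{\Phi_N^B(0)}^\Gamma$, $\overline{\phi^{T,0}}^\Gamma=\overline{\Phi_N^T(0)}^\Gamma$ and $\|\tilde\phi^0\|_{-1}+\|\tilde\phi^0\|_{-1,\Gamma}\le C_0(\Delta t+h^2)$ (for instance $\phi^0=\Phi_N(0)$ on the grid, with $C_0=0$). For $0\le n<M$, the error $\tilde\phi^{n+1}$ has discrete mean zero in the bulk and on each boundary section, $$\|\tilde\phi^{n+1}\|_{-1}+\|\tilde\phi^{n+1}\|_{-1,\Gamma}+\Delta t\sum_{k=1}^{n}\Big(\varepsilon^2\|\nabla_h\tilde\phi^k\|_2^2+\varepsilon\kappa\|D_x\tilde\phi^k\|_{2,\Gamma}^2\Big)\le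 C(\Delta t+h^2),$$ and $$\Big(\Delta t\sum_{k=1}^{n+1}\big(\varepsilon^2\|\nabla_h\tilde\phi^k\|_2^2+\varepsilon\kappa\|D_x\tilde\phi^k\|_{2,\Gamma}^2\big)\Big)^{1/2}\le C(\Delta t+h^2).$$ -/

import Mathlib

open Finset MeasureTheory

/-! ### The continuous problem

The spatial domain is `(0,1)²`, periodic with period `1` in `x`; functions on it are curried
functions `f x y` with `x : ℝ` and `y ∈ [0,1]`, space-time functions are `Φ t x y`. -/

/-- The Flory-Huggins potential (used in the bulk and on the boundary). -/
noncomputable def floryHuggins (θ₀ s : ℝ) : ℝ :=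
  (1 + s) * Real.log (1 + s) + (1 - s) * Real.log (1 - s) - θ₀ / 2 * s ^ 2

/-- The closed strip `ℝ × [0,1]`, i.e. the closure of the domain unrolled in `x`. -/
def strip : Set (ℝ × ℝ) := Set.univ ×ˢ Set.Icc (0 : ℝ) 1

/-- The partial derivative `∂ₓᵃ ∂ᵧᵇ f`, one-sided in `y` at `y = 0` and `y = 1`. -/
noncomputable def pd (a b : ℕ) (f : ℝ → ℝ → ℝ) (x y : ℝ) : ℝ :=
  iteratedDeriv a (fun x' => iteratedDerivWithin b (fun y' => f x' y') (Set.Icc 0 1) y) x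

/-- The Laplacian. -/
noncomputable def lap (f : ℝ → ℝ → ℝ) (x y : ℝ) : ℝ := pd 2 0 f x y + pd 0 2 f x y

/-- Bulk chemical potential `μ = F'(f) - ε² Δ f`. -/
noncomputable def bulkPot (ε θ₀ : ℝ) (f : ℝ → ℝ → ℝ) (x y : ℝ) : ℝ :=
  deriv (floryHuggins θ₀) (f x y) - ε ^ 2 * lap f x y

/-- Surface chemical potential on `y = 0`; the outward normal derivative there is `-∂ᵧ`. -/
noncomputable def botPot (ε κ θ₀ : ℝ) (f : ℝ → ℝ → ℝ) (x : ℝ) : ℝ :=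
  deriv (floryHuggins θ₀) (f x 0) - κ * ε * iteratedDeriv 2 (fun x' => f x' 0) x
    + ε ^ 2 * (-(pd 0 1 f x 0))

/-- Surface chemical potential on `y = 1`; the outward normal derivative there is `∂ᵧ`. -/
noncomputable def topPot (ε κ θ₀ : ℝ) (f : ℝ → ℝ → ℝ) (x : ℝ) : ℝ :=
  deriv (floryHuggins θ₀) (f x 1) - κ * ε * iteratedDeriv 2 (fun x' => f x' 1) x
    + ε ^ 2 * pd 0 1 f x 1

/-- The Cahn-Hilliard system with dynamical boundary conditions at `y = 0, 1`, satisfied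
pointwise in space for almost every time. (For functions of the class `ClassR` below all terms
are continuous in time, so that "almost every" and "every" agree.) -/
def SolvesCahnHilliard (ε κ θ₀ T : ℝ) (Φ : ℝ → ℝ → ℝ → ℝ) : Prop :=
  ∀ᵐ t ∂(volume.restrict (Set.Ioo 0 T)), ∀ x : ℝ,
    (∀ y ∈ Set.Ioo (0 : ℝ) 1,
      deriv (fun s => Φ s x y) t = lap (bulkPot ε θ₀ (Φ t)) x y) ∧
    pd 0 1 (bulkPot ε θ₀ (Φ t)) x 0 = 0 ∧
    pd 0 1 (bulkPot ε θ₀ (Φ t)) x 1 = 0 ∧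
    deriv (fun s => Φ s x 0) t = iteratedDeriv 2 (botPot ε κ θ₀ (Φ t)) x ∧
    deriv (fun s => Φ s x 1) t = iteratedDeriv 2 (topPot ε κ θ₀ (Φ t)) x

/-! ### The regularity class -/

/-- `v ∈ L²(0,T;E)` is the weak time derivative of (the continuous representative) `u` on
`[0,T]`. -/
def HasTimeDeriv {E : Type*} [NormedAddCommGroup E] [NormedSpace ℝ E]
    (T : ℝ) (u v : ℝ → E) : Prop :=
  MemLp v 2 (volume.restrict (Set.Ioc 0 T)) ∧
    ∀ t ∈ Set.Icc 0 T, u t = u 0 + ∫ s in (0 : ℝ)..t, v s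

/-- `u ∈ H¹(0,T;E)` (continuous representative). -/
def MemH1 {E : Type*} [NormedAddCommGroup E] [NormedSpace ℝ E] (T : ℝ) (u : ℝ → E) : Prop :=
  ∃ v, HasTimeDeriv T u v

/-- `u ∈ H²(0,T;E)` (continuous representative). -/
def MemH2 {E : Type*} [NormedAddCommGroup E] [NormedSpace ℝ E] (T : ℝ) (u : ℝ → E) : Prop :=
  ∃ v, HasTimeDeriv T u v ∧ MemH1 T v

/-- The curve `u` in the Banach space `C([0,1]²)` is `t ↦ Φ t`. -/
def Represents (T : ℝ) (Φ : ℝ → ℝ → ℝ → ℝ) (u : ℝ → C(unitInterval × unitInterval, ℝ)) : Prop :=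
  ∀ t ∈ Set.Icc 0 T, ∀ p : unitInterval × unitInterval, u t p = Φ t p.1 p.2

/-- `Φ ∈ H²(0,T;C_per) ∩ H¹(0,T;C²_per) ∩ L^∞(0,T;C⁶_per)`. Here `C^k_per` consists of the
functions that are `1`-periodic in `x` and `C^k` on the closed strip, and a curve in `C^k_per`
is identified with the tuple of its partial derivatives of order `≤ k`, which are curves in
`C([0,1]²)` (`C^k_per` is a closed subspace of the product of these spaces). In the last clause
strong measurability in time is automatic. -/
structure ClassR (T : ℝ) (Φ : ℝ → ℝ → ℝ → ℝ) : Prop where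
  periodic : ∀ t ∈ Set.Icc 0 T, ∀ x : ℝ, ∀ y ∈ Set.Icc (0 : ℝ) 1, Φ t (x + 1) y = Φ t x y
  h2_C0 : ∃ u, Represents T Φ u ∧ MemH2 T u
  contDiff2 : ∀ t ∈ Set.Icc 0 T, ContDiffOn ℝ 2 (Function.uncurry (Φ t)) strip
  h1_C2 : ∀ a b : ℕ, a + b ≤ 2 → ∃ u, Represents T (fun t => pd a b (Φ t)) u ∧ MemH1 T u
  linf_C6 : ∃ B : ℝ, ∀ᵐ t ∂(volume.restrict (Set.Ioo 0 T)),
    ContDiffOn ℝ 6 (Function.uncurry (Φ t)) strip ∧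
      ∀ a b : ℕ, a + b ≤ 6 → ∀ x : ℝ, ∀ y ∈ Set.Icc (0 : ℝ) 1, |pd a b (Φ t) x y| ≤ B

/-! ### Grid functions

`N = 2K+1`, `h = 1/N`. A grid function periodic in the first index is a function on
`ZMod N × ℤ`; the value `f i j` sits at `((i+1/2)h, jh)`. The nodes are `0 ≤ j ≤ N`, and
`j = -1`, `j = N+1` are ghost points. -/

/-- Number of cells in each direction. -/
abbrev cells (K : ℕ) : ℕ := 2 * K + 1

/-- Mesh size `h = 1/N`. -/
noncomputable def mesh (K : ℕ) : ℝ := 1 / (cells K : ℝ)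

/-- Bulk grid functions, periodic in `x`. -/
abbrev Grid (K : ℕ) : Type := ZMod (cells K) → ℤ → ℝ

/-- Grid functions on one boundary section. -/
abbrev BdGrid (K : ℕ) : Type := ZMod (cells K) → ℝ

/-- Restriction of a function to the grid. -/
noncomputable def sample (K : ℕ) (f : ℝ → ℝ → ℝ) : Grid K :=
  fun i j => f (((i.val : ℝ) + 1 / 2) * mesh K) ((j : ℝ) * mesh K)

/-- Boundary part on `y = 0`. -/
def bot {K : ℕ} (f : Grid K) : BdGrid K := fun i => f i 0

/-- Boundary part on `y = 1`. -/
def top {K : ℕ} (f : Grid K) : BdGrid K := fun i => f i (cells K)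

/-- Second difference on a boundary section. -/
noncomputable def bdD2x {K : ℕ} (f : BdGrid K) : BdGrid K :=
  fun i => (f (i + 1) - 2 * f i + f (i - 1)) / mesh K ^ 2

/-- `D_x²` in the bulk. -/
noncomputable def D2x {K : ℕ} (f : Grid K) : Grid K :=
  fun i j => (f (i + 1) j - 2 * f i j + f (i - 1) j) / mesh K ^ 2

/-- `D_y²` in the bulk. -/
noncomputable def D2y {K : ℕ} (f : Grid K) : Grid K :=
  fun i j => (f i (j + 1) - 2 * f i j + f i (j - 1)) / mesh K ^ 2

/-- The five-point Laplacian. -/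
noncomputable def lapH {K : ℕ} (f : Grid K) : Grid K := fun i j => D2x f i j + D2y f i j

/-- Long-stencil centred difference in `y`. -/
noncomputable def longDy {K : ℕ} (f : Grid K) (i : ZMod (cells K)) (j : ℤ) : ℝ :=
  (f i (j + 1) - f i (j - 1)) / (2 * mesh K)

/-- Quadrature weights in `y`. -/
noncomputable def wt (K j : ℕ) : ℝ := if j = 0 ∨ j = cells K then 1 / 2 else 1

/-- The discrete `ℓ²` inner product in the bulk. -/
noncomputable def ip {K : ℕ} (f g : Grid K) : ℝ :=
  mesh K ^ 2 * ∑ i : ZMod (cells K), ∑ j ∈ range (cells K + 1), wt K j * (f i j * g i j)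

/-- Discrete bulk mean `(f,1)/|Ω|`, with `|Ω| = 1`. -/
noncomputable def mean {K : ℕ} (f : Grid K) : ℝ := ip f (fun _ _ => 1)

/-- The discrete inner product on a boundary section. -/
noncomputable def bdIp {K : ℕ} (f g : BdGrid K) : ℝ := mesh K * ∑ i : ZMod (cells K), f i * g i

/-- Discrete mean on a boundary section (of length `1`). -/
noncomputable def bdMean {K : ℕ} (f : BdGrid K) : ℝ := bdIp f (fun _ => 1)

/-- `D_x f` at `(i+1/2, j)`. -/
noncomputable def Dx {K : ℕ} (f : Grid K) : Grid K := fun i j => (f (i + 1) j - f i j) / mesh K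

/-- `D_y f` at `(i, j+1/2)`. -/
noncomputable def Dy {K : ℕ} (f : Grid K) : Grid K := fun i j => (f i (j + 1) - f i j) / mesh K

/-- Averaging in `x` from the half points `(i±1/2, j)` to `(i, j)`. -/
noncomputable def avgX {K : ℕ} (f : Grid K) : Grid K := fun i j => (f i j + f (i - 1) j) / 2

/-- `‖∇_h f‖₂²`. -/
noncomputable def gradSq {K : ℕ} (f : Grid K) : ℝ :=
  ip (avgX fun i j => Dx f i j * Dx f i j) (fun _ _ => 1) +
    mesh K ^ 2 * ∑ i : ZMod (cells K), ∑ j ∈ range (cells K), Dy f i j * Dy f i j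

/-- `‖D_x f‖_{2,Γ}²` on one boundary section. -/
noncomputable def bdGradSq {K : ℕ} (f : BdGrid K) : ℝ :=
  mesh K * ∑ i : ZMod (cells K), ((f (i + 1) - f i) / mesh K) ^ 2

/-- The modified negative Laplacian `L_h` on the nodes `0 ≤ j ≤ N`. -/
noncomputable def negLap {K : ℕ} (f : Grid K) (i : ZMod (cells K)) (j : ℤ) : ℝ :=
  if j = 0 then -D2x f i 0 - 2 * ((f i 1 - f i 0) / mesh K ^ 2)
  else if j = cells K then
    -D2x f i (cells K) - 2 * ((f i ((cells K : ℤ) - 1) - f i (cells K)) / mesh K ^ 2)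
  else -lapH f i j

/-- `ψ` has mean zero and `L_h ψ = f` on the nodes. -/
def IsNegLapInv {K : ℕ} (f ψ : Grid K) : Prop :=
  mean ψ = 0 ∧ ∀ (i : ZMod (cells K)) (j : ℤ), 0 ≤ j → j ≤ cells K → negLap ψ i j = f i j

/-- `ψ` has mean zero and `-D_x² ψ = f` on a boundary section. -/
def IsBdNegLapInv {K : ℕ} (f ψ : BdGrid K) : Prop := bdMean ψ = 0 ∧ ∀ i, -bdD2x ψ i = f i

/-- The discrete `H⁻¹` norm of a mean-zero `f`: the square root of `(f, ψ)`, where `ψ` is the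
mean-zero solution of `L_h ψ = f` (see `exists_isNegLapInv` and `isNegLapInv_unique`). -/
noncomputable def negNorm {K : ℕ} (f : Grid K) : ℝ :=
  Real.sqrt (ip f (Classical.epsilon (IsNegLapInv f)))

/-- The discrete `H⁻¹` norm on a boundary section of a mean-zero `f` (see
`exists_isBdNegLapInv` and `isBdNegLapInv_unique`). -/
noncomputable def bdNegNorm {K : ℕ} (f : BdGrid K) : ℝ :=
  Real.sqrt (bdIp f (Classical.epsilon (IsBdNegLapInv f)))

/-- `‖f‖_{-1,Γ}`, both boundary sections together. -/
noncomputable def surfNegNorm {K : ℕ} (f : Grid K) : ℝ :=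
  Real.sqrt (bdNegNorm (top f) ^ 2 + bdNegNorm (bot f) ^ 2)

/-- `‖D_x f‖_{2,Γ}²`, both boundary sections together. -/
noncomputable def surfGradSq {K : ℕ} (f : Grid K) : ℝ := bdGradSq (top f) + bdGradSq (bot f)

/-! ### The discrete `H⁻¹` norms are well defined -/

theorem mesh_pos (K : ℕ) : 0 < mesh K := by
  unfold mesh; positivity

theorem sum_parts_x {n : ℕ} [NeZero n] (v u : ZMod n → ℝ) :
    ∑ i, v i * (2 * u i - u (i + 1) - u (i - 1)) =
      ∑ i, (v (i + 1) - v i) * (u (i + 1) - u i) := by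
  have h1 : ∑ i, v (i + 1) * u (i + 1) = ∑ i, v i * u i :=
    Equiv.sum_comp (Equiv.addRight (1 : ZMod n)) (fun i => v i * u i)
  have h2 : ∑ i, v (i + 1) * u i = ∑ i, v i * u (i - 1) := by
    rw [← Equiv.sum_comp (Equiv.addRight (1 : ZMod n)) (fun i => v i * u (i - 1))]
    simp
  simp only [mul_sub, sub_mul, sum_sub_distrib, h1, h2]
  have h3 : ∑ i, v i * (2 * u i) = 2 * ∑ i, v i * u i := by
    rw [mul_sum]; exact sum_congr rfl fun i _ => by ring
  rw [h3]; ring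

theorem sum_parts_y (n : ℕ) (v u : ℕ → ℝ) :
    v 0 * (u 0 - u 1) + ∑ j ∈ range n, v (j + 1) * (2 * u (j + 1) - u (j + 2) - u j)
      + v (n + 1) * (u (n + 1) - u n) =
      ∑ j ∈ range (n + 1), (v (j + 1) - v j) * (u (j + 1) - u j) := by
  induction n with
  | zero => simp; ring
  | succ n ih =>
    rw [sum_range_succ, sum_range_succ _ (n + 1), ← ih]; ring

/-- Summation by parts for `L_h`. -/
theorem ip_negLap {K : ℕ} (v u : Grid K) :
    ip v (negLap u) =
      ∑ j ∈ range (cells K + 1), wt K j *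
          ∑ i : ZMod (cells K), (v (i + 1) j - v i j) * (u (i + 1) j - u i j) +
        ∑ i : ZMod (cells K), ∑ j ∈ range (cells K),
          (v i (j + 1) - v i j) * (u i (j + 1) - u i j) := by
  have hm : mesh K ≠ 0 := (mesh_pos K).ne'
  have hx : ∀ j ∈ range (cells K + 1), wt K j *
      ∑ i : ZMod (cells K), (v (i + 1) j - v i j) * (u (i + 1) j - u i j) =
      ∑ i : ZMod (cells K), wt K j * (v i j * (2 * u i j - u (i + 1) j - u (i - 1) j)) := by
    intro j _
    rw [← sum_parts_x (fun i => v i j) (fun i => u i j), mul_sum]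
  have hy : ∀ i : ZMod (cells K), ∑ j ∈ range (cells K),
      (v i (j + 1) - v i j) * (u i (j + 1) - u i j) =
      v i 0 * (u i 0 - u i 1) + ∑ j ∈ range (2 * K),
        v i (j + 1) * (2 * u i (j + 1) - u i (j + 2) - u i j)
      + v i (2 * K + 1) * (u i (2 * K + 1) - u i (2 * K)) := by
    intro i
    have := sum_parts_y (2 * K) (fun j => v i j) (fun j => u i j)
    push_cast at this
    rw [← this]
  rw [sum_congr rfl hx, sum_comm, ← sum_add_distrib]
  unfold ip
  rw [mul_sum]
  refine sum_congr rfl fun i _ => ?_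
  rw [hy i]
  have e1 : cells K + 1 = 2 * K + 1 + 1 := rfl
  have w0 : wt K 0 = 1 / 2 := by simp [wt]
  have wN : wt K (2 * K + 1) = 1 / 2 := by simp [wt]
  have wj : ∀ j ∈ range (2 * K), wt K (j + 1) = 1 := by
    intro j hj; rw [mem_range] at hj; simp [wt, cells]; omega
  rw [e1, sum_range_succ, sum_range_succ', sum_range_succ, sum_range_succ', w0, wN]
  have l0 : negLap u i ((0 : ℕ) : ℤ) = (2 * u i 0 - u (i + 1) 0 - u (i - 1) 0) / mesh K ^ 2
      + 2 * ((u i 0 - u i 1) / mesh K ^ 2) := by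
    simp [negLap, D2x]; ring
  have lN : negLap u i ((2 * K + 1 : ℕ) : ℤ) =
      (2 * u i (2 * K + 1) - u (i + 1) (2 * K + 1) - u (i - 1) (2 * K + 1)) / mesh K ^ 2
      + 2 * ((u i (2 * K + 1) - u i (2 * K)) / mesh K ^ 2) := by
    have : ((2 * K + 1 : ℕ) : ℤ) ≠ 0 := by omega
    rw [negLap, if_neg this, if_pos rfl]
    simp [D2x, cells]; ring
  have lj : ∀ j ∈ range (2 * K), negLap u i ((j + 1 : ℕ) : ℤ) =
      (2 * u i (j + 1) - u (i + 1) (j + 1) - u (i - 1) (j + 1)) / mesh K ^ 2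
      + (2 * u i (j + 1) - u i (j + 2) - u i j) / mesh K ^ 2 := by
    intro j hj; rw [mem_range] at hj
    have h1 : ((j + 1 : ℕ) : ℤ) ≠ 0 := by omega
    have h2 : ((j + 1 : ℕ) : ℤ) ≠ (cells K : ℕ) := by simp only [cells]; omega
    rw [negLap, if_neg h1, if_neg h2]
    have h3 : (j : ℤ) + 1 + 1 = j + 2 := by ring
    simp [lapH, D2x, D2y, h3]; ring
  rw [sum_congr rfl fun j hj => by rw [wj j hj, lj j hj],
    sum_congr (g := fun j : ℕ => wt K (j + 1) * (v i ((j + 1 : ℕ) : ℤ) *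
      (2 * u i ((j + 1 : ℕ) : ℤ) - u (i + 1) ((j + 1 : ℕ) : ℤ) - u (i - 1) ((j + 1 : ℕ) : ℤ))))
      rfl fun j hj => rfl,
    sum_congr (s₁ := range (2 * K)) (f := fun j : ℕ => wt K (j + 1) * (v i ((j + 1 : ℕ) : ℤ) *
      (2 * u i ((j + 1 : ℕ) : ℤ) - u (i + 1) ((j + 1 : ℕ) : ℤ) - u (i - 1) ((j + 1 : ℕ) : ℤ))))
      rfl fun j hj => by rw [wj j hj], l0, lN]
  push_cast
  have hs : mesh K ^ 2 * ∑ j ∈ range (2 * K), 1 * (v i (j + 1) *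
      ((2 * u i (j + 1) - u (i + 1) (j + 1) - u (i - 1) (j + 1)) / mesh K ^ 2
      + (2 * u i (j + 1) - u i (j + 2) - u i j) / mesh K ^ 2)) =
      ∑ j ∈ range (2 * K), 1 * (v i (j + 1) *
        (2 * u i (j + 1) - u (i + 1) (j + 1) - u (i - 1) (j + 1))) +
      ∑ j ∈ range (2 * K), v i (j + 1) * (2 * u i (j + 1) - u i (j + 2) - u i j) := by
    rw [mul_sum, ← sum_add_distrib]
    exact sum_congr rfl fun j _ => by field_simp
  rw [mul_add, mul_add, hs]
  field_simp
  ring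

theorem wt_pos (K j : ℕ) : 0 < wt K j := by
  unfold wt; split_ifs <;> norm_num

theorem const_of_x {n : ℕ} [NeZero n] (f : ZMod n → ℝ) (h : ∀ i, f (i + 1) = f i) (i : ZMod n) :
    f i = f 0 := by
  have : ∀ m : ℕ, f (m : ZMod n) = f 0 := by
    intro m
    induction m with
    | zero => simp
    | succ m ih => push_cast; rw [h, ih]
  rw [← ZMod.natCast_zmod_val i]; exact this _

/-- The kernel of `L_h` consists of the constants. -/
theorem const_of_negLap {K : ℕ} (u : Grid K)
    (h : ∀ (i : ZMod (cells K)) (j : ℤ), 0 ≤ j → j ≤ cells K → negLap u i j = 0)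
    (i : ZMod (cells K)) (j : ℕ) (hj : j ≤ cells K) : u i j = u 0 0 := by
  have h0 : ip u (negLap u) = 0 := by
    unfold ip
    rw [sum_eq_zero, mul_zero]
    intro i _
    refine sum_eq_zero fun j hj => ?_
    rw [mem_range] at hj
    rw [h i j (by omega) (by omega)]; ring
  rw [ip_negLap] at h0
  have p1 : ∀ j ∈ range (cells K + 1), 0 ≤ wt K j *
          ∑ i : ZMod (cells K), (u (i + 1) j - u i j) * (u (i + 1) j - u i j) := fun j _ =>
    mul_nonneg (wt_pos K j).le (sum_nonneg fun i _ => mul_self_nonneg _)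
  have p2 : ∀ i ∈ (univ : Finset (ZMod (cells K))), 0 ≤ ∑ j ∈ range (cells K),
          (u i (j + 1) - u i j) * (u i (j + 1) - u i j) := fun i _ =>
    sum_nonneg fun j _ => mul_self_nonneg _
  obtain ⟨q1, q2⟩ := (add_eq_zero_iff_of_nonneg (sum_nonneg p1) (sum_nonneg p2)).1 h0
  have r1 : ∀ j : ℕ, j ≤ cells K → ∀ i, u (i + 1) j = u i j := by
    intro j hj i
    have := (sum_eq_zero_iff_of_nonneg p1).1 q1 j (mem_range.2 (by omega))
    have := (mul_eq_zero.1 this).resolve_left (wt_pos K j).ne'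
    have := (sum_eq_zero_iff_of_nonneg fun i _ => mul_self_nonneg _).1 this i (mem_univ _)
    linarith [mul_self_eq_zero.1 this]
  have r2 : ∀ i, ∀ j : ℕ, j < cells K → u i (j + 1) = u i j := by
    intro i j hj
    have := (sum_eq_zero_iff_of_nonneg p2).1 q2 i (mem_univ _)
    have := (sum_eq_zero_iff_of_nonneg fun j _ => mul_self_nonneg _).1 this j (mem_range.2 hj)
    linarith [mul_self_eq_zero.1 this]
  have r3 : u i j = u i 0 := by
    induction j with
    | zero => simp
    | succ j ih => push_cast; rw [r2 i j (by omega), ih (by omega)]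
  rw [r3]
  exact const_of_x (fun i => u i 0) (fun i => by simpa using r1 0 (by omega) i) i

theorem mean_negLap {K : ℕ} (u : Grid K) : mean (negLap u) = 0 := by
  have h1 : mean (negLap u) = ip (fun _ _ => 1) (negLap u) := by
    unfold mean ip
    simp only [mul_one, one_mul]
  rw [h1, ip_negLap]; simp

theorem mean_congr {K : ℕ} (f g : Grid K)
    (h : ∀ (i : ZMod (cells K)) (j : ℕ), j ≤ cells K → f i j = g i j) : mean f = mean g := by
  unfold mean ip
  congr 1
  refine sum_congr rfl fun i _ => sum_congr rfl fun j hj => ?_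
  rw [mem_range] at hj
  rw [h i j (by omega)]

theorem mean_add {K : ℕ} (f g : Grid K) : mean (fun i j => f i j + g i j) = mean f + mean g := by
  unfold mean ip
  simp only [add_mul, mul_add, sum_add_distrib]

theorem mean_smul {K : ℕ} (c : ℝ) (f : Grid K) : mean (fun i j => c * f i j) = c * mean f := by
  unfold mean ip
  simp only [mul_sum]
  refine sum_congr rfl fun i _ => sum_congr rfl fun j _ => ?_
  ring

theorem mean_one {K : ℕ} : mean (fun _ _ => 1 : Grid K) = 1 := by
  unfold mean ip
  have wj : ∀ j ∈ range (2 * K), wt K (j + 1) = 1 := by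
    intro j hj; rw [mem_range] at hj; simp [wt, cells]; omega
  have w0 : wt K 0 = 1 / 2 := by simp [wt]
  have wN : wt K (2 * K + 1) = 1 / 2 := by simp [wt]
  have : ∑ j ∈ range (cells K + 1), wt K j * ((1 : ℝ) * 1) = cells K := by
    have e1 : cells K + 1 = 2 * K + 1 + 1 := rfl
    simp only [mul_one]
    rw [e1, sum_range_succ, sum_range_succ', sum_congr rfl wj, w0, wN]
    simp [cells]; ring
  simp only [this, sum_const, card_univ, ZMod.card, nsmul_eq_mul, mesh]
  have : (cells K : ℝ) ≠ 0 := by positivity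
  field_simp

theorem negLap_add {K : ℕ} (f g : Grid K) (i : ZMod (cells K)) (j : ℤ) :
    negLap (fun i j => f i j + g i j) i j = negLap f i j + negLap g i j := by
  unfold negLap lapH D2x D2y; split_ifs <;> ring

theorem negLap_smul {K : ℕ} (c : ℝ) (f : Grid K) (i : ZMod (cells K)) (j : ℤ) :
    negLap (fun i j => c * f i j) i j = c * negLap f i j := by
  unfold negLap lapH D2x D2y; split_ifs <;> ring

/-- The mean-zero solution of `L_h ψ = f` is unique on the nodes. -/
theorem isNegLapInv_unique {K : ℕ} {f ψ χ : Grid K} (hψ : IsNegLapInv f ψ)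
    (hχ : IsNegLapInv f χ) (i : ZMod (cells K)) (j : ℕ) (hj : j ≤ cells K) :
    ψ i j = χ i j := by
  set d : Grid K := fun i j => ψ i j + (-1) * χ i j with hd
  have hc := const_of_negLap d fun i j h0 h1 => by
    rw [hd, negLap_add ψ (fun i j => (-1) * χ i j), negLap_smul, hψ.2 i j h0 h1,
      hχ.2 i j h0 h1]; ring
  have hm : mean d = 0 := by
    rw [hd, mean_add ψ (fun i j => (-1) * χ i j), mean_smul, hψ.1, hχ.1]; ring
  have hm2 : mean d = d 0 0 := by
    rw [mean_congr d (fun i j => d 0 0 * (1 : ℝ)) (fun i j hj => by rw [hc i j hj, mul_one]),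
      mean_smul, mean_one, mul_one]
  have := hc i j hj
  rw [← hm2, hm] at this
  simp only [hd] at this
  linarith

/-- `L_h ψ = f` has a mean-zero solution if `f` has mean zero. -/
theorem exists_isNegLapInv {K : ℕ} (f : Grid K) (hf : mean f = 0) : ∃ ψ, IsNegLapInv f ψ := by
  let E : (ZMod (cells K) → Fin (cells K + 1) → ℝ) → Grid K :=
    fun v i j => v i (Fin.ofNat (cells K + 1) j.toNat)
  have hE : ∀ (g : Grid K) (i : ZMod (cells K)) (j : ℕ), j ≤ cells K →
      E (fun i j => g i (j : ℕ)) i j = g i j := by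
    intro g i j hj
    simp only [E, Int.toNat_natCast, Fin.val_ofNat]
    rw [Nat.mod_eq_of_lt (by omega)]
  let A : (ZMod (cells K) → Fin (cells K + 1) → ℝ) →ₗ[ℝ]
      (ZMod (cells K) → Fin (cells K + 1) → ℝ) :=
    { toFun := fun v i j => negLap (E v) i (j : ℕ) + mean (E v)
      map_add' := fun v w => by
        funext i j
        have h : E (v + w) = fun i j => E v i j + E w i j := rfl
        simp only [h, negLap_add (E v) (E w), mean_add (E v) (E w), Pi.add_apply]; ring
      map_smul' := fun c v => by
        funext i j
        have h : E (c • v) = fun i j => c * E v i j := rfl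
        simp only [h, negLap_smul c (E v), mean_smul c (E v), Pi.smul_apply, smul_eq_mul,
          RingHom.id_apply]; ring }
  have hmean : ∀ v g, (∀ (i : ZMod (cells K)) (j : ℕ), j ≤ cells K →
      negLap (E v) i j + mean (E v) = g i j) → mean g = mean (E v) := by
    intro v g h
    rw [← mean_congr (fun i j => negLap (E v) i j + mean (E v)) g h, mean_add (negLap (E v)) (fun _ _ => mean (E v)), mean_negLap]
    have := mean_smul (K := K) (mean (E v)) (fun _ _ => 1)
    simp only [mul_one, mean_one] at this
    rw [this, zero_add]
  have hA : Function.Injective A := by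
    rw [injective_iff_map_eq_zero]
    intro v hv
    have h1 : ∀ (i : ZMod (cells K)) (j : ℕ), j ≤ cells K →
        negLap (E v) i j + mean (E v) = 0 := fun i j hj =>
      congrFun (congrFun hv i) ⟨j, by omega⟩
    have h2 : mean (E v) = 0 := by
      rw [← hmean v (fun _ _ => 0) h1]; simp [mean, ip]
    have h3 : IsNegLapInv (fun _ _ => 0) (E v) := by
      refine ⟨h2, fun i j h0 hj => ?_⟩
      lift j to ℕ using h0
      have := h1 i j (by omega)
      linarith
    have h4 : IsNegLapInv (K := K) (fun _ _ => 0) (fun _ _ => 0) := by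
      refine ⟨by simp [mean, ip], fun i j _ _ => by simp [negLap, lapH, D2x, D2y]⟩
    funext i j
    have := isNegLapInv_unique h3 h4 i j (by omega)
    simpa [E] using this
  obtain ⟨v, hv⟩ := LinearMap.injective_iff_surjective.1 hA (fun i j => f i (j : ℕ))
  have h1 : ∀ (i : ZMod (cells K)) (j : ℕ), j ≤ cells K →
      negLap (E v) i j + mean (E v) = f i j := fun i j hj =>
    congrFun (congrFun hv i) ⟨j, by omega⟩
  have h2 : mean (E v) = 0 := by rw [← hmean v f h1, hf]
  refine ⟨E v, h2, fun i j h0 hj => ?_⟩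
  lift j to ℕ using h0
  have := h1 i j (by omega)
  linarith

theorem bdMean_bdD2x {K : ℕ} (u : BdGrid K) : bdMean (bdD2x u) = 0 := by
  have h := sum_parts_x (fun _ => (1 : ℝ)) u
  simp only [sub_self, zero_mul, sum_const_zero, one_mul] at h
  have : ∑ i, bdD2x u i * 1 = -(∑ i, (2 * u i - u (i + 1) - u (i - 1))) / mesh K ^ 2 := by
    rw [← sum_neg_distrib, sum_div]
    exact sum_congr rfl fun i _ => by unfold bdD2x; ring
  unfold bdMean bdIp
  rw [this, h]; simp

theorem bdMean_const {K : ℕ} (c : ℝ) : bdMean (fun _ => c : BdGrid K) = c := by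
  unfold bdMean bdIp
  simp only [sum_const, card_univ, ZMod.card, nsmul_eq_mul, mesh]
  have : (cells K : ℝ) ≠ 0 := by positivity
  field_simp

theorem const_of_bdD2x {K : ℕ} (u : BdGrid K) (h : ∀ i, bdD2x u i = 0) (i : ZMod (cells K)) :
    u i = u 0 := by
  have hs := sum_parts_x u u
  have hz : ∀ i, 2 * u i - u (i + 1) - u (i - 1) = 0 := by
    intro i
    have := h i
    unfold bdD2x at this
    have := (div_eq_zero_iff.1 this).resolve_right (pow_ne_zero 2 (mesh_pos K).ne')
    linarith
  simp only [hz, mul_zero, sum_const_zero] at hs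
  refine const_of_x u (fun i => ?_) i
  have := (sum_eq_zero_iff_of_nonneg fun i _ => mul_self_nonneg _).1 hs.symm i (mem_univ _)
  linarith [mul_self_eq_zero.1 this]

theorem bdMean_add {K : ℕ} (f g : BdGrid K) : bdMean (f + g) = bdMean f + bdMean g := by
  unfold bdMean bdIp
  simp only [Pi.add_apply, add_mul, sum_add_distrib, mul_add]

theorem bdMean_smul {K : ℕ} (c : ℝ) (f : BdGrid K) : bdMean (c • f) = c * bdMean f := by
  unfold bdMean bdIp
  simp only [mul_sum, Pi.smul_apply, smul_eq_mul]
  exact sum_congr rfl fun i _ => by ring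

theorem bdD2x_add {K : ℕ} (f g : BdGrid K) : bdD2x (f + g) = bdD2x f + bdD2x g := by
  funext i; simp only [bdD2x, Pi.add_apply]; ring

theorem bdD2x_smul {K : ℕ} (c : ℝ) (f : BdGrid K) : bdD2x (c • f) = c • bdD2x f := by
  funext i; simp only [bdD2x, Pi.smul_apply, smul_eq_mul]; ring

/-- The mean-zero solution of `-D_x² ψ = f` is unique. -/
theorem isBdNegLapInv_unique {K : ℕ} {f ψ χ : BdGrid K} (hψ : IsBdNegLapInv f ψ)
    (hχ : IsBdNegLapInv f χ) : ψ = χ := by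
  have hc := const_of_bdD2x (ψ + (-1 : ℝ) • χ) fun i => by
    have h1 := hψ.2 i
    have h2 := hχ.2 i
    rw [bdD2x_add, bdD2x_smul]
    simp only [Pi.add_apply, Pi.smul_apply, smul_eq_mul]
    linarith
  have hm : bdMean (ψ + (-1 : ℝ) • χ) = 0 := by
    rw [bdMean_add, bdMean_smul, hψ.1, hχ.1]; ring
  have h3 : ψ + (-1 : ℝ) • χ = fun _ => (ψ + (-1 : ℝ) • χ) 0 := funext hc
  rw [h3, bdMean_const] at hm
  funext i
  have := hc i
  rw [hm] at this
  simp only [Pi.add_apply, Pi.smul_apply, smul_eq_mul] at this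
  linarith

/-- `-D_x² ψ = f` has a mean-zero solution if `f` has mean zero. -/
theorem exists_isBdNegLapInv {K : ℕ} (f : BdGrid K) (hf : bdMean f = 0) :
    ∃ ψ, IsBdNegLapInv f ψ := by
  let A : BdGrid K →ₗ[ℝ] BdGrid K :=
    { toFun := fun v => (-1 : ℝ) • bdD2x v + fun _ => bdMean v
      map_add' := fun v w => by
        funext i
        simp only [bdD2x_add, bdMean_add, Pi.add_apply, Pi.smul_apply, smul_eq_mul]; ring
      map_smul' := fun c v => by
        funext i
        simp only [bdD2x_smul, bdMean_smul, Pi.add_apply, Pi.smul_apply, smul_eq_mul,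
          RingHom.id_apply]; ring }
  have hmean : ∀ v, bdMean (A v) = bdMean v := fun v => by
    change bdMean ((-1 : ℝ) • bdD2x v + fun _ => bdMean v) = bdMean v
    rw [bdMean_add, bdMean_smul, bdMean_bdD2x, bdMean_const]; ring
  have hsol : ∀ v g, bdMean g = 0 → A v = g → IsBdNegLapInv g v := by
    intro v g hg h
    have h0 : bdMean v = 0 := by rw [← hmean v, h, hg]
    refine ⟨h0, fun i => ?_⟩
    have : (-1 : ℝ) * bdD2x v i + bdMean v = g i := congrFun h i
    linarith
  have hA : Function.Injective A := by
    rw [injective_iff_map_eq_zero]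
    intro v hv
    refine isBdNegLapInv_unique (f := 0) (hsol v 0 (bdMean_const 0) hv)
      (hsol 0 0 (bdMean_const 0) (map_zero A))
  obtain ⟨v, hv⟩ := LinearMap.injective_iff_surjective.1 hA f
  exact ⟨v, hsol v f hf hv⟩

/-! ### The scheme -/

/-- One step `φ ↦ φ'` of the first order convex-splitting scheme: `μ, μB, μT` are the discrete
chemical potentials, the values at the ghost points are determined by the equations, and the
arguments of the logarithms are positive. -/
def SchemeStep {K : ℕ} (ε κ θ₀ Δt : ℝ) (φ φ' : Grid K) : Prop :=
  ∃ (μ : Grid K) (μB μT : BdGrid K),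
    (∀ (i : ZMod (cells K)) (j : ℤ), 0 ≤ j → j ≤ cells K →
      (-1 < φ' i j ∧ φ' i j < 1) ∧
      (φ' i j - φ i j) / Δt = lapH μ i j ∧
      μ i j = Real.log (1 + φ' i j) - Real.log (1 - φ' i j) - θ₀ * φ i j
        - ε ^ 2 * lapH φ' i j) ∧
    (∀ i, longDy μ i 0 = 0 ∧ longDy μ i (cells K) = 0) ∧
    (∀ i, (bot φ' i - bot φ i) / Δt = bdD2x μB i) ∧
    (∀ i, (top φ' i - top φ i) / Δt = bdD2x μT i) ∧
    (∀ i, μB i = Real.log (1 + bot φ' i) - Real.log (1 - bot φ' i) - θ₀ * bot φ i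
        - κ * ε * bdD2x (bot φ') i - ε ^ 2 * longDy φ' i 0) ∧
    (∀ i, μT i = Real.log (1 + top φ' i) - Real.log (1 - top φ' i) - θ₀ * top φ i
        - κ * ε * bdD2x (top φ') i + ε ^ 2 * longDy φ' i (cells K))

/-! ### The corrected exact solution -/

/-- Fourier projection in `x` onto trigonometric polynomials of degree `≤ K`. (For real `f` the
sum is real.) -/
noncomputable def projX (K : ℕ) (f : ℝ → ℝ → ℝ) (x y : ℝ) : ℝ :=
  (∑ k ∈ Icc (-(K : ℤ)) K,
    fourierCoeffOn (zero_lt_one (α := ℝ)) (fun s => ((f s y : ℝ) : ℂ)) k *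
      Complex.exp (2 * Real.pi * Complex.I * k * x)).re

/-- The auxiliary function `δΦ`. -/
noncomputable def auxFun (K : ℕ) (Φ : ℝ → ℝ → ℝ → ℝ) (t _x y : ℝ) : ℝ :=
  (mean (sample K (projX K (Φ t))) - mean (sample K (projX K (Φ 0)))) *
    (1 - Real.cos (2 * Real.pi * y))

/-- Grid values of the corrected solution `Φ_N - δΦ` at time `t`. -/
noncomputable def corrected (K : ℕ) (Φ : ℝ → ℝ → ℝ → ℝ) (t : ℝ) : Grid K :=
  sample K fun x y => projX K (Φ t) x y - auxFun K Φ t x y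

/-- The error grid function at step `n`. -/
noncomputable def err {K : ℕ} (Φ : ℝ → ℝ → ℝ → ℝ) (Δt : ℝ) (φ : ℕ → Grid K) (n : ℕ) : Grid K :=
  fun i j => corrected K Φ (n * Δt) i j - φ n i j

/-! The scheme is compared with the corrected projection of the exact solution, which satisfies the
same scheme up to residuals. Stability in discrete `H⁻¹` then turns the size of the residuals into
the size of the error.

Stability (`energy_step`, `energy_gronwall`). The ghost values are eliminated: on the boundary rows
the five-point Laplacian is `-L_h` plus a flux term of weight `2/h`. The error equations in the bulk
and on the two sections are tested with the inverse Laplacians of the new error. The logarithms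
contribute a nonnegative term because they are monotone, so the numerical solution need not stay
uniformly away from `±1`. The explicit term `θ₀ φⁿ` is interpolated between `H⁻¹` and `H¹`. The bulk
flux term, summed with the quadrature weight `h/2`, becomes a boundary pairing that cancels exactly
against the normal derivatives in the surface potentials. What remains is `H⁻¹` growth, dissipation
and squared residuals, to which a discrete Gronwall inequality applies.

Boundary rows. The truncation error of the bulk evolution equation is only of order `h` on the rows
`y = 0, 1`. Each of these rows has weight `h/2`, and every row of a mean-zero grid function is
controlled by the discrete gradient (`row_poincare`). Hence a residual of size `s/h` there costs no
more than one of size `s` inside (`abs_ip_le_of_rows`). In the potential equation the discrete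
normal derivative of the comparison function is free, and it is chosen so that the boundary
Laplacian has no error at all. It still approximates `∂_yΦ` to order `h²`, because the error of
order `h` is multiplied by `h/2`.

Projection. On each row the Fourier projection commutes with translation by `h`, hence with the
difference operators, and it is bounded from the supremum norm to the discrete `ℓ²` norm by Parseval
and Bessel (`bdIp_rowProj_le`). So truncation errors are estimated pointwise for the exact solution
and then projected. Only the logarithm does not commute with the projection; there both sides are
compared with `log` of the exact solution (`partialSum_logPart`).

Masses. The negative norms require errors of mean zero. On the boundary sections the discrete mean
of the projection is the exact integral, which is conserved. In the bulk the trapezoidal mass drifts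
by `O(Δt + h²)`; the correction `δΦ` removes the drift exactly, and its profile `1 - cos 2πy`
vanishes on the boundary.

Time. The `C⁶` bounds and the differential equation are available only at almost every time, whereas
the scheme needs every `nΔt`. All truncation estimates are inequalities between quantities
continuous in time, so they extend to all times (`exists_consistent`). The second time derivative is
only in `L²(0,T)`; the backward difference errors are then square summable with `Δt ∑ τ_k² ≤ C Δt²`,
which suffices for Gronwall. -/

/-! ### Discrete summation by parts, means and negative norms -/

/-- Weighted average over the rows of the grid. -/
noncomputable def rowSum (K : ℕ) (a : ℕ → ℝ) : ℝ :=
  mesh K * ∑ j ∈ range (cells K + 1), wt K j * a j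

theorem mesh_mul_cells (K : ℕ) : mesh K * (cells K : ℝ) = 1 := by
  unfold mesh
  have : (cells K : ℝ) ≠ 0 := by positivity
  field_simp

theorem sum_wt (K : ℕ) : ∑ j ∈ range (cells K + 1), wt K j = cells K := by
  have wj : ∀ j ∈ range (2 * K), wt K (j + 1) = 1 := by
    intro j hj; rw [mem_range] at hj; simp [wt, cells]; omega
  have w0 : wt K 0 = 1 / 2 := by simp [wt]
  have wN : wt K (2 * K + 1) = 1 / 2 := by simp [wt]
  have e1 : cells K + 1 = 2 * K + 1 + 1 := rfl
  rw [e1, sum_range_succ, sum_range_succ', sum_congr rfl wj, w0, wN]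
  simp [cells]; ring

theorem rowSum_const (K : ℕ) (c : ℝ) : rowSum K (fun _ => c) = c := by
  unfold rowSum
  rw [← sum_mul, sum_wt, ← mul_assoc, mesh_mul_cells, one_mul]

theorem rowSum_mono {K : ℕ} {a b : ℕ → ℝ} (h : ∀ j ≤ cells K, a j ≤ b j) :
    rowSum K a ≤ rowSum K b := by
  unfold rowSum
  refine mul_le_mul_of_nonneg_left (sum_le_sum fun j hj => ?_) (mesh_pos K).le
  rw [mem_range] at hj
  exact mul_le_mul_of_nonneg_left (h j (by omega)) (wt_pos K j).le

theorem rowSum_congr {K : ℕ} {a b : ℕ → ℝ} (h : ∀ j ≤ cells K, a j = b j) :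
    rowSum K a = rowSum K b :=
  le_antisymm (rowSum_mono fun j hj => (h j hj).le) (rowSum_mono fun j hj => (h j hj).ge)

theorem rowSum_add {K : ℕ} (a b : ℕ → ℝ) :
    rowSum K (fun j => a j + b j) = rowSum K a + rowSum K b := by
  unfold rowSum; simp only [mul_add, sum_add_distrib]

theorem rowSum_smul {K : ℕ} (c : ℝ) (a : ℕ → ℝ) :
    rowSum K (fun j => c * a j) = c * rowSum K a := by
  unfold rowSum
  simp only [mul_sum]
  exact sum_congr rfl fun j _ => by ring

theorem ip_eq_rowSum {K : ℕ} (f g : Grid K) :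
    ip f g = rowSum K fun j => bdIp (fun i => f i j) (fun i => g i j) := by
  unfold ip rowSum bdIp
  rw [sum_comm, pow_two, mul_assoc, mul_sum]
  congr 1
  refine sum_congr rfl fun j _ => ?_
  simp only [mul_sum]
  exact sum_congr rfl fun i _ => by ring

/-- A weight function supported on the two boundary rows. -/
theorem rowSum_ends {K : ℕ} (a b : ℝ) :
    rowSum K (fun j => if j = 0 then a else if j = cells K then b else 0)
      = mesh K / 2 * (a + b) := by
  unfold rowSum
  have e1 : cells K + 1 = 2 * K + 1 + 1 := rfl
  have w0 : wt K 0 = 1 / 2 := by simp [wt]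
  have wN : wt K (2 * K + 1) = 1 / 2 := by simp [wt]
  have hz : ∀ j ∈ range (2 * K), wt K (j + 1) *
      (if j + 1 = 0 then a else if j + 1 = cells K then b else 0) = 0 := by
    intro j hj; rw [mem_range] at hj
    rw [if_neg (by omega), if_neg (by simp only [cells]; omega), mul_zero]
  rw [e1, sum_range_succ, sum_range_succ', sum_congr rfl hz, w0, wN]
  simp [cells]; ring

theorem bdIp_comm {K : ℕ} (f g : BdGrid K) : bdIp f g = bdIp g f := by
  unfold bdIp; simp only [mul_comm]

theorem bdIp_add_left {K : ℕ} (f g k : BdGrid K) :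
    bdIp (fun i => f i + g i) k = bdIp f k + bdIp g k := by
  unfold bdIp; simp only [add_mul, sum_add_distrib, mul_add]

theorem bdIp_smul_left {K : ℕ} (c : ℝ) (f g : BdGrid K) :
    bdIp (fun i => c * f i) g = c * bdIp f g := by
  unfold bdIp; simp only [mul_sum]; exact sum_congr rfl fun i _ => by ring

theorem bdIp_self_nonneg {K : ℕ} (f : BdGrid K) : 0 ≤ bdIp f f :=
  mul_nonneg (mesh_pos K).le (sum_nonneg fun _ _ => mul_self_nonneg _)

theorem bdIp_nonneg {K : ℕ} {f g : BdGrid K} (h : ∀ i, 0 ≤ f i * g i) : 0 ≤ bdIp f g :=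
  mul_nonneg (mesh_pos K).le (sum_nonneg fun i _ => h i)

/-- Cauchy-Schwarz with majorants in place of norms, so that callers need not handle square roots.
-/
theorem abs_bdIp_le {K : ℕ} {f g : BdGrid K} {a b : ℝ} (ha : 0 ≤ a) (hb : 0 ≤ b)
    (hf : bdIp f f ≤ a ^ 2) (hg : bdIp g g ≤ b ^ 2) : |bdIp f g| ≤ a * b := by
  refine abs_le_of_sq_le_sq ?_ (mul_nonneg ha hb)
  have h1 : bdIp f g ^ 2 ≤ bdIp f f * bdIp g g := by
    unfold bdIp
    have := sum_mul_sq_le_sq_mul_sq (univ : Finset (ZMod (cells K))) f g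
    have h2 := mul_le_mul_of_nonneg_left this (sq_nonneg (mesh K))
    simp only [pow_two] at h2 ⊢
    nlinarith [h2]
  rw [mul_pow]
  exact h1.trans (mul_le_mul hf hg (bdIp_self_nonneg g) (sq_nonneg a))

theorem bdIp_add_self_le {K : ℕ} {f g : BdGrid K} {a b : ℝ} (ha : 0 ≤ a) (hb : 0 ≤ b)
    (hf : bdIp f f ≤ a ^ 2) (hg : bdIp g g ≤ b ^ 2) :
    bdIp (fun i => f i + g i) (fun i => f i + g i) ≤ (a + b) ^ 2 := by
  have h := (abs_le.1 (abs_bdIp_le ha hb hf hg)).2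
  have h1 : bdIp (fun i => f i + g i) (fun i => f i + g i) = bdIp f f + 2 * bdIp f g + bdIp g g := by
    rw [bdIp_add_left, bdIp_comm f, bdIp_comm g, bdIp_add_left, bdIp_add_left, bdIp_comm g f]; ring
  rw [h1]; nlinarith

theorem bdIp_self_le_of_abs_le {K : ℕ} {f : BdGrid K} {a : ℝ} (hf : ∀ i, |f i| ≤ a) :
    bdIp f f ≤ a ^ 2 := by
  have h : ∑ i, f i * f i ≤ ∑ _i : ZMod (cells K), a ^ 2 := sum_le_sum fun i _ => by
    rw [← pow_two]; exact sq_le_sq' (by linarith [(abs_le.1 (hf i)).1]) (abs_le.1 (hf i)).2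
  unfold bdIp
  refine (mul_le_mul_of_nonneg_left h (mesh_pos K).le).trans (le_of_eq ?_)
  rw [sum_const, card_univ, ZMod.card, nsmul_eq_mul, ← mul_assoc, mesh_mul_cells, one_mul]

theorem bdIp_smul_self_le {K : ℕ} {f : BdGrid K} {a c : ℝ}
    (hf : bdIp f f ≤ a ^ 2) : bdIp (fun i => c * f i) (fun i => c * f i) ≤ (|c| * a) ^ 2 := by
  rw [bdIp_smul_left, bdIp_comm, bdIp_smul_left, mul_pow, sq_abs]
  nlinarith [sq_nonneg c]

theorem ip_comm {K : ℕ} (f g : Grid K) : ip f g = ip g f := by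
  unfold ip; simp only [mul_comm (f _ _)]

theorem ip_add_left {K : ℕ} (f g k : Grid K) :
    ip (fun i j => f i j + g i j) k = ip f k + ip g k := by
  unfold ip; simp only [add_mul, mul_add, sum_add_distrib]

theorem ip_smul_left {K : ℕ} (c : ℝ) (f g : Grid K) :
    ip (fun i j => c * f i j) g = c * ip f g := by
  unfold ip
  simp only [mul_sum]
  exact sum_congr rfl fun i _ => sum_congr rfl fun j _ => by ring

theorem ip_congr {K : ℕ} {f f' g g' : Grid K}
    (hf : ∀ (i : ZMod (cells K)) (j : ℕ), j ≤ cells K → f i j = f' i j)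
    (hg : ∀ (i : ZMod (cells K)) (j : ℕ), j ≤ cells K → g i j = g' i j) : ip f g = ip f' g' := by
  unfold ip
  congr 1
  refine sum_congr rfl fun i _ => sum_congr rfl fun j hj => ?_
  rw [mem_range] at hj
  rw [hf i j (by omega), hg i j (by omega)]

theorem ip_negLap_comm {K : ℕ} (v u : Grid K) : ip v (negLap u) = ip u (negLap v) := by
  rw [ip_negLap, ip_negLap]
  congr 1 <;> refine sum_congr rfl fun _ _ => ?_
  · congr 1; exact sum_congr rfl fun _ _ => mul_comm _ _
  · exact sum_congr rfl fun _ _ => mul_comm _ _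

theorem gradSq_eq {K : ℕ} (u : Grid K) :
    gradSq u = ∑ j ∈ range (cells K + 1), wt K j *
          ∑ i : ZMod (cells K), (u (i + 1) j - u i j) * (u (i + 1) j - u i j) +
        ∑ i : ZMod (cells K), ∑ j ∈ range (cells K),
          (u i (j + 1) - u i j) * (u i (j + 1) - u i j) := by
  have hm : mesh K ≠ 0 := (mesh_pos K).ne'
  unfold gradSq ip
  congr 1
  · rw [sum_comm, mul_sum]
    refine sum_congr rfl fun j _ => ?_
    have h1 : ∑ i : ZMod (cells K), (Dx u i j * Dx u i j + Dx u (i - 1) j * Dx u (i - 1) j)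
        = 2 * ∑ i : ZMod (cells K), Dx u i j * Dx u i j := by
      rw [sum_add_distrib, two_mul (∑ i : ZMod (cells K), Dx u i j * Dx u i j)]
      congr 1
      exact Equiv.sum_comp (Equiv.subRight (1 : ZMod (cells K))) fun i => Dx u i j * Dx u i j
    have h2 : ∑ i : ZMod (cells K), wt K j * (avgX (fun i j => Dx u i j * Dx u i j) i j * 1)
        = wt K j * ∑ i : ZMod (cells K), Dx u i j * Dx u i j := by
      rw [show ∑ i : ZMod (cells K), Dx u i j * Dx u i j = (1 / 2) *
        ∑ i : ZMod (cells K), (Dx u i j * Dx u i j + Dx u (i - 1) j * Dx u (i - 1) j) by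
          rw [h1]; ring, mul_sum, mul_sum]
      refine sum_congr rfl fun i _ => ?_
      simp only [avgX]; ring
    rw [h2, mul_left_comm]
    congr 1
    rw [mul_sum]
    refine sum_congr rfl fun i _ => ?_
    simp only [Dx]; field_simp
  · rw [mul_sum]
    refine sum_congr rfl fun i _ => ?_
    rw [mul_sum]
    refine sum_congr rfl fun j _ => ?_
    simp only [Dy]; field_simp

theorem ip_negLap_self {K : ℕ} (u : Grid K) : ip u (negLap u) = gradSq u := by
  rw [ip_negLap, gradSq_eq]

theorem gradSq_nonneg {K : ℕ} (u : Grid K) : 0 ≤ gradSq u := by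
  rw [gradSq_eq]
  exact add_nonneg (sum_nonneg fun j _ => mul_nonneg (wt_pos K j).le
    (sum_nonneg fun i _ => mul_self_nonneg _))
    (sum_nonneg fun i _ => sum_nonneg fun j _ => mul_self_nonneg _)

/-- Cauchy-Schwarz and Young for the Dirichlet form in one step: expand `gradSq (c v - σ u) ≥ 0`
with `σ = ±1` and divide by `c`. -/
theorem ip_negLap_le {K : ℕ} (v u : Grid K) {c : ℝ} (hc : 0 < c) :
    2 * |ip v (negLap u)| ≤ c * gradSq v + gradSq u / c := by
  have key : ∀ σ : ℝ, σ ^ 2 = 1 → 2 * (σ * ip v (negLap u)) ≤ c * gradSq v + gradSq u / c := by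
    intro σ hσ
    have h := gradSq_nonneg (fun i j => c * v i j + (-σ) * u i j)
    rw [← ip_negLap_self, ip_add_left (fun i j => c * v i j) (fun i j => (-σ) * u i j),
      ip_smul_left, ip_smul_left, ip_negLap_comm, ip_negLap_comm u,
      ip_add_left (fun i j => c * v i j) (fun i j => (-σ) * u i j), ip_smul_left, ip_smul_left,
      ip_add_left (fun i j => c * v i j) (fun i j => (-σ) * u i j), ip_smul_left, ip_smul_left,
      ip_negLap_self, ip_negLap_self, ip_negLap_comm u v] at h
    have h2 : c * gradSq v + gradSq u / c - 2 * (σ * ip v (negLap u)) =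
      (c * (c * gradSq v + -σ * ip v (negLap u)) + -σ * (c * ip v (negLap u) + -σ * gradSq u)) / c
      := by
      field_simp; linear_combination (-gradSq u) * hσ
    have := div_nonneg h hc.le
    linarith
  rcases abs_cases (ip v (negLap u)) with ⟨h, _⟩ | ⟨h, _⟩ <;> rw [h]
  · have := key 1 (by norm_num); linarith
  · have := key (-1) (by norm_num); linarith

theorem IsNegLapInv.ip_eq {K : ℕ} {f ψ : Grid K} (h : IsNegLapInv f ψ) (g : Grid K) :
    ip g f = ip g (negLap ψ) :=
  ip_congr (fun _ _ _ => rfl) fun i j hj => (h.2 i j (by omega) (by omega)).symm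

theorem negNorm_nonneg {K : ℕ} (f : Grid K) : 0 ≤ negNorm f := Real.sqrt_nonneg _

/-- The choice made by `Classical.epsilon` is immaterial, since solutions agree on the nodes.
Summation by parts gives `(f, ψ) = (L_h ψ, ψ)`. -/
theorem negNorm_sq {K : ℕ} {f ψ : Grid K} (h : IsNegLapInv f ψ) : negNorm f ^ 2 = gradSq ψ := by
  have hε : IsNegLapInv f (Classical.epsilon (IsNegLapInv f)) :=
    Classical.epsilon_spec ⟨ψ, h⟩
  have h1 : ip f (Classical.epsilon (IsNegLapInv f)) = gradSq ψ := by
    rw [ip_congr (fun _ _ _ => rfl) (isNegLapInv_unique hε h), ip_comm, h.ip_eq, ip_negLap_self]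
  rw [negNorm, Real.sq_sqrt] <;> rw [h1]
  exact gradSq_nonneg ψ

/-! ### The boundary sections -/

theorem bdIp_bdD2x {K : ℕ} (v u : BdGrid K) :
    bdIp v (fun i => -bdD2x u i) =
      mesh K * ∑ i : ZMod (cells K), (v (i + 1) - v i) / mesh K * ((u (i + 1) - u i) / mesh K) := by
  have hm : mesh K ≠ 0 := (mesh_pos K).ne'
  unfold bdIp
  congr 1
  have h := sum_parts_x v u
  have e1 : ∑ i : ZMod (cells K), (v (i + 1) - v i) / mesh K * ((u (i + 1) - u i) / mesh K)
      = (∑ i, (v (i + 1) - v i) * (u (i + 1) - u i)) / mesh K ^ 2 := by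
    rw [sum_div]; exact sum_congr rfl fun i _ => by field_simp
  rw [e1, ← h, sum_div]
  refine sum_congr rfl fun i _ => ?_
  unfold bdD2x; ring

theorem bdIp_bdD2x_comm {K : ℕ} (v u : BdGrid K) :
    bdIp v (fun i => -bdD2x u i) = bdIp u (fun i => -bdD2x v i) := by
  rw [bdIp_bdD2x, bdIp_bdD2x]; simp only [mul_comm ((v _ - v _) / _)]

theorem bdIp_bdD2x_self {K : ℕ} (u : BdGrid K) :
    bdIp u (fun i => -bdD2x u i) = bdGradSq u := by
  rw [bdIp_bdD2x]; simp only [bdGradSq, pow_two]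

theorem bdGradSq_nonneg {K : ℕ} (u : BdGrid K) : 0 ≤ bdGradSq u :=
  mul_nonneg (mesh_pos K).le (sum_nonneg fun _ _ => sq_nonneg _)

theorem bdIp_bdD2x_le {K : ℕ} (v u : BdGrid K) {c : ℝ} (hc : 0 < c) :
    2 * |bdIp v (fun i => -bdD2x u i)| ≤ c * bdGradSq v + bdGradSq u / c := by
  have key : ∀ σ : ℝ, σ ^ 2 = 1 →
      2 * (σ * bdIp v (fun i => -bdD2x u i)) ≤ c * bdGradSq v + bdGradSq u / c := by
    intro σ hσ
    rw [bdIp_bdD2x, bdGradSq, bdGradSq]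
    have : ∀ a b : ℝ, 2 * (σ * (a * b)) ≤ c * a ^ 2 + b ^ 2 / c := by
      intro a b
      have h : c * a ^ 2 + b ^ 2 / c - 2 * (σ * (a * b)) = (c * a - σ * b) ^ 2 / c := by
        field_simp; linear_combination (-b ^ 2) * hσ
      have : 0 ≤ (c * a - σ * b) ^ 2 / c := by positivity
      linarith
    have h := sum_le_sum fun (i : ZMod (cells K)) (_ : i ∈ univ) =>
      this ((v (i + 1) - v i) / mesh K) ((u (i + 1) - u i) / mesh K)
    rw [sum_add_distrib, ← mul_sum, ← mul_sum, ← mul_sum, ← sum_div] at h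
    have h2 := mul_le_mul_of_nonneg_left h (mesh_pos K).le
    calc _ = mesh K * (2 * (σ * ∑ i : ZMod (cells K),
          (v (i + 1) - v i) / mesh K * ((u (i + 1) - u i) / mesh K))) := by ring
      _ ≤ _ := h2
      _ = _ := by ring
  rcases abs_cases (bdIp v (fun i => -bdD2x u i)) with ⟨h, _⟩ | ⟨h, _⟩ <;> rw [h]
  · have := key 1 (by norm_num); linarith
  · have := key (-1) (by norm_num); linarith

theorem bdNegNorm_sq {K : ℕ} {f ψ : BdGrid K} (h : IsBdNegLapInv f ψ) :
    bdNegNorm f ^ 2 = bdGradSq ψ := by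
  have hε : IsBdNegLapInv f (Classical.epsilon (IsBdNegLapInv f)) :=
    Classical.epsilon_spec ⟨ψ, h⟩
  have h1 : bdIp f (Classical.epsilon (IsBdNegLapInv f)) = bdGradSq ψ := by
    rw [isBdNegLapInv_unique hε h, bdIp_comm, ← bdIp_bdD2x_self]
    congr 1; funext i; exact (h.2 i).symm
  rw [bdNegNorm, Real.sq_sqrt] <;> rw [h1]
  exact bdGradSq_nonneg ψ

theorem surfNegNorm_nonneg {K : ℕ} (f : Grid K) : 0 ≤ surfNegNorm f := Real.sqrt_nonneg _

theorem surfNegNorm_sq {K : ℕ} (f : Grid K) :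
    surfNegNorm f ^ 2 = bdNegNorm (top f) ^ 2 + bdNegNorm (bot f) ^ 2 :=
  Real.sq_sqrt (by positivity)

/-! ### Poincaré and trace inequalities -/

/-- Telescope along the forward path from `k` to `i` on the cycle. The path has fewer than `n`
edges, all distinct, so Cauchy-Schwarz applies and the edge sum is part of the full one. -/
theorem sq_sub_le_card_mul_sum {n : ℕ} [NeZero n] (u : ZMod n → ℝ) (i k : ZMod n) :
    (u i - u k) ^ 2 ≤ n * ∑ l, (u (l + 1) - u l) ^ 2 := by
  have h1 : ∀ m : ℕ, u (k + m) - u k = ∑ l ∈ range m, (u (k + l + 1) - u (k + l)) := by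
    intro m
    induction m with
    | zero => simp
    | succ m ih => rw [sum_range_succ, ← ih]; push_cast; rw [← add_assoc]; ring
  have h2 : u i = u (k + ((i - k).val : ℕ)) := by
    rw [ZMod.natCast_zmod_val]; congr 1; ring
  have hlt := ZMod.val_lt (i - k)
  rw [h2, h1]
  refine sq_sum_le_card_mul_sum_sq.trans ?_
  rw [card_range]
  have h3 : ∑ l ∈ range (i - k).val, (u (k + l + 1) - u (k + l)) ^ 2
      ≤ ∑ l, (u (l + 1) - u l) ^ 2 := by
    rw [← Equiv.sum_comp (Equiv.addLeft k)]
    have hinj : Set.InjOn (fun l : ℕ => (l : ZMod n)) (range (i - k).val) := by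
      intro a ha b hb hab
      simp only [coe_range, Set.mem_Iio] at ha hb
      have := congrArg ZMod.val hab
      rwa [ZMod.val_natCast_of_lt (by omega), ZMod.val_natCast_of_lt (by omega)] at this
    rw [← sum_image (f := fun l : ZMod n => (u (k + l + 1) - u (k + l)) ^ 2) hinj]
    exact sum_le_sum_of_subset_of_nonneg (subset_univ _) fun _ _ _ => sq_nonneg _
  exact mul_le_mul (by exact_mod_cast hlt.le) h3 (sum_nonneg fun _ _ => sq_nonneg _)
    (Nat.cast_nonneg n)

theorem sq_sub_le_mul_sum_range {n : ℕ} (u : ℕ → ℝ) {i k : ℕ} (hi : i ≤ n) (hk : k ≤ n) :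
    (u i - u k) ^ 2 ≤ n * ∑ l ∈ range n, (u (l + 1) - u l) ^ 2 := by
  wlog hik : k ≤ i generalizing i k
  · have := this hk hi (by omega)
    linarith [show (u i - u k) ^ 2 = (u k - u i) ^ 2 by ring]
  have h1 : u i - u k = ∑ l ∈ Ico k i, (u (l + 1) - u l) := by
    rw [sum_Ico_sub u hik]
  rw [h1]
  refine sq_sum_le_card_mul_sum_sq.trans ?_
  rw [Nat.card_Ico]
  refine mul_le_mul (by exact_mod_cast (by omega)) ?_ (sum_nonneg fun _ _ => sq_nonneg _)
    (Nat.cast_nonneg n)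
  refine sum_le_sum_of_subset_of_nonneg (fun l hl => ?_) fun _ _ _ => sq_nonneg _
  rw [mem_Ico] at hl; rw [mem_range]; omega

/-- On a boundary section, the Poincaré inequality. -/
theorem bd_poincare {K : ℕ} {u : BdGrid K} (hu : bdMean u = 0) : bdIp u u ≤ bdGradSq u := by
  have hN := mesh_mul_cells K
  have hm := mesh_pos K
  -- The bound holds pointwise: as the mean vanishes, `u i` is the average of the differences `u i -
  -- u k`.
  have hb : ∀ i, u i * u i ≤ bdGradSq u := by
    intro i
    have h0 : ∑ k, u k = 0 := by
      have : bdMean u = mesh K * ∑ k, u k := by simp [bdMean, bdIp]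
      rw [this] at hu
      exact (mul_eq_zero.1 hu).resolve_left hm.ne'
    have h1 : (cells K : ℝ) * u i = ∑ k, (u i - u k) := by
      rw [sum_sub_distrib, h0, sum_const, card_univ, ZMod.card, nsmul_eq_mul, sub_zero]
    have h2 : ((cells K : ℝ) * u i) ^ 2 ≤ cells K * ∑ k : ZMod (cells K), (u i - u k) ^ 2 := by
      rw [h1]
      refine sq_sum_le_card_mul_sum_sq.trans (le_of_eq ?_)
      rw [card_univ, ZMod.card]
    have h3 : ∑ k : ZMod (cells K), (u i - u k) ^ 2 ≤
        cells K * (cells K * ∑ l, (u (l + 1) - u l) ^ 2) := by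
      refine (sum_le_sum fun k _ => sq_sub_le_card_mul_sum u i k).trans (le_of_eq ?_)
      rw [sum_const, card_univ, ZMod.card, nsmul_eq_mul]
    have h4 : bdGradSq u = cells K * ∑ l, (u (l + 1) - u l) ^ 2 := by
      unfold bdGradSq
      simp only [div_pow, ← sum_div]
      have : (cells K : ℝ) = 1 / mesh K := by field_simp; linarith
      rw [this]; field_simp
    have hc : (0 : ℝ) < cells K := by positivity
    rw [← h4] at h3
    have h5 : (cells K : ℝ) ^ 2 * (u i * u i) ≤ (cells K : ℝ) ^ 2 * bdGradSq u := by nlinarith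
    exact le_of_mul_le_mul_left h5 (by positivity)
  refine (mul_le_mul_of_nonneg_left (sum_le_sum fun i _ => hb i) hm.le).trans (le_of_eq ?_)
  rw [sum_const, card_univ, ZMod.card, nsmul_eq_mul, ← mul_assoc, hN, one_mul]

/-- Jensen's inequality: the row weights have total mass one, and the variance is nonnegative. -/
theorem rowSum_sq_le {K : ℕ} (a : ℕ → ℝ) : rowSum K a ^ 2 ≤ rowSum K fun j => a j ^ 2 := by
  have h : 0 ≤ rowSum K fun j => (a j - rowSum K a) ^ 2 := by
    have := rowSum_mono (K := K) (a := fun _ => 0) (b := fun j => (a j - rowSum K a) ^ 2)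
      fun j _ => sq_nonneg _
    rwa [rowSum_const] at this
  have h2 : (rowSum K fun j => (a j - rowSum K a) ^ 2) =
      (rowSum K fun j => a j ^ 2) + ((-2 * rowSum K a) * rowSum K a + rowSum K a ^ 2) := by
    rw [rowSum_congr (b := fun j => a j ^ 2 + ((-2 * rowSum K a) * a j + rowSum K a ^ 2))
      fun j _ => by ring, rowSum_add, rowSum_add, rowSum_smul, rowSum_const]
  linarith [h2, pow_two (rowSum K a)]

theorem mean_eq_rowSum {K : ℕ} (f : Grid K) : mean f = rowSum K fun j => bdMean fun i => f i j := by
  rw [mean, ip_eq_rowSum]; rfl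

/-- Combined Poincaré and trace inequality: every row of a mean-zero grid function, including the
boundary rows, is controlled by the discrete gradient. -/
theorem row_poincare {K : ℕ} {u : Grid K} (hu : mean u = 0) {j : ℕ} (hj : j ≤ cells K) :
    bdIp (fun i => u i j) (fun i => u i j) ≤ 2 * gradSq u := by
  have hN := mesh_mul_cells K
  have hm := mesh_pos K
  have hc : (cells K : ℝ) = 1 / mesh K := by field_simp; linarith
  set X : ℕ → ℝ := fun l => bdGradSq fun i => u i l with hX
  set Y : ZMod (cells K) → ℝ := fun i => (cells K : ℝ) * ∑ l ∈ range (cells K),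
    (u i (l + 1) - u i l) ^ 2 with hY
  have hgrad : gradSq u = rowSum K X + mesh K * ∑ i, Y i := by
    rw [gradSq_eq]
    congr 1
    · unfold rowSum
      rw [mul_sum]
      refine sum_congr rfl fun l _ => ?_
      simp only [hX, bdGradSq, div_pow, ← sum_div, ← pow_two]
      field_simp
    · simp only [hY, ← mul_sum, ← mul_assoc, hN, one_mul, pow_two]
  have hpt : ∀ i, u i j * u i j ≤ 2 * Y i + 2 * rowSum K X := by
    intro i
    -- Go from `(i, j)` to `(k, l)` first along column `i`, which costs the column energy `Y i`,
    -- then along row `l`, which costs the row energy `X l`. Averaging over `(k, l)` recovers `u i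
    -- j` because `u` has mean zero.
    have h1 : ∀ l ≤ cells K, ∀ k, (u i j - u k l) ^ 2 ≤ 2 * Y i + 2 * X l := by
      intro l hl k
      have a1 := sq_sub_le_mul_sum_range (fun l => u i l) hj hl
      have a2 := sq_sub_le_card_mul_sum (fun i => u i l) i k
      have a3 : X l = cells K * ∑ i, (u (i + 1) l - u i l) ^ 2 := by
        simp only [hX, bdGradSq, div_pow, ← sum_div]; rw [hc]; field_simp
      have a4 : Y i = cells K * ∑ l ∈ range (cells K),
        (u i ((l + 1 : ℕ) : ℤ) - u i l) ^ 2 := by simp [hY]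
      rw [← a3] at a2
      rw [← a4] at a1
      nlinarith [sq_nonneg ((u i j - u i l) - (u i l - u k l))]
    have h2 : rowSum K (fun l => bdMean fun k => u i j - u k l) = u i j := by
      have e : ∀ l : ℕ, bdMean (fun k => u i j - u k l) = u i j + (-1) * bdMean fun k => u k l := by
        intro l
        rw [← bdMean_smul, show (fun k => u i j - u k l) =
          (fun _ => u i j) + (-1 : ℝ) • fun k => u k l by
            funext k; simp [sub_eq_add_neg], bdMean_add, bdMean_const]
      rw [rowSum_congr fun l _ => e l, rowSum_add, rowSum_const, rowSum_smul,
        ← mean_eq_rowSum, hu]; ring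
    rw [← pow_two, ← h2]
    refine (rowSum_sq_le _).trans ?_
    have h3 : ∀ l ≤ cells K, bdMean (fun k => u i j - u k l) ^ 2 ≤ 2 * Y i + 2 * X l := by
      intro l hl
      have e : bdMean (fun k => u i j - u k l) ^ 2 ≤
          bdIp (fun k => u i j - u k l) fun k => u i j - u k l := by
        have hnn := bdIp_self_nonneg fun k => u i j - u k l
        have h1 : bdIp (fun _ => (1 : ℝ) : BdGrid K) (fun _ => 1) ≤ 1 ^ 2 := by
          have := bdMean_const (K := K) 1
          unfold bdMean at this; rw [this]; norm_num
        have := abs_bdIp_le (Real.sqrt_nonneg _) zero_le_one (Real.sq_sqrt hnn).ge h1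
        rw [mul_one] at this
        rw [bdMean, ← sq_abs]
        exact (pow_le_pow_left₀ (abs_nonneg _) this 2).trans (Real.sq_sqrt hnn).le
      refine e.trans ?_
      unfold bdIp
      refine (mul_le_mul_of_nonneg_left (sum_le_sum fun k _ =>
        (le_of_eq (pow_two _).symm).trans (h1 l hl k)) hm.le).trans (le_of_eq ?_)
      rw [sum_const, card_univ, ZMod.card, nsmul_eq_mul, ← mul_assoc, hN, one_mul]
    refine (rowSum_mono h3).trans (le_of_eq ?_)
    rw [rowSum_add, rowSum_const, rowSum_smul]
  unfold bdIp
  refine (mul_le_mul_of_nonneg_left (sum_le_sum fun i _ => hpt i) hm.le).trans (le_of_eq ?_)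
  rw [sum_add_distrib, sum_const, card_univ, ZMod.card, nsmul_eq_mul, ← mul_sum, hgrad, hc]
  field_simp; ring

/-- Duality bound for residuals whose row norms may be of size `s / h` on the boundary rows. -/
theorem abs_ip_le_of_rows {K : ℕ} {R u : Grid K} (hu : mean u = 0) {s : ℝ} (hs : 0 ≤ s)
    (hR : ∀ j ≤ cells K, bdIp (fun i => R i j) (fun i => R i j) ≤
      (if j = 0 ∨ j = cells K then s / mesh K else s) ^ 2) :
    |ip R u| ≤ 2 * s * Real.sqrt (2 * gradSq u) := by
  have hm := mesh_pos K
  set q := Real.sqrt (2 * gradSq u) with hq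
  have hq0 : 0 ≤ q := Real.sqrt_nonneg _
  have hqs : q ^ 2 = 2 * gradSq u := Real.sq_sqrt (by have := gradSq_nonneg u; positivity)
  -- The term `s q` in all rows sums to `s q`. The additional `(s/h) q` on the two boundary rows,
  -- each of weight `h/2`, sums to another `s q`; this explains the factor `2`.
  have hb : ∀ j ≤ cells K, |bdIp (fun i => R i j) fun i => u i j| ≤
      s * q + (if j = 0 then s / mesh K * q else if j = cells K then s / mesh K * q else 0) := by
    intro j hj
    have hsm : 0 ≤ s / mesh K := by positivity
    have := abs_bdIp_le (by split_ifs <;> assumption) hq0 (hR j hj)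
      ((row_poincare hu hj).trans hqs.ge)
    refine this.trans ?_
    have : 0 ≤ s * q := by positivity
    split_ifs <;> first | tauto | nlinarith
  rw [ip_eq_rowSum]
  have h1 := rowSum_mono fun j hj => (abs_le.1 (hb j hj)).2
  have h2 := rowSum_mono (a := fun j => -(s * q +
    (if j = 0 then s / mesh K * q else if j = cells K then s / mesh K * q else 0)))
    fun j hj => (abs_le.1 (hb j hj)).1
  have h3 : rowSum K (fun j : ℕ => s * q +
      (if j = 0 then s / mesh K * q else if j = cells K then s / mesh K * q else 0)) = 2 * s * q := by
    rw [rowSum_add, rowSum_const, rowSum_ends]; field_simp; ring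
  have h4 : rowSum K (fun j : ℕ => -(s * q +
      (if j = 0 then s / mesh K * q else if j = cells K then s / mesh K * q else 0)))
      = -(2 * s * q) := by
    rw [← h3, rowSum_congr (b := fun j => (-1) * (s * q +
      (if j = 0 then s / mesh K * q else if j = cells K then s / mesh K * q else 0)))
      fun j _ => by ring, rowSum_smul]; ring
  rw [h3] at h1
  rw [h4] at h2
  exact abs_le.2 ⟨h2, h1⟩

/-! ### The energy estimate for one step -/

/-- The singular part of the derivative of the Flory-Huggins potential. -/
noncomputable def logPart (s : ℝ) : ℝ := Real.log (1 + s) - Real.log (1 - s)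

/-- Both logarithms contribute monotonically. This sign replaces any Lipschitz bound for the
singular nonlinearity at the numerical solution. -/
theorem logPart_monotone {a b : ℝ} (ha : |a| < 1) (hb : |b| < 1) :
    0 ≤ (logPart a - logPart b) * (a - b) := by
  have key : ∀ {a b : ℝ}, |a| < 1 → |b| < 1 → a ≤ b → logPart a ≤ logPart b := by
    intro a b ha hb h
    have ha' := abs_lt.1 ha
    have hb' := abs_lt.1 hb
    have h1 := Real.log_le_log (by linarith) (show 1 + a ≤ 1 + b by linarith)
    have h2 := Real.log_le_log (by linarith) (show 1 - b ≤ 1 - a by linarith)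
    unfold logPart; linarith
  rcases le_total a b with h | h
  · exact mul_nonneg_of_nonpos_of_nonpos (by linarith [key ha hb h]) (by linarith)
  · exact mul_nonneg (by linarith [key hb ha h]) (by linarith)

/-- A step of the scheme perturbed by residuals `R, RB, RT` in the evolution equations and
`S, SB, ST` in the chemical potentials; `G` and `H` are the discrete normal derivatives
`∂ᵧ` at `y = 0` and `y = 1`. The ghost points have been eliminated. -/
def PerturbedStep {K : ℕ} (ε κ θ₀ Δt : ℝ) (U U' R S : Grid K) (RB RT SB ST : BdGrid K) : Prop :=
  ∃ (ν : Grid K) (νB νT G H : BdGrid K),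
    (∀ (i : ZMod (cells K)) (j : ℕ), j ≤ cells K →
      |U' i j| < 1 ∧ (U' i j - U i j) / Δt = -negLap ν i j - R i j ∧
      ν i j = logPart (U' i j) - θ₀ * U i j + ε ^ 2 * (negLap U' i j +
        2 / mesh K * (if j = 0 then G i else if j = cells K then -H i else 0)) + S i j) ∧
    (∀ i, (bot U' i - bot U i) / Δt = bdD2x νB i - RB i) ∧
    (∀ i, (top U' i - top U i) / Δt = bdD2x νT i - RT i) ∧
    (∀ i, νB i = logPart (bot U' i) - θ₀ * bot U i - κ * ε * bdD2x (bot U') i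
      - ε ^ 2 * G i + SB i) ∧
    (∀ i, νT i = logPart (top U' i) - θ₀ * top U i - κ * ε * bdD2x (top U') i
      + ε ^ 2 * H i + ST i)

/-- The ghost value is expressed through the long-stencil difference, for instance `u₋₁ = u₁ - 2h
D̃_y u₀`. The remainder of the stencil is `-L_h`, and the flux enters with weight `2/h`. -/
theorem lapH_eq_neg_negLap {K : ℕ} (u : Grid K) (i : ZMod (cells K)) {j : ℕ} (hj : j ≤ cells K) :
    lapH u i j = -negLap u i j - 2 / mesh K * (if j = 0 then longDy u i 0 else
      if j = cells K then -longDy u i (cells K) else 0) := by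
  have hm := (mesh_pos K).ne'
  by_cases h0 : j = 0
  · subst h0
    simp only [negLap, lapH, D2x, D2y, longDy, Nat.cast_zero, if_true, zero_add, zero_sub]
    field_simp; ring
  · have h0' : (j : ℤ) ≠ 0 := by omega
    by_cases hN : j = cells K
    · subst hN
      simp only [negLap, lapH, D2x, D2y, longDy, h0, h0', if_true, if_false]
      field_simp; ring
    · have hN' : (j : ℤ) ≠ cells K := by omega
      simp only [negLap, h0, h0', hN, hN', if_false]; ring

/-- The condition `D̃_y μ = 0` removes the flux from the evolution equation, and the flux terms left
in the potential are the same `D̃_y φ'` as in the surface potentials. -/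
theorem SchemeStep.perturbedStep {K : ℕ} {ε κ θ₀ Δt : ℝ} {φ φ' : Grid K}
    (h : SchemeStep ε κ θ₀ Δt φ φ') : PerturbedStep ε κ θ₀ Δt φ φ' 0 0 0 0 0 0 := by
  obtain ⟨μ, μB, μT, hn, hμ, hB, hT, hμB, hμT⟩ := h
  refine ⟨μ, μB, μT, fun i => longDy φ' i 0, fun i => longDy φ' i (cells K), ?_, ?_, ?_, ?_, ?_⟩
  · intro i j hj
    obtain ⟨h1, h2, h3⟩ := hn i j (by omega) (by omega)
    refine ⟨abs_lt.2 h1, ?_, ?_⟩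
    · rw [h2, lapH_eq_neg_negLap μ i hj, (hμ i).1, (hμ i).2]; simp
    · rw [h3, lapH_eq_neg_negLap φ' i hj, logPart]
      simp only [Pi.zero_apply]
      ring
  · intro i; rw [hB i]; simp
  · intro i; rw [hT i]; simp
  · intro i; rw [hμB i, logPart]; simp only [Pi.zero_apply]; ring
  · intro i; rw [hμT i, logPart]; simp only [Pi.zero_apply]; ring

theorem IsNegLapInv.gradSq_eq {K : ℕ} {f ψ : Grid K} (h : IsNegLapInv f ψ) :
    gradSq ψ = negNorm f ^ 2 := (negNorm_sq h).symm

/-- Test with `ψ'`, where `L_h ψ' = e'`. Symmetry of `L_h` turns the flux into `(ω, e')`, and the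
time difference dominates half the increment of the squared `H⁻¹` norm. The residual is paired with
`ψ'` by `abs_ip_le_of_rows`; Young's inequality with `gradSq ψ' = ‖e'‖₋₁²` gives the last two terms.
-/
theorem bulk_energy_le {K : ℕ} {e e' ω R : Grid K} {Δt s : ℝ} (hΔt : 0 < Δt) (hs : 0 ≤ s)
    (he : mean e = 0) (he' : mean e' = 0)
    (h : ∀ (i : ZMod (cells K)) (j : ℕ), j ≤ cells K →
      (e' i j - e i j) / Δt = -negLap ω i j - R i j)
    (hR : ∀ j ≤ cells K, bdIp (fun i => R i j) (fun i => R i j) ≤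
      (if j = 0 ∨ j = cells K then s / mesh K else s) ^ 2) :
    negNorm e' ^ 2 - negNorm e ^ 2 ≤ 2 * Δt * (-ip ω e' + (2 * s ^ 2 + negNorm e' ^ 2)) := by
  obtain ⟨ψ, hψ⟩ := exists_isNegLapInv e he
  obtain ⟨ψ', hψ'⟩ := exists_isNegLapInv e' he'
  have h1 : ip (fun i j => e' i j + (-1) * e i j) ψ' =
      ip (fun i j => (-Δt) * (negLap ω i j + R i j)) ψ' := by
    refine ip_congr (fun i j hj => ?_) fun _ _ _ => rfl
    have := h i j hj
    field_simp at this
    linarith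
  rw [ip_add_left e' (fun i j => (-1) * e i j), ip_smul_left, ip_smul_left,
    ip_add_left (negLap ω) R, ip_comm e' ψ', hψ'.ip_eq ψ', ip_negLap_self, ip_comm e ψ', hψ.ip_eq ψ',
    ip_comm (negLap ω), ip_negLap_comm ψ' ω, ← hψ'.ip_eq ω, hψ'.gradSq_eq] at h1
  have h2 := (abs_le.1 (le_div_iff₀' (by norm_num : (0 : ℝ) < 2) |>.2
    (ip_negLap_le ψ' ψ one_pos))).2
  rw [hψ.gradSq_eq, hψ'.gradSq_eq] at h2
  have h3 := (abs_le.1 (abs_ip_le_of_rows hψ'.1 hs hR)).1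
  have h4 : 2 * s * Real.sqrt (2 * gradSq ψ') ≤ 2 * s ^ 2 + negNorm e' ^ 2 := by
    have hq : Real.sqrt (2 * gradSq ψ') ^ 2 = 2 * gradSq ψ' :=
      Real.sq_sqrt (by have := gradSq_nonneg ψ'; positivity)
    rw [← hψ'.gradSq_eq]
    nlinarith [sq_nonneg (2 * s - Real.sqrt (2 * gradSq ψ'))]
  have h5 : Δt * (-(2 * s ^ 2 + negNorm e' ^ 2)) ≤ Δt * ip R ψ' :=
    mul_le_mul_of_nonneg_left (by linarith) hΔt.le
  nlinarith [h1, h2, h5]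

theorem bd_energy_le {K : ℕ} {e e' ω R : BdGrid K} {Δt s : ℝ} (hΔt : 0 < Δt) (hs : 0 ≤ s)
    (he : bdMean e = 0) (he' : bdMean e' = 0)
    (h : ∀ i, (e' i - e i) / Δt = bdD2x ω i - R i) (hR : bdIp R R ≤ s ^ 2) :
    bdNegNorm e' ^ 2 - bdNegNorm e ^ 2 ≤ 2 * Δt * (-bdIp ω e' + (s ^ 2 + bdNegNorm e' ^ 2)) := by
  obtain ⟨ψ, hψ⟩ := exists_isBdNegLapInv e he
  obtain ⟨ψ', hψ'⟩ := exists_isBdNegLapInv e' he'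
  have hf : e = fun i => -bdD2x ψ i := funext fun i => (hψ.2 i).symm
  have hf' : e' = fun i => -bdD2x ψ' i := funext fun i => (hψ'.2 i).symm
  have h1 : bdIp (fun i => e' i + (-1) * e i) ψ' =
      bdIp (fun i => (-Δt) * (-bdD2x ω i + R i)) ψ' := by
    congr 1; funext i
    have := h i
    field_simp at this
    linarith
  have e1 : bdIp e' ψ' = bdNegNorm e' ^ 2 := by
    rw [bdNegNorm_sq hψ', bdIp_comm, ← bdIp_bdD2x_self, ← hf']
  have e2 : bdIp e ψ' = bdIp ψ' (fun i => -bdD2x ψ i) := by rw [bdIp_comm, ← hf]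
  have e3 : bdIp (fun i => -bdD2x ω i) ψ' = bdIp ω e' := by
    rw [bdIp_comm, bdIp_bdD2x_comm, ← hf']
  rw [bdIp_add_left e' (fun i => (-1) * e i), bdIp_smul_left, bdIp_smul_left,
    bdIp_add_left (fun i => -bdD2x ω i) R, e1, e2, e3] at h1
  have h2 := (abs_le.1 (le_div_iff₀' (by norm_num : (0 : ℝ) < 2) |>.2
    (bdIp_bdD2x_le ψ' ψ one_pos))).2
  rw [← bdNegNorm_sq hψ, ← bdNegNorm_sq hψ'] at h2
  have hq0 := bdGradSq_nonneg ψ'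
  have h3 := (abs_le.1 (abs_bdIp_le hs (Real.sqrt_nonneg _) hR
    ((bd_poincare hψ'.1).trans (Real.sq_sqrt hq0).ge))).1
  have h4 : s * Real.sqrt (bdGradSq ψ') ≤ s ^ 2 + bdNegNorm e' ^ 2 := by
    have hq := Real.sq_sqrt hq0
    rw [bdNegNorm_sq hψ']
    nlinarith [sq_nonneg (s - Real.sqrt (bdGradSq ψ')), sq_nonneg s]
  have h5 : Δt * (-(s ^ 2 + bdNegNorm e' ^ 2)) ≤ Δt * bdIp R ψ' :=
    mul_le_mul_of_nonneg_left (by linarith) hΔt.le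
  nlinarith [h1, h2, h5]

/-- Lower bound for the pairing of the bulk chemical potential difference with the error. -/
theorem bulk_pairing_ge {K : ℕ} {e e' ω S L : Grid K} {g k : BdGrid K} {ε θ₀ s : ℝ} (hε : 0 < ε)
    (hs : 0 ≤ s) (he : mean e = 0) (he' : mean e' = 0)
    (hL : ∀ (i : ZMod (cells K)) (j : ℕ), j ≤ cells K → 0 ≤ L i j * e' i j)
    (h : ∀ (i : ZMod (cells K)) (j : ℕ), j ≤ cells K →
      ω i j = L i j - θ₀ * e i j + ε ^ 2 * (negLap e' i j +
        2 / mesh K * (if j = 0 then g i else if j = cells K then -k i else 0)) + S i j)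
    (hS : ∀ j ≤ cells K, bdIp (fun i => S i j) (fun i => S i j) ≤ s ^ 2) :
    ε ^ 2 / 2 * gradSq e' + ε ^ 2 * (bdIp g (bot e') - bdIp k (top e'))
      - |θ₀| * (|θ₀| + 1) / ε ^ 2 * negNorm e ^ 2 - 8 / ε ^ 2 * s ^ 2 ≤ ip ω e' := by
  have hm := mesh_pos K
  obtain ⟨ψ, hψ⟩ := exists_isNegLapInv e he
  set B : Grid K := fun i j => if j = 0 then g i else if j = cells K then -k i else 0 with hB
  have h1 : ip ω e' = ip L e' + ((-θ₀) * ip e e' +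
      (ε ^ 2 * (gradSq e' + 2 / mesh K * ip B e') + ip S e')) := by
    rw [ip_congr (f' := fun i j => L i j + ((-θ₀) * e i j + (ε ^ 2 * (negLap e' i j +
      2 / mesh K * B i j) + S i j))) (fun i j hj => ?_) (fun _ _ _ => rfl),
      ip_add_left L (fun i j => (-θ₀) * e i j + (ε ^ 2 * (negLap e' i j +
        2 / mesh K * B i j) + S i j)), ip_add_left (fun i j => (-θ₀) * e i j), ip_smul_left,
      ip_add_left (fun i j => ε ^ 2 * (negLap e' i j + 2 / mesh K * B i j)) S, ip_smul_left,
      ip_add_left (negLap e') (fun i j => 2 / mesh K * B i j), ip_smul_left,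
      ip_comm (negLap e'), ip_negLap_self]
    rw [h i j hj]
    simp only [hB, Nat.cast_eq_zero, Nat.cast_inj]; ring
  have h2 : 0 ≤ ip L e' := by
    refine mul_nonneg (sq_nonneg _) (sum_nonneg fun i _ => sum_nonneg fun j hj => ?_)
    rw [mem_range] at hj
    exact mul_nonneg (wt_pos K j).le (hL i j (by omega))
  -- The quadrature weight `h/2` cancels the factor `2/h` of the flux, which leaves a pairing on the
  -- boundary sections without powers of `h`.
  have h3 : ip B e' = mesh K / 2 * (bdIp g (bot e') - bdIp k (top e')) := by
    rw [ip_eq_rowSum, sub_eq_add_neg, ← rowSum_ends]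
    refine rowSum_congr fun j _ => ?_
    simp only [hB, Nat.cast_eq_zero, Nat.cast_inj]
    split_ifs with a b
    · subst a; rfl
    · subst b
      simp only [bdIp, top, neg_mul, sum_neg_distrib, mul_neg]
    · simp [bdIp]
  have h4 : |θ₀| * |ip e e'| ≤ ε ^ 2 / 4 * gradSq e' +
      |θ₀| * (|θ₀| + 1) / ε ^ 2 * negNorm e ^ 2 := by
    -- The Young parameter spends at most `ε²/4` of the gradient on the explicit term; the `+ 1`
    -- covers `θ₀ = 0`.
    have hc : 0 < ε ^ 2 / (2 * (|θ₀| + 1)) := by positivity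
    have := ip_negLap_le e' ψ hc
    rw [← hψ.ip_eq e', ip_comm, hψ.gradSq_eq] at this
    have h5 := mul_le_mul_of_nonneg_left this (abs_nonneg θ₀)
    have h6 : |θ₀| * (ε ^ 2 / (2 * (|θ₀| + 1)) * gradSq e') ≤ ε ^ 2 / 2 * gradSq e' := by
      have : |θ₀| * (ε ^ 2 / (2 * (|θ₀| + 1))) ≤ ε ^ 2 / 2 := by
        rw [mul_div_assoc', div_le_div_iff₀ (by positivity) (by norm_num)]
        nlinarith [abs_nonneg θ₀, sq_nonneg ε]
      rw [← mul_assoc]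
      exact mul_le_mul_of_nonneg_right this (gradSq_nonneg _)
    have h7 : |θ₀| * (negNorm e ^ 2 / (ε ^ 2 / (2 * (|θ₀| + 1)))) =
        2 * (|θ₀| * (|θ₀| + 1) / ε ^ 2 * negNorm e ^ 2) := by
      field_simp
    rw [mul_add, h7] at h5
    linarith
  have h5 : -(ε ^ 2 / 4 * gradSq e' + 8 / ε ^ 2 * s ^ 2) ≤ ip S e' := by
    have hle : ∀ j ≤ cells K, bdIp (fun i => S i j) (fun i => S i j) ≤
        (if j = 0 ∨ j = cells K then s / mesh K else s) ^ 2 := by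
      intro j hj
      refine (hS j hj).trans (pow_le_pow_left₀ hs ?_ 2)
      split_ifs
      · rw [le_div_iff₀ hm]
        have : mesh K ≤ 1 := by
          unfold mesh
          rw [div_le_one (by positivity)]
          simp [cells]
        nlinarith
      · exact le_rfl
    have := (abs_le.1 (abs_ip_le_of_rows he' hs hle)).1
    have hq : Real.sqrt (2 * gradSq e') ^ 2 = 2 * gradSq e' :=
      Real.sq_sqrt (by have := gradSq_nonneg e'; positivity)
    -- Another quarter of the gradient absorbs the residual; completing the square fixes the
    -- constant `8/ε²`.
    have h6 : ε ^ 2 / 4 * gradSq e' + 8 / ε ^ 2 * s ^ 2 - 2 * s * Real.sqrt (2 * gradSq e')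
        = (ε ^ 2 * Real.sqrt (2 * gradSq e') - 8 * s) ^ 2 / (8 * ε ^ 2) := by
      have hg : gradSq e' = Real.sqrt (2 * gradSq e') ^ 2 / 2 := by rw [hq]; ring
      set q := Real.sqrt (2 * gradSq e')
      rw [hg]
      field_simp
      ring
    have : 0 ≤ (ε ^ 2 * Real.sqrt (2 * gradSq e') - 8 * s) ^ 2 / (8 * ε ^ 2) := by positivity
    linarith
  have h6 : -(|θ₀| * |ip e e'|) ≤ (-θ₀) * ip e e' := by
    rw [← abs_mul, neg_mul]; exact neg_le_neg (le_abs_self _)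
  have h7 : ε ^ 2 * (gradSq e' + 2 / mesh K * ip B e') =
      ε ^ 2 * gradSq e' + ε ^ 2 * (bdIp g (bot e') - bdIp k (top e')) := by
    rw [h3]; field_simp
  rw [h1, h7]
  linarith

/-- Lower bound for the pairing of a surface chemical potential difference with the error. -/
theorem bd_pairing_ge {K : ℕ} {e e' ω S L g : BdGrid K} {η θ₀ s : ℝ} (hη : 0 < η)
    (hs : 0 ≤ s) (he : bdMean e = 0) (he' : bdMean e' = 0) (hL : ∀ i, 0 ≤ L i * e' i)
    (h : ∀ i, ω i = L i - θ₀ * e i - η * bdD2x e' i + g i + S i) (hS : bdIp S S ≤ s ^ 2) :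
    η / 2 * bdGradSq e' + bdIp g e' - |θ₀| * (|θ₀| + 1) / η * bdNegNorm e ^ 2 - 1 / η * s ^ 2
      ≤ bdIp ω e' := by
  obtain ⟨ψ, hψ⟩ := exists_isBdNegLapInv e he
  have hf : e = fun i => -bdD2x ψ i := funext fun i => (hψ.2 i).symm
  have h1 : bdIp ω e' = bdIp L e' + ((-θ₀) * bdIp e e' + (η * bdGradSq e' +
      (bdIp g e' + bdIp S e'))) := by
    rw [show ω = fun i => L i + ((-θ₀) * e i + (η * (-bdD2x e' i) + (g i + S i))) by
      funext i; rw [h i]; ring, bdIp_add_left L, bdIp_add_left (fun i => (-θ₀) * e i),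
      bdIp_add_left (fun i => η * (-bdD2x e' i)), bdIp_add_left g, bdIp_smul_left,
      bdIp_smul_left η, bdIp_comm (fun i => -bdD2x e' i), bdIp_bdD2x_self]
  have h2 : 0 ≤ bdIp L e' := bdIp_nonneg hL
  have h4 : |θ₀| * |bdIp e e'| ≤ η / 4 * bdGradSq e' +
      |θ₀| * (|θ₀| + 1) / η * bdNegNorm e ^ 2 := by
    have hc : 0 < η / (2 * (|θ₀| + 1)) := by positivity
    have := bdIp_bdD2x_le e' ψ hc
    rw [← hf, bdIp_comm, ← bdNegNorm_sq hψ] at this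
    have h5 := mul_le_mul_of_nonneg_left this (abs_nonneg θ₀)
    have h6 : |θ₀| * (η / (2 * (|θ₀| + 1)) * bdGradSq e') ≤ η / 2 * bdGradSq e' := by
      have : |θ₀| * (η / (2 * (|θ₀| + 1))) ≤ η / 2 := by
        rw [mul_div_assoc', div_le_div_iff₀ (by positivity) (by norm_num)]
        nlinarith [abs_nonneg θ₀]
      rw [← mul_assoc]
      exact mul_le_mul_of_nonneg_right this (bdGradSq_nonneg _)
    have h7 : |θ₀| * (bdNegNorm e ^ 2 / (η / (2 * (|θ₀| + 1)))) =
        2 * (|θ₀| * (|θ₀| + 1) / η * bdNegNorm e ^ 2) := by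
      field_simp
    rw [mul_add, h7] at h5
    linarith
  have h5 : -(η / 4 * bdGradSq e' + 1 / η * s ^ 2) ≤ bdIp S e' := by
    have hq0 := bdGradSq_nonneg e'
    have hq := Real.sq_sqrt hq0
    have := (abs_le.1 (abs_bdIp_le hs (Real.sqrt_nonneg _) hS
      ((bd_poincare he').trans hq.ge))).1
    have h6 : η / 4 * bdGradSq e' + 1 / η * s ^ 2 - s * Real.sqrt (bdGradSq e')
        = (η * Real.sqrt (bdGradSq e') - 2 * s) ^ 2 / (4 * η) := by
      set q := Real.sqrt (bdGradSq e')
      rw [← hq]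
      field_simp
      ring
    have : 0 ≤ (η * Real.sqrt (bdGradSq e') - 2 * s) ^ 2 / (4 * η) := by positivity
    linarith
  have h6 : -(|θ₀| * |bdIp e e'|) ≤ (-θ₀) * bdIp e e' := by
    rw [← abs_mul, neg_mul]; exact neg_le_neg (le_abs_self _)
  rw [h1]
  linarith

/-- The squared negative norm, bulk and surface together. -/
noncomputable def energy {K : ℕ} (e : Grid K) : ℝ := negNorm e ^ 2 + surfNegNorm e ^ 2

/-- The dissipation. -/
noncomputable def dissip {K : ℕ} (ε κ : ℝ) (e : Grid K) : ℝ :=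
  ε ^ 2 * gradSq e + ε * κ * surfGradSq e

theorem negLap_sub {K : ℕ} (f g : Grid K) (i : ZMod (cells K)) (j : ℤ) :
    negLap (fun i j => f i j - g i j) i j = negLap f i j - negLap g i j := by
  unfold negLap lapH D2x D2y; split_ifs <;> ring

theorem bdD2x_sub {K : ℕ} (f g : BdGrid K) (i : ZMod (cells K)) :
    bdD2x (fun i => f i - g i) i = bdD2x f i - bdD2x g i := by
  unfold bdD2x; ring

/-- The constant in the energy estimate. -/
noncomputable def energyConst (ε κ θ₀ : ℝ) : ℝ :=
  2 * (|θ₀| * (|θ₀| + 1) / ε ^ 2 + |θ₀| * (|θ₀| + 1) / (κ * ε) + 8 / ε ^ 2 + 2 / (κ * ε) + 4)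

theorem energyConst_pos {ε κ : ℝ} (hε : 0 < ε) (hκ : 0 < κ) (θ₀ : ℝ) :
    0 < energyConst ε κ θ₀ := by
  unfold energyConst; positivity

/-- One step of the error equation. -/
theorem energy_step {K : ℕ} {ε κ θ₀ Δt s : ℝ} (hε : 0 < ε) (hκ : 0 < κ) (hΔt : 0 < Δt)
    (hs : 0 ≤ s) {U U' φ φ' R S : Grid K} {RB RT SB ST : BdGrid K}
    (hU : PerturbedStep ε κ θ₀ Δt U U' R S RB RT SB ST)
    (hφ : PerturbedStep ε κ θ₀ Δt φ φ' 0 0 0 0 0 0)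
    (hR : ∀ j ≤ cells K, bdIp (fun i => R i j) (fun i => R i j) ≤
      (if j = 0 ∨ j = cells K then s / mesh K else s) ^ 2)
    (hS : ∀ j ≤ cells K, bdIp (fun i => S i j) (fun i => S i j) ≤ s ^ 2)
    (hRB : bdIp RB RB ≤ s ^ 2) (hRT : bdIp RT RT ≤ s ^ 2)
    (hSB : bdIp SB SB ≤ s ^ 2) (hST : bdIp ST ST ≤ s ^ 2)
    {e e' : Grid K} (hee : e = fun i j => U i j - φ i j) (hee' : e' = fun i j => U' i j - φ' i j)
    (m1 : mean e = 0) (m2 : mean e' = 0) (m3 : bdMean (bot e) = 0) (m4 : bdMean (bot e') = 0)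
    (m5 : bdMean (top e) = 0) (m6 : bdMean (top e') = 0) :
    energy e' + Δt * dissip ε κ e' ≤
      energy e + Δt * (energyConst ε κ θ₀ * (energy e + energy e' + s ^ 2)) := by
  obtain ⟨ν, νB, νT, G, H, hn, hB, hT, hνB, hνT⟩ := hU
  obtain ⟨μ, μB, μT, G', H', hn', hB', hT', hμB, hμT⟩ := hφ
  have hκε : 0 < κ * ε := by positivity
  have b1 := bulk_energy_le (ω := fun i j => ν i j - μ i j) hΔt hs m1 m2 (fun i j hj => by
    rw [negLap_sub ν μ, hee, hee']
    have a := (hn i j hj).2.1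
    have b := (hn' i j hj).2.1
    simp only [Pi.zero_apply] at b
    have : (U' i j - φ' i j - (U i j - φ i j)) / Δt =
      (U' i j - U i j) / Δt - (φ' i j - φ i j) / Δt := by ring
    rw [this, a, b]; ring) hR
  have b2 := bulk_pairing_ge (ω := fun i j => ν i j - μ i j) (S := S) (θ₀ := θ₀)
    (L := fun i j => logPart (U' i j) - logPart (φ' i j)) (g := fun i => G i - G' i)
    (k := fun i => H i - H' i) hε hs m1 m2 (fun i j hj => by
      rw [hee']
      exact logPart_monotone (hn i j hj).1 (hn' i j hj).1) (fun i j hj => by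
      have a := (hn i j hj).2.2
      have b := (hn' i j hj).2.2
      rw [hee, hee', negLap_sub U' φ']
      simp only [Pi.zero_apply] at b
      simp only
      rw [a, b]
      split_ifs <;> ring) hS
  have c1 := bd_energy_le (e := bot e) (e' := bot e') (ω := fun i => νB i - μB i) hΔt hs m3 m4
    (fun i => by
      have a := hB i
      have b := hB' i
      simp only [Pi.zero_apply] at b
      rw [bdD2x_sub, hee, hee']
      simp only [bot] at a b ⊢
      have : (U' i 0 - φ' i 0 - (U i 0 - φ i 0)) / Δt =
        (U' i 0 - U i 0) / Δt - (φ' i 0 - φ i 0) / Δt := by ring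
      rw [this, a, b]; ring) hRB
  have c2 := bd_pairing_ge (e := bot e) (e' := bot e') (ω := fun i => νB i - μB i) (S := SB)
    (θ₀ := θ₀) (L := fun i => logPart (bot U' i) - logPart (bot φ' i))
    (g := fun i => (-ε ^ 2) * (G i - G' i)) hκε hs m3 m4 (fun i => by
      rw [hee']
      exact logPart_monotone (hn i 0 (by omega)).1 (hn' i 0 (by omega)).1) (fun i => by
      have e1 : bot e' = fun i => bot U' i - bot φ' i := by rw [hee']; rfl
      have e2 : bot e = fun i => bot U i - bot φ i := by rw [hee]; rfl
      rw [e1, e2, bdD2x_sub]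
      simp only
      rw [hνB i, hμB i]
      simp only [Pi.zero_apply]; ring) hSB
  have d1 := bd_energy_le (e := top e) (e' := top e') (ω := fun i => νT i - μT i) hΔt hs m5 m6
    (fun i => by
      have a := hT i
      have b := hT' i
      simp only [Pi.zero_apply] at b
      rw [bdD2x_sub, hee, hee']
      simp only [top] at a b ⊢
      have : (U' i (cells K) - φ' i (cells K) - (U i (cells K) - φ i (cells K))) / Δt =
        (U' i (cells K) - U i (cells K)) / Δt - (φ' i (cells K) - φ i (cells K)) / Δt := by ring
      rw [this, a, b]; ring) hRT
  have d2 := bd_pairing_ge (e := top e) (e' := top e') (ω := fun i => νT i - μT i) (S := ST)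
    (θ₀ := θ₀) (L := fun i => logPart (top U' i) - logPart (top φ' i))
    (g := fun i => ε ^ 2 * (H i - H' i)) hκε hs m5 m6 (fun i => by
      rw [hee']
      exact logPart_monotone (hn i (cells K) le_rfl).1 (hn' i (cells K) le_rfl).1) (fun i => by
      have e1 : top e' = fun i => top U' i - top φ' i := by rw [hee']; rfl
      have e2 : top e = fun i => top U i - top φ i := by rw [hee]; rfl
      rw [e1, e2, bdD2x_sub]
      simp only
      rw [hνT i, hμT i]
      simp only [Pi.zero_apply]; ring) hST
  rw [bdIp_smul_left] at c2 d2
  set A := |θ₀| * (|θ₀| + 1) with hA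
  have hA0 : 0 ≤ A := by positivity
  unfold energy dissip
  rw [surfNegNorm_sq, surfNegNorm_sq, surfGradSq]
  set X := negNorm e ^ 2
  set X' := negNorm e' ^ 2
  set B := bdNegNorm (bot e) ^ 2
  set B' := bdNegNorm (bot e') ^ 2
  set T := bdNegNorm (top e) ^ 2
  set T' := bdNegNorm (top e') ^ 2
  have hX : 0 ≤ X := sq_nonneg _
  have hX' : 0 ≤ X' := sq_nonneg _
  have hB0 : 0 ≤ B := sq_nonneg _
  have hB0' : 0 ≤ B' := sq_nonneg _
  have hT0 : 0 ≤ T := sq_nonneg _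
  have hT0' : 0 ≤ T' := sq_nonneg _
  -- In the sum of the three estimates the pairings of `G - G'` with the bottom error and of `H -
  -- H'` with the top error cancel: they enter the bulk and the surface equations with opposite
  -- signs.
  have key : X' - X + (B' - B) + (T' - T) ≤ 2 * Δt * (-(ε ^ 2 / 2 * gradSq e'
      + κ * ε / 2 * bdGradSq (bot e') + κ * ε / 2 * bdGradSq (top e'))
      + (A / ε ^ 2 * X + A / (κ * ε) * (B + T) + (8 / ε ^ 2 + 2 / (κ * ε) + 4) * s ^ 2
        + (X' + B' + T'))) := by
    have hh : 1 / (κ * ε) * s ^ 2 + 1 / (κ * ε) * s ^ 2 = 2 / (κ * ε) * s ^ 2 := by ring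
    refine (add_le_add (add_le_add b1 c1) d1).trans ?_
    rw [← mul_add, ← mul_add]
    refine mul_le_mul_of_nonneg_left ?_ (by positivity)
    linarith
  have h1 : 0 ≤ A / ε ^ 2 := by positivity
  have h2 : 0 ≤ A / (κ * ε) := by positivity
  have h3 : 0 ≤ 8 / ε ^ 2 + 2 / (κ * ε) + 4 := by positivity
  have fin : 2 * (A / ε ^ 2 * X + A / (κ * ε) * (B + T) + (8 / ε ^ 2 + 2 / (κ * ε) + 4) * s ^ 2
        + (X' + B' + T')) ≤
      energyConst ε κ θ₀ * (X + (T + B) + (X' + (T' + B')) + s ^ 2) := by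
    unfold energyConst
    rw [← hA]
    set p := A / ε ^ 2
    set q := A / (κ * ε)
    have h4 : 0 ≤ 8 / ε ^ 2 := by positivity
    have h5 : 0 ≤ 2 / (κ * ε) := by positivity
    set r := 8 / ε ^ 2
    set u := 2 / (κ * ε)
    have e0 : 0 ≤ s ^ 2 := sq_nonneg s
    set Y := B + T
    set Y' := B' + T'
    rw [show T + B = Y by ring, show T' + B' = Y' by ring, show X' + B' + T' = X' + Y' by ring]
    have hY : 0 ≤ Y := add_nonneg hB0 hT0
    have hY' : 0 ≤ Y' := add_nonneg hB0' hT0'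
    have t1 : 0 ≤ p * (Y + X' + Y' + s ^ 2) := by positivity
    have t2 : 0 ≤ q * (X + X' + Y' + s ^ 2) := by positivity
    have t3 : 0 ≤ (r + u) * (X + Y + X' + Y') := by positivity
    linarith
  have := mul_le_mul_of_nonneg_left fin hΔt.le
  linarith

/-- Discrete Gronwall inequality for the energy estimate. -/
theorem energy_gronwall {E D : ℕ → ℝ} {σ : ℕ → ℝ} {c Δt : ℝ} {M : ℕ} (hc : 0 ≤ c) (hΔt : 0 < Δt)
    (hsmall : c * Δt ≤ 1 / 2) (hE : ∀ n, 0 ≤ E n) (hD : ∀ n, 0 ≤ D n) (hσ : ∀ n, 0 ≤ σ n)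
    (h : ∀ n < M, E (n + 1) + Δt * D (n + 1) ≤
      E n + Δt * (c * (E n + E (n + 1) + σ n))) {n : ℕ} (hn : n ≤ M) :
    E n + Δt * ∑ k ∈ Icc 1 n, D k ≤
      Real.exp (4 * c * (n * Δt)) * (E 0 + 2 * c * (Δt * ∑ k ∈ range n, σ k)) := by
  -- With `x = c Δt ≤ 1/2`, the new energy is absorbed on the left by `1 + x ≤ (1 - x)(1 + 4x)` and
  -- `x ≤ (1 - x) 2x`.
  have step : ∀ n < M, E (n + 1) + Δt * D (n + 1) ≤
      (1 + 4 * c * Δt) * E n + 2 * c * Δt * σ n := by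
    intro n hn
    have h1 := h n hn
    set x := c * Δt with hx
    have hx0 : 0 ≤ x := by positivity
    have h2 : (1 - x) * (E (n + 1) + Δt * D (n + 1)) ≤ (1 + x) * E n + x * σ n := by
      have : 0 ≤ x * (Δt * D (n + 1)) := mul_nonneg hx0 (mul_nonneg hΔt.le (hD _))
      have e : Δt * (c * (E n + E (n + 1) + σ n)) = x * (E n + E (n + 1) + σ n) := by
        rw [hx]; ring
      rw [e] at h1
      linarith
    have h3 : (1 + x) * E n + x * σ n ≤
        (1 - x) * ((1 + 4 * c * Δt) * E n + 2 * c * Δt * σ n) := by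
      have e : (1 - x) * ((1 + 4 * c * Δt) * E n + 2 * c * Δt * σ n) - ((1 + x) * E n + x * σ n)
        = (2 * x * (1 - 2 * x)) * E n + (x * (1 - 2 * x)) * σ n := by rw [hx]; ring
      have p1 : 0 ≤ (2 * x * (1 - 2 * x)) * E n :=
        mul_nonneg (mul_nonneg (by positivity) (by linarith)) (hE n)
      have p2 : 0 ≤ (x * (1 - 2 * x)) * σ n := mul_nonneg (mul_nonneg hx0 (by linarith)) (hσ n)
      linarith
    exact le_of_mul_le_mul_left (h2.trans h3) (by linarith)
  induction n with
  | zero => simp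
  | succ n ih =>
    have ih := ih (by omega)
    have h1 := step n (by omega)
    rw [sum_Icc_succ_top (by omega), sum_range_succ]
    have hS : 0 ≤ ∑ k ∈ Icc 1 n, D k := sum_nonneg fun k _ => hD k
    have hσS : 0 ≤ ∑ k ∈ range n, σ k := sum_nonneg fun k _ => hσ k
    have e1 : 1 + 4 * c * Δt ≤ Real.exp (4 * c * Δt) := by
      rw [add_comm]; exact Real.add_one_le_exp _
    have e2 : Real.exp (4 * c * ((n + 1 : ℕ) * Δt)) =
        Real.exp (4 * c * Δt) * Real.exp (4 * c * (n * Δt)) := by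
      rw [← Real.exp_add]; congr 1; push_cast; ring
    have e3 : 1 ≤ Real.exp (4 * c * ((n + 1 : ℕ) * Δt)) :=
      Real.one_le_exp (by positivity)
    have e4 : (1 + 4 * c * Δt) * (E n + Δt * ∑ k ∈ Icc 1 n, D k) ≤
        Real.exp (4 * c * Δt) * (Real.exp (4 * c * (n * Δt)) *
          (E 0 + 2 * c * (Δt * ∑ k ∈ range n, σ k))) :=
      mul_le_mul e1 ih (add_nonneg (hE n) (by positivity)) (Real.exp_pos _).le
    have e5 : 2 * c * Δt * σ n ≤ Real.exp (4 * c * ((n + 1 : ℕ) * Δt)) * (2 * c * Δt * σ n) :=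
      le_mul_of_one_le_left (mul_nonneg (by positivity) (hσ n)) e3
    have e6 : Δt * ∑ k ∈ Icc 1 n, D k ≤ (1 + 4 * c * Δt) * (Δt * ∑ k ∈ Icc 1 n, D k) :=
      le_mul_of_one_le_left (by positivity) (by nlinarith [mul_nonneg hc hΔt.le])
    rw [← mul_assoc, ← e2] at e4
    nlinarith [e4, e5, e6, h1]

/-! ### Fourier projection on grid rows -/

/-- The character `exp(2πikx)`. -/
noncomputable def expK (k : ℤ) (x : ℝ) : ℂ := Complex.exp (2 * Real.pi * Complex.I * k * x)

/-- The Fourier coefficient of a real function on `[0,1]`. -/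
noncomputable def coeffK (g : ℝ → ℝ) (k : ℤ) : ℂ :=
  fourierCoeffOn (zero_lt_one (α := ℝ)) (fun s => ((g s : ℝ) : ℂ)) k

/-- Fourier partial sum of a real function. -/
noncomputable def partialSum (K : ℕ) (g : ℝ → ℝ) (x : ℝ) : ℝ :=
  (∑ k ∈ Icc (-(K : ℤ)) K, coeffK g k * expK k x).re

/-- The abscissa of the grid column `i`. -/
noncomputable def xpt (K : ℕ) (i : ZMod (cells K)) : ℝ := ((i.val : ℝ) + 1 / 2) * mesh K

/-- Grid values of the Fourier partial sum. -/
noncomputable def rowProj (K : ℕ) (g : ℝ → ℝ) : BdGrid K := fun i => partialSum K g (xpt K i)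

theorem expK_add (k : ℤ) (x y : ℝ) : expK k (x + y) = expK k x * expK k y := by
  unfold expK; rw [← Complex.exp_add]; congr 1; push_cast; ring

theorem expK_add_left (k l : ℤ) (x : ℝ) : expK (k + l) x = expK k x * expK l x := by
  unfold expK; rw [← Complex.exp_add]; congr 1; push_cast; ring

theorem expK_one (k : ℤ) : expK k 1 = 1 := by
  unfold expK
  rw [show (2 * Real.pi * Complex.I * k * (1 : ℝ) : ℂ) = k * (2 * Real.pi * Complex.I) by
    push_cast; ring]
  exact Complex.exp_int_mul_two_pi_mul_I k

theorem norm_expK (k : ℤ) (x : ℝ) : ‖expK k x‖ = 1 := by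
  unfold expK
  rw [show (2 * Real.pi * Complex.I * k * x : ℂ) = ((2 * Real.pi * k * x : ℝ) : ℂ) * Complex.I by
    push_cast; ring]
  exact Complex.norm_exp_ofReal_mul_I _

theorem conj_expK (k : ℤ) (x : ℝ) : (starRingEnd ℂ) (expK k x) = expK (-k) x := by
  unfold expK
  rw [← Complex.exp_conj]; congr 1
  simp only [map_mul, Complex.conj_ofReal, Complex.conj_I, map_intCast, map_ofNat]
  push_cast; ring

theorem continuous_expK (k : ℤ) : Continuous (expK k) := by unfold expK; fun_prop

theorem fourier_one_eq (k : ℤ) (x : ℝ) {T : ℝ} (hT : T = 1) :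
    fourier k (x : AddCircle T) = expK k x := by
  subst hT
  rw [fourier_coe_apply]; unfold expK; congr 1; push_cast; ring

theorem coeffK_eq (g : ℝ → ℝ) (k : ℤ) :
    coeffK g k = ∫ x in (0 : ℝ)..1, expK (-k) x * g x := by
  unfold coeffK
  rw [fourierCoeffOn_eq_integral]
  simp only [sub_zero, div_one, one_smul]
  refine intervalIntegral.integral_congr fun x _ => ?_
  simp only [smul_eq_mul]
  rw [fourier_one_eq _ _ (by norm_num)]

theorem intervalIntegrable_expK_mul {g : ℝ → ℝ} (hg : ContinuousOn g (Set.Icc 0 1)) (k : ℤ) :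
    IntervalIntegrable (fun x => expK k x * g x) volume 0 1 := by
  refine ContinuousOn.intervalIntegrable ?_
  rw [Set.uIcc_of_le zero_le_one]
  exact (continuous_expK k).continuousOn.mul (Complex.continuous_ofReal.comp_continuousOn hg)

theorem coeffK_add {f g : ℝ → ℝ} (hf : ContinuousOn f (Set.Icc 0 1))
    (hg : ContinuousOn g (Set.Icc 0 1)) (k : ℤ) :
    coeffK (fun x => f x + g x) k = coeffK f k + coeffK g k := by
  rw [coeffK_eq, coeffK_eq, coeffK_eq, ← intervalIntegral.integral_add
    (intervalIntegrable_expK_mul hf _) (intervalIntegrable_expK_mul hg _)]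
  congr 1; funext x; push_cast; ring

theorem coeffK_smul (c : ℝ) (f : ℝ → ℝ) (k : ℤ) :
    coeffK (fun x => c * f x) k = c * coeffK f k := by
  rw [coeffK_eq, coeffK_eq, ← intervalIntegral.integral_const_mul]
  congr 1; funext x; push_cast; ring

theorem norm_coeffK_le {g : ℝ → ℝ} {B : ℝ} (h : ∀ x ∈ Set.Icc (0 : ℝ) 1, |g x| ≤ B) (k : ℤ) :
    ‖coeffK g k‖ ≤ B := by
  rw [coeffK_eq]
  have := intervalIntegral.norm_integral_le_of_norm_le_const (a := (0 : ℝ)) (b := 1)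
    (f := fun x => expK (-k) x * (g x : ℂ)) (C := B) fun x hx => by
      rw [Set.uIoc_of_le zero_le_one] at hx
      rw [norm_mul, norm_expK, one_mul, Complex.norm_real]
      exact h x ⟨hx.1.le, hx.2⟩
  simpa using this

theorem coeffK_zero (g : ℝ → ℝ) : coeffK g 0 = ((∫ x in (0 : ℝ)..1, g x : ℝ) : ℂ) := by
  rw [coeffK_eq, ← intervalIntegral.integral_ofReal]
  congr 1; funext x; simp [expK]

/-- Change of variables; periodicity moves the shifted interval of integration back to `[0,1]`. -/
theorem coeffK_shift {g : ℝ → ℝ} (hp : Function.Periodic g 1) (a : ℝ) (k : ℤ) :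
    coeffK (fun x => g (x + a)) k = expK k a * coeffK g k := by
  rw [coeffK_eq, coeffK_eq, ← intervalIntegral.integral_const_mul]
  set F : ℝ → ℂ := fun x => expK k a * (expK (-k) x * g x) with hF
  have hFp : Function.Periodic F 1 := by
    intro x
    simp only [hF, hp x, expK_add, expK_one, mul_one]
  have h1 : ∀ x, expK (-k) x * ((g (x + a) : ℝ) : ℂ) = F (x + a) := by
    intro x
    have h2 : expK k a * expK (-k) a = 1 := by
      rw [← expK_add_left]; simp [expK]
    simp only [hF, expK_add]
    linear_combination (-(expK (-k) x * g (x + a))) * h2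
  simp only [h1]
  rw [intervalIntegral.integral_comp_add_right]
  have := hFp.intervalIntegral_add_eq (0 + a) 0
  rw [show (0 : ℝ) + a + 1 = 1 + a by ring, zero_add 1] at this
  exact this

theorem rowProj_add (K : ℕ) {f g : ℝ → ℝ} (hf : ContinuousOn f (Set.Icc 0 1))
    (hg : ContinuousOn g (Set.Icc 0 1)) (i : ZMod (cells K)) :
    rowProj K (fun x => f x + g x) i = rowProj K f i + rowProj K g i := by
  unfold rowProj partialSum
  simp only [coeffK_add hf hg, add_mul, sum_add_distrib, Complex.add_re]

theorem rowProj_smul (K : ℕ) (c : ℝ) (f : ℝ → ℝ) (i : ZMod (cells K)) :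
    rowProj K (fun x => c * f x) i = c * rowProj K f i := by
  unfold rowProj partialSum
  simp only [coeffK_smul, mul_assoc, ← mul_sum, Complex.re_ofReal_mul]

theorem rowProj_sub (K : ℕ) {f g : ℝ → ℝ} (hf : ContinuousOn f (Set.Icc 0 1))
    (hg : ContinuousOn g (Set.Icc 0 1)) (i : ZMod (cells K)) :
    rowProj K (fun x => f x - g x) i = rowProj K f i - rowProj K g i := by
  have := rowProj_add K (g := fun x => (-1) * g x) hf (continuousOn_const.mul hg) i
  rw [rowProj_smul] at this
  simp only [neg_one_mul, ← sub_eq_add_neg] at this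
  exact this

/-- At the last column the index wraps around and the abscissa jumps by `1`, which a character does
not see. Only characters, not abscissae, therefore satisfy the shift rule at every column. -/
theorem expK_xpt_succ (K : ℕ) (k : ℤ) (i : ZMod (cells K)) :
    expK k (xpt K (i + 1)) = expK k (xpt K i + mesh K) := by
  have hN := mesh_mul_cells K
  have hlt := ZMod.val_lt i
  by_cases h : i.val + 1 < cells K
  · have : (i + 1).val = i.val + 1 := by
      by_cases hK : K = 0
      · subst hK; simp only [cells] at h hlt; omega
      have : Fact (1 < cells K) := ⟨by simp only [cells]; omega⟩
      rw [ZMod.val_add_of_lt] <;> rw [ZMod.val_one]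
      exact h
    unfold xpt; rw [this]; congr 1; push_cast; ring
  · have h1 : i.val + 1 = cells K := by omega
    have h2 : (i + 1).val = 0 := by
      have : ((i.val + 1 : ℕ) : ZMod (cells K)) = 0 := by rw [h1]; simp
      push_cast at this
      rw [ZMod.natCast_zmod_val] at this
      rw [this, ZMod.val_zero]
    have h3 : (i.val : ℝ) = cells K - 1 := by
      have : ((i.val + 1 : ℕ) : ℝ) = cells K := congrArg _ h1
      push_cast [cells] at this ⊢
      linarith
    have h4 : xpt K i + mesh K = xpt K (i + 1) + 1 := by
      unfold xpt; rw [h2, h3, Nat.cast_zero]; linear_combination hN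
    rw [h4, expK_add, expK_one, mul_one]

/-- The projection is a Fourier multiplier, so it commutes with translations. Difference quotients
can hence be formed for the function itself and projected afterwards. -/
theorem rowProj_shift (K : ℕ) {g : ℝ → ℝ} (hp : Function.Periodic g 1) (i : ZMod (cells K)) :
    rowProj K (fun x => g (x + mesh K)) i = rowProj K g (i + 1) := by
  unfold rowProj partialSum
  congr 1
  refine sum_congr rfl fun k _ => ?_
  rw [coeffK_shift hp, expK_xpt_succ, expK_add]; ring

theorem rowProj_shift_neg (K : ℕ) {g : ℝ → ℝ} (hp : Function.Periodic g 1)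
    (i : ZMod (cells K)) : rowProj K (fun x => g (x - mesh K)) i = rowProj K g (i - 1) := by
  have hp' : Function.Periodic (fun x => g (x - mesh K)) 1 := by
    intro x; simp only; rw [← hp (x - mesh K)]; congr 1; ring
  have := rowProj_shift K hp' (i - 1)
  simp only [add_sub_cancel_right, sub_add_cancel] at this
  exact this.symm

/-- Discrete orthogonality of the characters. -/
theorem sum_expK (K : ℕ) {m : ℤ} (hm : |m| < cells K) :
    mesh K * ∑ i : ZMod (cells K), expK m (xpt K i) = if m = 0 then 1 else 0 := by
  split_ifs with h0
  · subst h0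
    simp only [expK, Int.cast_zero, mul_zero, zero_mul, Complex.exp_zero, sum_const, card_univ,
      ZMod.card, nsmul_eq_mul, mul_one]
    exact_mod_cast mesh_mul_cells K
  · have h1 : ∀ i : ZMod (cells K), expK m (xpt K i) =
        expK m (mesh K / 2) * expK m (mesh K) ^ i.val := by
      intro i
      have : ∀ n : ℕ, expK m (n * mesh K) = expK m (mesh K) ^ n := by
        intro n
        induction n with
        | zero => simp [expK]
        | succ n ih => rw [pow_succ, ← ih, ← expK_add]; congr 1; push_cast; ring
      rw [← this, ← expK_add]; congr 1; unfold xpt; ring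
    have h2 : ∑ i : ZMod (cells K), expK m (mesh K) ^ i.val =
        ∑ n ∈ range (cells K), expK m (mesh K) ^ n := by
      rw [← Fin.sum_univ_eq_sum_range (fun n => expK m (mesh K) ^ n) (cells K)]
      rfl
    have h3 : expK m (mesh K) ^ cells K = 1 := by
      have : ∀ n : ℕ, expK m (n * mesh K) = expK m (mesh K) ^ n := by
        intro n
        induction n with
        | zero => simp [expK]
        | succ n ih => rw [pow_succ, ← ih, ← expK_add]; congr 1; push_cast; ring
      rw [← this, mul_comm, mesh_mul_cells, expK_one]
    -- Otherwise `m h` would be an integer, that is `N ∣ m`, which is impossible for `0 < |m| < N`.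
    have h4 : expK m (mesh K) ≠ 1 := by
      intro h
      unfold expK at h
      rw [Complex.exp_eq_one_iff] at h
      obtain ⟨n, hn⟩ := h
      have hpi : (2 * Real.pi * Complex.I : ℂ) ≠ 0 := Complex.two_pi_I_ne_zero
      have h5 : (m : ℂ) * (mesh K : ℂ) = n := by
        have : (2 * Real.pi * Complex.I : ℂ) * (m * mesh K) = (2 * Real.pi * Complex.I) * n := by
          rw [← mul_assoc, hn]; ring
        exact mul_left_cancel₀ hpi this
      have h6 : (m : ℝ) * mesh K = n := by exact_mod_cast h5
      have h7 : (m : ℝ) = n * cells K := by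
        rw [← h6, mul_assoc, mesh_mul_cells, mul_one]
      have h8 : m = n * cells K := by exact_mod_cast h7
      have hn0 : n ≠ 0 := by rintro rfl; simp at h8; exact h0 h8
      rw [h8, abs_mul] at hm
      have : (1 : ℤ) ≤ |n| := Int.one_le_abs hn0
      have hc : |((cells K : ℕ) : ℤ)| = cells K := abs_of_nonneg (by positivity)
      rw [hc] at hm
      nlinarith [show (0 : ℤ) ≤ (cells K : ℕ) by positivity]
    have h5 : ∑ n ∈ range (cells K), expK m (mesh K) ^ n = 0 := by
      rw [geom_sum_eq h4, h3, sub_self, zero_div]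
    rw [sum_congr rfl fun i _ => h1 i, ← mul_sum, h2, h5, mul_zero, mul_zero]

/-- Discrete Parseval identity for trigonometric polynomials. -/
theorem parseval_row (K : ℕ) (a : ℤ → ℂ) :
    mesh K * ∑ i : ZMod (cells K), ‖∑ k ∈ Icc (-(K : ℤ)) K, a k * expK k (xpt K i)‖ ^ 2
      = ∑ k ∈ Icc (-(K : ℤ)) K, ‖a k‖ ^ 2 := by
  have h1 : ∀ i : ZMod (cells K),
      ((‖∑ k ∈ Icc (-(K : ℤ)) K, a k * expK k (xpt K i)‖ ^ 2 : ℝ) : ℂ) =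
      ∑ k ∈ Icc (-(K : ℤ)) K, ∑ l ∈ Icc (-(K : ℤ)) K,
        a k * (starRingEnd ℂ) (a l) * expK (k - l) (xpt K i) := by
    intro i
    push_cast
    rw [← Complex.mul_conj', map_sum, sum_mul_sum]
    refine sum_congr rfl fun k _ => sum_congr rfl fun l _ => ?_
    rw [map_mul, conj_expK, sub_eq_add_neg, expK_add_left]; ring
  have h2 : ((mesh K * ∑ i : ZMod (cells K),
      ‖∑ k ∈ Icc (-(K : ℤ)) K, a k * expK k (xpt K i)‖ ^ 2 : ℝ) : ℂ) =
      ((∑ k ∈ Icc (-(K : ℤ)) K, ‖a k‖ ^ 2 : ℝ) : ℂ) := by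
    rw [Complex.ofReal_mul, Complex.ofReal_sum, sum_congr rfl fun i _ => h1 i, sum_comm, mul_sum,
      Complex.ofReal_sum]
    refine sum_congr rfl fun k hk => ?_
    rw [sum_comm, mul_sum]
    have h3 : ∀ l ∈ Icc (-(K : ℤ)) K, (mesh K : ℂ) * ∑ i : ZMod (cells K),
        a k * (starRingEnd ℂ) (a l) * expK (k - l) (xpt K i) =
        if k = l then a k * (starRingEnd ℂ) (a l) else 0 := by
      intro l hl
      rw [mem_Icc] at hk hl
      -- Frequencies of modulus at most `K` differ by at most `2K < N`, so there is no aliasing on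
      -- the grid.
      have hlt : |k - l| < cells K := by
        rw [abs_lt]; simp only [cells]; push_cast; constructor <;> omega
      rw [← mul_sum, mul_left_comm, sum_expK K hlt]
      simp only [sub_eq_zero, mul_ite, mul_one, mul_zero]
    rw [sum_congr rfl h3, sum_ite_eq, if_pos hk, Complex.mul_conj']
    push_cast; rfl
  exact_mod_cast h2

/-- Bessel's inequality, obtained from Parseval by keeping finitely many terms; on an interval of
length one the `L²` norm is at most the supremum. -/
theorem sum_sq_coeffK_le {g : ℝ → ℝ} (hg : ContinuousOn g (Set.Icc 0 1)) {B : ℝ}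
    (h : ∀ x ∈ Set.Icc (0 : ℝ) 1, |g x| ≤ B) (s : Finset ℤ) :
    ∑ k ∈ s, ‖coeffK g k‖ ^ 2 ≤ B ^ 2 := by
  have hgc : ContinuousOn (fun s => ((g s : ℝ) : ℂ)) (Set.Icc 0 1) :=
    Complex.continuous_ofReal.comp_continuousOn hg
  have hL2 : MemLp (fun s => ((g s : ℝ) : ℂ)) 2 (volume.restrict (Set.Ioc (0 : ℝ) 1)) := by
    refine MemLp.of_bound ((hgc.mono Set.Ioc_subset_Icc_self).aestronglyMeasurable
      measurableSet_Ioc) B ?_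
    refine (ae_restrict_iff' measurableSet_Ioc).2 (ae_of_all _ fun x hx => ?_)
    rw [Complex.norm_real]
    exact h x ⟨hx.1.le, hx.2⟩
  have hs := hasSum_sq_fourierCoeffOn (zero_lt_one (α := ℝ)) hL2
  refine (sum_le_hasSum s (fun _ _ => sq_nonneg _) hs).trans ?_
  simp only [sub_zero, inv_one, one_smul]
  have := intervalIntegral.norm_integral_le_of_norm_le_const (a := (0 : ℝ)) (b := 1)
    (f := fun x => ‖((g x : ℝ) : ℂ)‖ ^ 2) (C := B ^ 2) fun x hx => by
      rw [Set.uIoc_of_le zero_le_one] at hx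
      rw [Complex.norm_real, norm_pow, norm_norm]
      exact pow_le_pow_left₀ (norm_nonneg _) (h x ⟨hx.1.le, hx.2⟩) 2
  simp only [sub_zero, abs_one, mul_one] at this
  exact (le_abs_self _).trans this

/-- The projection is bounded from the supremum norm to the discrete `ℓ²` norm. -/
theorem bdIp_rowProj_le (K : ℕ) {g : ℝ → ℝ} (hg : ContinuousOn g (Set.Icc 0 1)) {B : ℝ}
    (h : ∀ x ∈ Set.Icc (0 : ℝ) 1, |g x| ≤ B) : bdIp (rowProj K g) (rowProj K g) ≤ B ^ 2 := by
  refine le_trans ?_ ((parseval_row K (coeffK g)).le.trans (sum_sq_coeffK_le hg h _))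
  unfold bdIp
  refine mul_le_mul_of_nonneg_left (sum_le_sum fun i _ => ?_) (mesh_pos K).le
  rw [← pow_two, ← sq_abs]
  exact pow_le_pow_left₀ (abs_nonneg _) (Complex.abs_re_le_norm _) 2

/-- The discrete mean of the projection is the integral. -/
theorem bdMean_rowProj (K : ℕ) (g : ℝ → ℝ) :
    bdMean (rowProj K g) = ∫ x in (0 : ℝ)..1, g x := by
  have h1 : bdMean (rowProj K g) = ((mesh K : ℂ) * ∑ i : ZMod (cells K),
      ∑ k ∈ Icc (-(K : ℤ)) K, coeffK g k * expK k (xpt K i)).re := by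
    rw [Complex.re_ofReal_mul, Complex.re_sum]
    simp only [bdMean, bdIp, mul_one, rowProj, partialSum]
  have h2 : ∀ k ∈ Icc (-(K : ℤ)) K, (mesh K : ℂ) * ∑ i : ZMod (cells K),
      coeffK g k * expK k (xpt K i) = if 0 = k then coeffK g k else 0 := by
    intro k hk
    rw [mem_Icc] at hk
    have hlt : |k| < cells K := by
      rw [abs_lt]; simp only [cells]; push_cast; constructor <;> omega
    rw [← mul_sum, mul_left_comm, sum_expK K hlt]
    simp only [eq_comm, mul_ite, mul_one, mul_zero]
  rw [h1, sum_comm, mul_sum, sum_congr rfl h2, sum_ite_eq,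
    if_pos (by rw [mem_Icc]; constructor <;> omega), coeffK_zero, Complex.ofReal_re]

/-! ### Approximation by Fourier partial sums -/

/-- Integration by parts, where periodicity removes the boundary term. The true factor `1/(2π|k|)`
is weakened to `1/|k|`. -/
theorem coeffK_of_hasDerivAt {g g' : ℝ → ℝ} (hp : Function.Periodic g 1)
    (hg : ∀ x, HasDerivAt g (g' x) x) (hg' : Continuous g') {k : ℤ} (hk : k ≠ 0) :
    ‖coeffK g k‖ ≤ ‖coeffK g' k‖ / |(k : ℝ)| := by
  have h := fourierCoeffOn_of_hasDerivAt (zero_lt_one (α := ℝ)) (f := fun s => ((g s : ℝ) : ℂ))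
    (f' := fun s => ((g' s : ℝ) : ℂ)) hk (fun x _ => (hg x).ofReal_comp)
    ((Complex.continuous_ofReal.comp hg').intervalIntegrable _ _)
  have hp1 : g 1 = g 0 := by simpa using hp 0
  rw [hp1, sub_self, mul_zero, zero_sub] at h
  have hn : ‖coeffK g k‖ = 1 / (2 * Real.pi * |(k : ℝ)|) * ‖coeffK g' k‖ := by
    unfold coeffK
    rw [h, norm_mul, norm_neg, norm_mul, norm_div]
    simp only [norm_mul, norm_neg, Complex.norm_ofNat, Complex.norm_real, Complex.norm_I,
      Complex.norm_intCast, norm_one, Complex.ofReal_one, Complex.ofReal_zero, sub_zero, one_mul,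
      mul_one, Real.norm_eq_abs, abs_of_pos Real.pi_pos]
  have hk' : 0 < |(k : ℝ)| := abs_pos.2 (by exact_mod_cast hk)
  rw [hn, div_eq_mul_one_div, mul_comm]
  refine mul_le_mul_of_nonneg_left ?_ (norm_nonneg _)
  rw [one_mul, ← one_div]
  apply one_div_le_one_div_of_le hk'
  nlinarith [Real.pi_gt_three]

/-- Constant in the approximation estimate for Fourier partial sums. -/
noncomputable def fourierConst : ℝ := 9 * ∑' k : ℤ, 1 / (k : ℝ) ^ 2

/-- Approximation by Fourier partial sums for four times differentiable periodic functions. -/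
theorem partialSum_sub_le {K : ℕ} (hK : 1 ≤ K) {g : ℕ → ℝ → ℝ} {B : ℝ}
    (hp : Function.Periodic (g 0) 1) (hg : ∀ m < 4, ∀ x, HasDerivAt (g m) (g (m + 1) x) x)
    (hc : Continuous (g 4)) (hB : ∀ x, |g 4 x| ≤ B) (x : ℝ) :
    |partialSum K (g 0) x - g 0 x| ≤ fourierConst * B * mesh K ^ 2 := by
  have hB0 : 0 ≤ B := (abs_nonneg _).trans (hB 0)
  have hper : ∀ m ≤ 3, Function.Periodic (g m) 1 := by
    intro m
    induction m with
    | zero => exact fun _ => hp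
    | succ m ih =>
      intro hm y
      have h1 := (hg m (by omega) (y + 1)).comp_add_const y 1
      have h2 : (fun z => g m (z + 1)) = g m := funext fun z => ih (by omega) z
      rw [h2] at h1
      exact h1.unique (hg m (by omega) y)
  have hcont : ∀ m ≤ 4, Continuous (g m) := by
    intro m hm
    rcases eq_or_lt_of_le hm with h | h
    · rw [h]; exact hc
    · exact continuous_iff_continuousAt.2 fun y => (hg m h y).continuousAt
  have hcoef : ∀ k : ℤ, k ≠ 0 → ‖coeffK (g 0) k‖ ≤ B / |(k : ℝ)| ^ 4 := by
    intro k hk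
    have hk' : 0 < |(k : ℝ)| := abs_pos.2 (by exact_mod_cast hk)
    have h4 := norm_coeffK_le (fun x _ => hB x) k
    have h3 := coeffK_of_hasDerivAt (hper 3 (by omega)) (hg 3 (by omega)) (hcont 4 (by omega)) hk
    have h2 := coeffK_of_hasDerivAt (hper 2 (by omega)) (hg 2 (by omega)) (hcont 3 (by omega)) hk
    have h1 := coeffK_of_hasDerivAt (hper 1 (by omega)) (hg 1 (by omega)) (hcont 2 (by omega)) hk
    have h0 := coeffK_of_hasDerivAt (hper 0 (by omega)) (hg 0 (by omega)) (hcont 1 (by omega)) hk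
    simp only [zero_add] at h0 h1 h2 h3
    rw [le_div_iff₀ hk'] at h0 h1 h2 h3
    rw [le_div_iff₀ (by positivity)]
    calc ‖coeffK (g 0) k‖ * |(k : ℝ)| ^ 4
        = ‖coeffK (g 0) k‖ * |(k : ℝ)| * |(k : ℝ)| * |(k : ℝ)| * |(k : ℝ)| := by ring
      _ ≤ ‖coeffK (g 1) k‖ * |(k : ℝ)| * |(k : ℝ)| * |(k : ℝ)| := by gcongr
      _ ≤ ‖coeffK (g 2) k‖ * |(k : ℝ)| * |(k : ℝ)| := by gcongr
      _ ≤ ‖coeffK (g 3) k‖ * |(k : ℝ)| := by gcongr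
      _ ≤ _ := h3
      _ ≤ B := h4
  have hsum2 : Summable fun k : ℤ => 1 / (k : ℝ) ^ 2 :=
    Real.summable_one_div_int_pow.2 (by norm_num)
  have hnorm : ∀ k : ℤ, ‖coeffK (g 0) k * expK k x‖ = ‖coeffK (g 0) k‖ := fun k => by
    rw [norm_mul, norm_expK, mul_one]
  -- pointwise convergence of the Fourier series
  have hsum : HasSum (fun k : ℤ => coeffK (g 0) k * expK k x) ((g 0 x : ℝ) : ℂ) := by
    have hpc : Function.Periodic (fun s => ((g 0 s : ℝ) : ℂ)) 1 := fun s => by simp only [hp s]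
    let F : C(AddCircle (1 : ℝ), ℂ) := ⟨hpc.lift, by
      have : Continuous fun s => ((g 0 s : ℝ) : ℂ) :=
        Complex.continuous_ofReal.comp (hcont 0 (by omega))
      exact continuous_coinduced_dom.2 this⟩
    have hF : ∀ s : ℝ, F (s : AddCircle (1 : ℝ)) = ((g 0 s : ℝ) : ℂ) := fun s => hpc.lift_coe s
    have hco : ∀ k, fourierCoeff F k = coeffK (g 0) k := by
      intro k
      rw [fourierCoeff_eq_intervalIntegral F k 0, coeffK_eq]
      simp only [zero_add, div_one, one_smul]
      refine intervalIntegral.integral_congr fun s _ => ?_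
      simp only [smul_eq_mul, hF, fourier_one_eq _ _ rfl]
    have hS : Summable (fourierCoeff F) := by
      refine Summable.of_norm_bounded_eventually (g := fun k : ℤ => B * (1 / (k : ℝ) ^ 2))
        (hsum2.mul_left B) ?_
      rw [Filter.eventually_cofinite]
      refine (Set.finite_singleton (0 : ℤ)).subset fun k hk => ?_
      by_contra hk0
      refine hk ?_
      have hk0 : k ≠ 0 := hk0
      rw [hco]
      refine (hcoef k hk0).trans ?_
      rw [mul_one_div, ← sq_abs (k : ℝ)]
      have h1 : (1 : ℝ) ≤ |(k : ℝ)| := by exact_mod_cast Int.one_le_abs hk0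
      exact div_le_div_of_nonneg_left hB0 (by positivity)
        (pow_le_pow_right₀ h1 (by norm_num))
    have := has_pointwise_sum_fourier_series_of_summable hS (x : AddCircle (1 : ℝ))
    simp only [hco, hF, fourier_one_eq _ _ rfl, smul_eq_mul] at this
    exact this
  set s := Icc (-(K : ℤ)) K with hs
  have hfin : HasSum (fun k : ℤ => if k ∈ s then coeffK (g 0) k * expK k x else 0)
      (∑ k ∈ s, coeffK (g 0) k * expK k x) := by
    have : HasSum (fun k : ℤ => if k ∈ s then coeffK (g 0) k * expK k x else 0)
        (∑ k ∈ s, if k ∈ s then coeffK (g 0) k * expK k x else 0) :=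
      hasSum_sum_of_ne_finset_zero fun k hk => if_neg hk
    rwa [sum_congr rfl fun k hk => if_pos hk] at this
  -- Outside the truncation range `|k|⁻⁴ ≤ K⁻² k⁻²`: two powers give the rate and the other two make
  -- the tail summable.
  have hbound := (hfin.sub hsum).norm_le_of_bounded
    (hsum2.mul_left (B / (K : ℝ) ^ 2)).hasSum fun k => by
      have hKpos : (0 : ℝ) < K := by exact_mod_cast hK
      split_ifs with hk
      · simp only [sub_self, norm_zero]; positivity
      · rw [zero_sub, norm_neg, hnorm]
        have hk0 : k ≠ 0 := by
          rintro rfl; apply hk; rw [hs, mem_Icc]; constructor <;> omega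
        refine (hcoef k hk0).trans ?_
        have hkK : (K : ℝ) ≤ |(k : ℝ)| := by
          rw [hs, mem_Icc] at hk
          have : (K : ℤ) ≤ |k| := by
            by_contra hcon
            exact hk (abs_le.1 (by omega))
          exact_mod_cast this
        rw [div_mul_div_comm, mul_one, ← sq_abs (k : ℝ)]
        refine div_le_div_of_nonneg_left hB0 (by have := hKpos.trans_le hkK; positivity) ?_
        have := hKpos.trans_le hkK
        calc (K : ℝ) ^ 2 * |(k : ℝ)| ^ 2 ≤ |(k : ℝ)| ^ 2 * |(k : ℝ)| ^ 2 := by gcongr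
          _ = |(k : ℝ)| ^ 4 := by ring
  have hre : |partialSum K (g 0) x - g 0 x| ≤
      ‖∑ k ∈ s, coeffK (g 0) k * expK k x - ((g 0 x : ℝ) : ℂ)‖ := by
    refine le_trans (le_of_eq ?_) (Complex.abs_re_le_norm _)
    rw [Complex.sub_re, Complex.ofReal_re]; rfl
  refine hre.trans (hbound.trans ?_)
  rw [tsum_mul_left, fourierConst]
  have hKpos : (0 : ℝ) < K := by exact_mod_cast hK
  -- The factor `9` comes from `N = 2K + 1 ≤ 3K`, which needs `K ≥ 1`.
  have hKm : B / (K : ℝ) ^ 2 ≤ 9 * B * mesh K ^ 2 := by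
    unfold mesh
    rw [div_pow, one_pow, mul_one_div, div_le_div_iff₀ (by positivity) (by positivity)]
    have : (cells K : ℝ) ≤ 3 * K := by
      simp only [cells]; push_cast
      have : (1 : ℝ) ≤ K := by exact_mod_cast hK
      linarith
    have h2 : (cells K : ℝ) ^ 2 ≤ 9 * (K : ℝ) ^ 2 := by
      calc (cells K : ℝ) ^ 2 ≤ (3 * (K : ℝ)) ^ 2 := by gcongr
        _ = 9 * (K : ℝ) ^ 2 := by ring
    calc B * (cells K : ℝ) ^ 2 ≤ B * (9 * (K : ℝ) ^ 2) := by gcongr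
      _ = 9 * B * (K : ℝ) ^ 2 := by ring
  have hZ : 0 ≤ ∑' k : ℤ, 1 / (k : ℝ) ^ 2 := tsum_nonneg fun _ => by positivity
  calc B / (K : ℝ) ^ 2 * ∑' k : ℤ, 1 / (k : ℝ) ^ 2
      ≤ 9 * B * mesh K ^ 2 * ∑' k : ℤ, 1 / (k : ℝ) ^ 2 := by gcongr
    _ = _ := by ring

/-! ### Taylor expansion along chains of derivatives -/

/-- Induction on the order: the derivative of the remainder is the remainder of one order less for
the shifted chain, and the mean value inequality integrates it. Derivatives within a convex set are
used so that the expansion is valid up to `y = 0` and `y = 1`; the factor `1/n!` is not kept. -/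
theorem taylor_chain {S : Set ℝ} (hS : Convex ℝ S) (n : ℕ) : ∀ {g : ℕ → ℝ → ℝ} {B : ℝ},
    (∀ k < n, ∀ y ∈ S, HasDerivWithinAt (g k) (g (k + 1) y) S y) → (∀ y ∈ S, |g n y| ≤ B) →
    ∀ {y z : ℝ}, y ∈ S → z ∈ S →
      |g 0 z - ∑ k ∈ range n, g k y * (z - y) ^ k / (k.factorial : ℝ)| ≤ B * |z - y| ^ n := by
  induction n with
  | zero => intro g B _ hB y z _ hz; simpa using hB z hz
  | succ n ih =>
    intro g B hg hB y z hy hz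
    have hB0 : 0 ≤ B := (abs_nonneg _).trans (hB y hy)
    have hsub : Set.uIcc y z ⊆ S := hS.ordConnected.uIcc_subset hy hz
    set r : ℝ → ℝ := fun w => g 0 w -
      ((∑ k ∈ range n, g (k + 1) y * (w - y) ^ (k + 1) / ((k + 1).factorial : ℝ)) + g 0 y) with hr
    set r' : ℝ → ℝ := fun w => g 1 w - ∑ k ∈ range n, g (k + 1) y * (w - y) ^ k / (k.factorial : ℝ)
      with hr'
    have hder : ∀ w ∈ Set.uIcc y z, HasDerivWithinAt r (r' w) (Set.uIcc y z) w := by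
      intro w hw
      refine ((hg 0 (by omega) w (hsub hw)).mono hsub).sub (HasDerivWithinAt.add_const _ ?_)
      refine HasDerivWithinAt.fun_sum fun k _ => ?_
      have h1 : HasDerivWithinAt (fun w : ℝ => (w - y) ^ (k + 1)) ((k + 1 : ℕ) * (w - y) ^ k)
          (Set.uIcc y z) w := by
        have := ((hasDerivWithinAt_id w (Set.uIcc y z)).sub_const y).fun_pow (k + 1)
        simpa using this
      have h2 := (h1.const_mul (g (k + 1) y)).div_const ((k + 1).factorial : ℝ)
      refine h2.congr_deriv ?_
      rw [Nat.factorial_succ]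
      have : ((k.factorial : ℕ) : ℝ) ≠ 0 := by exact_mod_cast k.factorial_ne_zero
      push_cast
      field_simp
    have hbd : ∀ w ∈ Set.uIcc y z, ‖r' w‖ ≤ B * |z - y| ^ n := by
      intro w hw
      have := ih (g := fun k => g (k + 1)) (fun k hk => hg (k + 1) (by omega)) hB hy (hsub hw)
      rw [Real.norm_eq_abs]
      refine this.trans ?_
      exact mul_le_mul_of_nonneg_left
        (pow_le_pow_left₀ (abs_nonneg _) (Set.abs_sub_left_of_mem_uIcc hw) n) hB0
    have := (convex_uIcc y z).norm_image_sub_le_of_norm_hasDerivWithin_le hder hbd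
      Set.left_mem_uIcc Set.right_mem_uIcc
    have hry : r y = 0 := by simp [hr]
    rw [hry, sub_zero, Real.norm_eq_abs, Real.norm_eq_abs] at this
    rw [sum_range_succ', pow_succ, ← mul_assoc]
    simpa [hr] using this

/-- Centred second difference quotient. -/
noncomputable def diff2 (h : ℝ) (g : ℝ → ℝ) (x : ℝ) : ℝ := (g (x + h) - 2 * g x + g (x - h)) / h ^ 2

/-- In the sum of the two Taylor expansions the odd terms cancel. -/
theorem diff2_sub_le {S : Set ℝ} (hS : Convex ℝ S) {g : ℕ → ℝ → ℝ} {B h y : ℝ} (hh : 0 < h)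
    (hg : ∀ k < 4, ∀ y ∈ S, HasDerivWithinAt (g k) (g (k + 1) y) S y)
    (hB : ∀ y ∈ S, |g 4 y| ≤ B) (hy : y ∈ S) (hp : y + h ∈ S) (hm : y - h ∈ S) :
    |diff2 h (g 0) y - g 2 y| ≤ 2 * B * h ^ 2 := by
  have h1 := taylor_chain hS 4 hg hB hy hp
  have h2 := taylor_chain hS 4 hg hB hy hm
  simp only [sum_range_succ, sum_range_zero, add_sub_cancel_left, sub_sub_cancel_left, abs_neg,
    abs_of_pos hh, Nat.factorial] at h1 h2
  have e : diff2 h (g 0) y - g 2 y = (g 0 (y + h) - 2 * g 0 y + g 0 (y - h) - g 2 y * h ^ 2) / h ^ 2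
    := by unfold diff2; field_simp
  rw [e, abs_div, abs_of_pos (show 0 < h ^ 2 by positivity), div_le_iff₀ (by positivity)]
  rw [abs_le] at h1 h2 ⊢
  push_cast at h1 h2
  constructor <;> nlinarith [h1.1, h1.2, h2.1, h2.2]

/-- Third-order Taylor expansion towards the interior. No cancellation is available, so the error is
only of order `h`. The first derivative is kept explicitly: it vanishes for the chemical potential
and is the normal flux for the phase variable. -/
theorem onesided_sub_le {S : Set ℝ} (hS : Convex ℝ S) {g : ℕ → ℝ → ℝ} {B h y s : ℝ} (hh : 0 < h)
    (hs : |s| = 1) (hg : ∀ k < 3, ∀ y ∈ S, HasDerivWithinAt (g k) (g (k + 1) y) S y)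
    (hB : ∀ y ∈ S, |g 3 y| ≤ B) (hy : y ∈ S) (hp : y + s * h ∈ S) :
    |2 / h ^ 2 * (g 0 (y + s * h) - g 0 y) - g 2 y - 2 / h * s * g 1 y| ≤ 2 * B * h := by
  have h1 := taylor_chain hS 3 hg hB hy hp
  have hs2 : s ^ 2 = 1 := by rw [← sq_abs, hs]; norm_num
  simp only [sum_range_succ, sum_range_zero, add_sub_cancel_left, abs_mul, hs, one_mul,
    abs_of_pos hh, Nat.factorial] at h1
  have e : 2 / h ^ 2 * (g 0 (y + s * h) - g 0 y) - g 2 y - 2 / h * s * g 1 y =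
      2 * (g 0 (y + s * h) - g 0 y - g 1 y * (s * h) - g 2 y * (s * h) ^ 2 / 2) / h ^ 2 := by
    rw [mul_pow, hs2]; field_simp; ring
  rw [e, abs_div, abs_of_pos (show 0 < h ^ 2 by positivity), div_le_iff₀ (by positivity)]
  rw [abs_le] at h1 ⊢
  push_cast at h1
  constructor <;> nlinarith [h1.1, h1.2]

/-! ### Composition with the logarithmic potential -/

/-- The derivatives of `logPart ∘ g 0`, where `g k` is the `k`-th derivative of `g 0`. -/
noncomputable def logChain (g : ℕ → ℝ → ℝ) (k : ℕ) (y : ℝ) : ℝ :=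
  let P := (1 + g 0 y)⁻¹
  let Q := (1 - g 0 y)⁻¹
  match k with
  | 0 => logPart (g 0 y)
  | 1 => (P + Q) * g 1 y
  | 2 => (Q ^ 2 - P ^ 2) * g 1 y ^ 2 + (P + Q) * g 2 y
  | 3 => 2 * (P ^ 3 + Q ^ 3) * g 1 y ^ 3 + 3 * (Q ^ 2 - P ^ 2) * (g 1 y * g 2 y) + (P + Q) * g 3 y
  | _ => 6 * (Q ^ 4 - P ^ 4) * g 1 y ^ 4 + 12 * (P ^ 3 + Q ^ 3) * (g 1 y ^ 2 * g 2 y)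
      + 3 * (Q ^ 2 - P ^ 2) * g 2 y ^ 2 + 4 * (Q ^ 2 - P ^ 2) * (g 1 y * g 3 y) + (P + Q) * g 4 y

/-- With `P` and `Q` the reciprocals of `1 ± g`, the rules `P' = -g' P²` and `Q' = g' Q²` reduce
every order to polynomial algebra. The last branch of the definition is the fourth derivative; no
higher order is used. -/
theorem logChain_hasDeriv {S : Set ℝ} {g : ℕ → ℝ → ℝ}
    (hg : ∀ k < 4, ∀ y ∈ S, HasDerivWithinAt (g k) (g (k + 1) y) S y)
    (hsep : ∀ y ∈ S, 0 < 1 + g 0 y ∧ 0 < 1 - g 0 y) :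
    ∀ k < 4, ∀ y ∈ S, HasDerivWithinAt (logChain g k) (logChain g (k + 1) y) S y := by
  intro k hk y hy
  have g0 := hg 0 (by omega) y hy
  have g1 := hg 1 (by omega) y hy
  have g2 := hg 2 (by omega) y hy
  have g3 := hg 3 (by omega) y hy
  simp only [zero_add, Nat.reduceAdd] at g0 g1 g2 g3
  have p0 := (hsep y hy).1.ne'
  have q0 := (hsep y hy).2.ne'
  have hP : HasDerivWithinAt (fun y => (1 + g 0 y)⁻¹) (-(g 1 y) * ((1 + g 0 y)⁻¹) ^ 2) S y := by
    refine ((g0.const_add 1).fun_inv p0).congr_deriv ?_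
    field_simp
  have hQ : HasDerivWithinAt (fun y => (1 - g 0 y)⁻¹) (g 1 y * ((1 - g 0 y)⁻¹) ^ 2) S y := by
    refine ((g0.const_sub 1).fun_inv q0).congr_deriv ?_
    field_simp
  have hk' : k = 0 ∨ k = 1 ∨ k = 2 ∨ k = 3 := by omega
  rcases hk' with rfl | rfl | rfl | rfl
  · refine (((g0.const_add 1).log p0).sub ((g0.const_sub 1).log q0)).congr_deriv ?_
    simp only [logChain]; field_simp; ring
  · refine ((hP.add hQ).mul g1).congr_deriv ?_
    simp only [logChain, Pi.add_apply]; ring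
  · refine ((((hQ.fun_pow 2).sub (hP.fun_pow 2)).mul (g1.fun_pow 2)).add
      ((hP.add hQ).mul g2)).congr_deriv ?_
    simp only [logChain, Pi.add_apply, Pi.sub_apply]; push_cast; ring
  · refine ((((((hP.fun_pow 3).add (hQ.fun_pow 3)).const_mul 2).mul (g1.fun_pow 3)).add
      ((((hQ.fun_pow 2).sub (hP.fun_pow 2)).const_mul 3).mul (g1.mul g2))).add
      ((hP.add hQ).mul g3)).congr_deriv ?_
    simp only [logChain, Pi.add_apply, Pi.sub_apply, Pi.mul_apply]; push_cast; ring

/-- Bound for the derivatives of order `≤ 4` of the logarithmic part. -/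
noncomputable def logBound (ε₀ B : ℝ) : ℝ := 40 * (1 + 1 / ε₀) ^ 4 * (1 + B) ^ 4

theorem logBound_nonneg {ε₀ B : ℝ} (hε₀ : 0 < ε₀) (hB : 0 ≤ B) : 0 ≤ logBound ε₀ B := by
  unfold logBound; positivity

theorem abs_mul_le_mul {a b c d : ℝ} (ha : |a| ≤ c) (hb : |b| ≤ d) : |a * b| ≤ c * d := by
  rw [abs_mul]; exact mul_le_mul ha hb (abs_nonneg b) ((abs_nonneg a).trans ha)

theorem abs_logChain_le {g : ℕ → ℝ → ℝ} {ε₀ B y : ℝ} (hε₀ : 0 < ε₀)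
    (hsep : ε₀ ≤ 1 + g 0 y ∧ ε₀ ≤ 1 - g 0 y) (hB : ∀ k ≤ 4, |g k y| ≤ B) {k : ℕ} (hk3 : 3 ≤ k)
    (hk4 : k ≤ 4) : |logChain g k y| ≤ logBound ε₀ B := by
  have hB0 : 0 ≤ B := (abs_nonneg _).trans (hB 0 (by omega))
  set A := 1 + 1 / ε₀ with hA
  set b := 1 + B with hb
  have hA1 : 1 ≤ A := by have : 0 < 1 / ε₀ := by positivity
                         linarith
  have hb1 : 1 ≤ b := by linarith
  have hgb : ∀ k ≤ 4, |g k y| ≤ b := fun k hk => (hB k hk).trans (by linarith)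
  have hinv : ∀ x, ε₀ ≤ x → 0 < x⁻¹ ∧ x⁻¹ ≤ A := by
    intro x hx
    have hx0 : 0 < x := hε₀.trans_le hx
    refine ⟨inv_pos.2 hx0, ?_⟩
    have : x⁻¹ ≤ 1 / ε₀ := by rw [one_div]; exact inv_anti₀ hε₀ hx
    linarith
  obtain ⟨P0, PA⟩ := hinv _ hsep.1
  obtain ⟨Q0, QA⟩ := hinv _ hsep.2
  set P := (1 + g 0 y)⁻¹ with hP
  set Q := (1 - g 0 y)⁻¹ with hQ
  have hdiff : ∀ n, n ≤ 4 → |Q ^ n - P ^ n| ≤ A ^ 4 ∧ |P ^ n + Q ^ n| ≤ 2 * A ^ 4 := by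
    intro n hn
    have a1 : P ^ n ≤ A ^ 4 := (pow_le_pow_left₀ P0.le PA n).trans (pow_le_pow_right₀ hA1 hn)
    have a2 : Q ^ n ≤ A ^ 4 := (pow_le_pow_left₀ Q0.le QA n).trans (pow_le_pow_right₀ hA1 hn)
    have a3 : 0 < P ^ n := pow_pos P0 n
    have a4 : 0 < Q ^ n := pow_pos Q0 n
    constructor <;> rw [abs_le] <;> constructor <;> linarith
  have m1 := hgb 1 (by omega)
  have m2 := hgb 2 (by omega)
  have m3 := hgb 3 (by omega)
  have m4 := hgb 4 (by omega)
  have hpw : ∀ n ≤ 4, b ^ n ≤ b ^ 4 := fun n hn => pow_le_pow_right₀ hb1 hn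
  have hbb : b ≤ b ^ 4 := by simpa using hpw 1 (by omega)
  have q1 : ∀ n ≤ 4, |g 1 y ^ n| ≤ b ^ 4 := fun n hn => by
    rw [abs_pow]; exact (pow_le_pow_left₀ (abs_nonneg _) m1 n).trans (hpw n hn)
  have q12 : |g 1 y * g 2 y| ≤ b ^ 4 :=
    (abs_mul_le_mul m1 m2).trans (by simpa [pow_two] using hpw 2 (by omega))
  have q13 : |g 1 y * g 3 y| ≤ b ^ 4 :=
    (abs_mul_le_mul m1 m3).trans (by simpa [pow_two] using hpw 2 (by omega))
  have q22 : |g 2 y ^ 2| ≤ b ^ 4 := by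
    rw [abs_pow]; exact (pow_le_pow_left₀ (abs_nonneg _) m2 2).trans (hpw 2 (by omega))
  have q112 : |g 1 y ^ 2 * g 2 y| ≤ b ^ 4 := by
    refine (abs_mul_le_mul (d := b) (c := b ^ 2) ?_ m2).trans ?_
    · rw [abs_pow]; exact pow_le_pow_left₀ (abs_nonneg _) m1 2
    · simpa [pow_succ] using hpw 3 (by omega)
  have hPQ : |P + Q| ≤ 2 * A ^ 4 := by simpa using (hdiff 1 (by omega)).2
  have hD2 := (hdiff 2 (by omega)).1
  have hD4 := (hdiff 4 (by omega)).1
  have hS3 := (hdiff 3 (by omega)).2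
  unfold logBound
  rw [← hA, ← hb]
  have r3 := abs_le.1 (abs_mul_le_mul hPQ (m3.trans hbb))
  have r4 := abs_le.1 (abs_mul_le_mul hPQ (m4.trans hbb))
  have r12 := abs_le.1 (abs_mul_le_mul hD2 q12)
  have r13 := abs_le.1 (abs_mul_le_mul hD2 q13)
  have r22 := abs_le.1 (abs_mul_le_mul hD2 q22)
  have r1 := abs_le.1 (abs_mul_le_mul hD4 (q1 4 (by omega)))
  have r111 := abs_le.1 (abs_mul_le_mul hS3 (q1 3 (by omega)))
  have r112 := abs_le.1 (abs_mul_le_mul hS3 q112)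
  have hpos : 0 ≤ A ^ 4 * b ^ 4 := by positivity
  rw [abs_le]
  have hk : k = 3 ∨ k = 4 := by omega
  rcases hk with rfl | rfl
  · simp only [logChain, ← hP, ← hQ]
    constructor <;> linarith [r3.1, r3.2, r12.1, r12.2, r111.1, r111.2]
  -- The fourth-order coefficients, counting each sum of reciprocals twice, add up to `6 + 24 + 3 +
  -- 4 + 2 = 39`, whence the constant `40`.
  · simp only [logChain, ← hP, ← hQ]
    constructor <;>
      linarith [r4.1, r4.2, r13.1, r13.2, r22.1, r22.2, r1.1, r1.2, r112.1, r112.2]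

/-! ### Partial derivatives on the closed strip -/

theorem uniqueDiffOn_strip : UniqueDiffOn ℝ strip :=
  uniqueDiffOn_univ.prod (uniqueDiffOn_Icc zero_lt_one)

theorem mem_strip {x y : ℝ} (hy : y ∈ Set.Icc (0 : ℝ) 1) : (x, y) ∈ strip := ⟨trivial, hy⟩

/-- The `x`-derivative, from the Fréchet derivative within the strip. -/
noncomputable def dX (f : ℝ → ℝ → ℝ) (x y : ℝ) : ℝ :=
  fderivWithin ℝ (Function.uncurry f) strip (x, y) (1, 0)

/-- The `y`-derivative, from the Fréchet derivative within the strip. -/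
noncomputable def dY (f : ℝ → ℝ → ℝ) (x y : ℝ) : ℝ :=
  fderivWithin ℝ (Function.uncurry f) strip (x, y) (0, 1)

theorem hasDerivAt_dX {f : ℝ → ℝ → ℝ} (hf : ContDiffOn ℝ 1 (Function.uncurry f) strip) (x : ℝ)
    {y : ℝ} (hy : y ∈ Set.Icc (0 : ℝ) 1) : HasDerivAt (fun x' => f x' y) (dX f x y) x := by
  have h1 := ((hf.differentiableOn (by norm_num)) (x, y) (mem_strip hy)).hasFDerivWithinAt
  have h2 : HasDerivWithinAt (fun x' : ℝ => (x', y)) ((1 : ℝ), (0 : ℝ)) Set.univ x :=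
    ((hasDerivAt_id x).prodMk (hasDerivAt_const x y)).hasDerivWithinAt
  have h3 := h1.comp_hasDerivWithinAt x h2 fun x' _ => mem_strip hy
  rw [hasDerivWithinAt_univ] at h3
  exact h3

theorem hasDerivWithinAt_dY {f : ℝ → ℝ → ℝ} (hf : ContDiffOn ℝ 1 (Function.uncurry f) strip)
    (x : ℝ) {y : ℝ} (hy : y ∈ Set.Icc (0 : ℝ) 1) :
    HasDerivWithinAt (fun y' => f x y') (dY f x y) (Set.Icc 0 1) y := by
  have h1 := ((hf.differentiableOn (by norm_num)) (x, y) (mem_strip hy)).hasFDerivWithinAt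
  have h2 : HasDerivWithinAt (fun y' : ℝ => (x, y')) ((0 : ℝ), (1 : ℝ)) (Set.Icc 0 1) y :=
    ((hasDerivAt_const y x).prodMk (hasDerivAt_id y)).hasDerivWithinAt
  exact h1.comp_hasDerivWithinAt y h2 fun y' hy' => mem_strip hy'

theorem contDiffOn_dX {f : ℝ → ℝ → ℝ} {n : ℕ}
    (hf : ContDiffOn ℝ ((n + 1 : ℕ) : WithTop ℕ∞) (Function.uncurry f) strip) :
    ContDiffOn ℝ (n : WithTop ℕ∞) (Function.uncurry (dX f)) strip := by
  have := hf.fderivWithin (m := (n : WithTop ℕ∞)) uniqueDiffOn_strip (by push_cast; exact le_rfl)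
  exact this.clm_apply contDiffOn_const

theorem contDiffOn_dY {f : ℝ → ℝ → ℝ} {n : ℕ}
    (hf : ContDiffOn ℝ ((n + 1 : ℕ) : WithTop ℕ∞) (Function.uncurry f) strip) :
    ContDiffOn ℝ (n : WithTop ℕ∞) (Function.uncurry (dY f)) strip := by
  have := hf.fderivWithin (m := (n : WithTop ℕ∞)) uniqueDiffOn_strip (by push_cast; exact le_rfl)
  exact this.clm_apply contDiffOn_const

theorem dX_congr {f g : ℝ → ℝ → ℝ} (h : ∀ x, ∀ y ∈ Set.Icc (0 : ℝ) 1, f x y = g x y) (x : ℝ)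
    {y : ℝ} (hy : y ∈ Set.Icc (0 : ℝ) 1) : dX f x y = dX g x y := by
  unfold dX
  have h' : Set.EqOn (Function.uncurry f) (Function.uncurry g) strip :=
    fun p hp => h p.1 p.2 hp.2
  rw [fderivWithin_congr h' (h' (mem_strip hy))]

theorem dY_congr {f g : ℝ → ℝ → ℝ} (h : ∀ x, ∀ y ∈ Set.Icc (0 : ℝ) 1, f x y = g x y) (x : ℝ)
    {y : ℝ} (hy : y ∈ Set.Icc (0 : ℝ) 1) : dY f x y = dY g x y := by
  unfold dY
  have h' : Set.EqOn (Function.uncurry f) (Function.uncurry g) strip :=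
    fun p hp => h p.1 p.2 hp.2
  rw [fderivWithin_congr h' (h' (mem_strip hy))]

/-- Mixed second partial derivatives commute on the closed strip. -/
theorem dX_dY_comm {f : ℝ → ℝ → ℝ} (hf : ContDiffOn ℝ 2 (Function.uncurry f) strip) (x : ℝ)
    {y : ℝ} (hy : y ∈ Set.Icc (0 : ℝ) 1) : dX (dY f) x y = dY (dX f) x y := by
  -- Symmetry of the second derivative extends to the boundary because every point of the strip is a
  -- limit of interior points.
  have hcl : (x, y) ∈ closure (interior strip) := by
    unfold strip
    rw [interior_prod_eq, interior_univ, interior_Icc, closure_prod_eq, closure_univ,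
      closure_Ioo zero_ne_one]
    exact ⟨trivial, hy⟩
  have hsymm := (hf (x, y) (mem_strip hy)).isSymmSndFDerivWithinAt (by simp)
    uniqueDiffOn_strip hcl (mem_strip hy)
  have hd : DifferentiableWithinAt ℝ (fderivWithin ℝ (Function.uncurry f) strip) strip (x, y) :=
    ((hf.fderivWithin (m := 1) uniqueDiffOn_strip (by norm_num)).differentiableOn
      (by norm_num)) (x, y) (mem_strip hy)
  have key : ∀ v w : ℝ × ℝ, fderivWithin ℝ (fun p => fderivWithin ℝ (Function.uncurry f) strip p v)
      strip (x, y) w = fderivWithin ℝ (fderivWithin ℝ (Function.uncurry f) strip) strip (x, y) w v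
      := by
    intro v w
    have := (hd.hasFDerivWithinAt.clm_apply (hasFDerivWithinAt_const v (x, y) strip)).fderivWithin
      (uniqueDiffOn_strip _ (mem_strip hy))
    rw [this]; simp
  have e1 : dX (dY f) x y = fderivWithin ℝ (fun p => fderivWithin ℝ (Function.uncurry f) strip p
    (0, 1)) strip (x, y) (1, 0) := rfl
  have e2 : dY (dX f) x y = fderivWithin ℝ (fun p => fderivWithin ℝ (Function.uncurry f) strip p
    (1, 0)) strip (x, y) (0, 1) := rfl
  rw [e1, e2, key, key]
  exact hsymm.eq _ _

theorem pd_zero_zero (f : ℝ → ℝ → ℝ) (x y : ℝ) : pd 0 0 f x y = f x y := by simp [pd]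

theorem pd_succ_left (a b : ℕ) (f : ℝ → ℝ → ℝ) (x y : ℝ) :
    pd (a + 1) b f x y = deriv (fun x' => pd a b f x' y) x := by
  unfold pd; rw [iteratedDeriv_succ]

theorem pd_zero_succ (b : ℕ) (f : ℝ → ℝ → ℝ) (x y : ℝ) :
    pd 0 (b + 1) f x y = derivWithin (fun y' => pd 0 b f x y') (Set.Icc 0 1) y := by
  unfold pd; simp only [iteratedDeriv_zero]; rw [iteratedDerivWithin_succ]

theorem pd_succ_left_eq_dX {a b : ℕ} {f : ℝ → ℝ → ℝ}
    (hf : ContDiffOn ℝ 1 (Function.uncurry (pd a b f)) strip) (x : ℝ) {y : ℝ}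
    (hy : y ∈ Set.Icc (0 : ℝ) 1) : pd (a + 1) b f x y = dX (pd a b f) x y := by
  rw [pd_succ_left]; exact (hasDerivAt_dX hf x hy).deriv

theorem pd_zero_succ_eq_dY {b : ℕ} {f : ℝ → ℝ → ℝ}
    (hf : ContDiffOn ℝ 1 (Function.uncurry (pd 0 b f)) strip) (x : ℝ) {y : ℝ}
    (hy : y ∈ Set.Icc (0 : ℝ) 1) : pd 0 (b + 1) f x y = dY (pd 0 b f) x y := by
  rw [pd_zero_succ]
  exact (hasDerivWithinAt_dY hf x hy).derivWithin (uniqueDiffOn_Icc zero_lt_one y hy)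

theorem contDiffOn_one_of_succ {f : ℝ → ℝ → ℝ} {n : ℕ}
    (hf : ContDiffOn ℝ ((n + 1 : ℕ) : WithTop ℕ∞) (Function.uncurry f) strip) :
    ContDiffOn ℝ 1 (Function.uncurry f) strip :=
  hf.of_le (by exact_mod_cast Nat.le_add_left 1 n)

/-- `pd` takes all `y`-derivatives before the `x`-derivatives, and the induction follows that order.
Each step is a partial Fréchet derivative within the strip and costs one order of smoothness. -/
theorem contDiffOn_pd {f : ℝ → ℝ → ℝ} (a b : ℕ) : ∀ {n : ℕ},
    ContDiffOn ℝ ((n + a + b : ℕ) : WithTop ℕ∞) (Function.uncurry f) strip →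
    ContDiffOn ℝ (n : WithTop ℕ∞) (Function.uncurry (pd a b f)) strip := by
  induction a with
  | zero =>
    induction b with
    | zero =>
      intro n hf
      refine hf.congr fun p _ => ?_
      exact pd_zero_zero f p.1 p.2
    | succ b ih =>
      intro n hf
      have h1 := ih (n := n + 1) (by convert hf using 2; ring)
      refine (contDiffOn_dY h1).congr fun p hp => ?_
      exact pd_zero_succ_eq_dY (contDiffOn_one_of_succ h1) p.1 hp.2
  | succ a ih =>
    intro n hf
    have h1 := ih (n := n + 1) (by convert hf using 2; ring)
    refine (contDiffOn_dX h1).congr fun p hp => ?_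
    exact pd_succ_left_eq_dX (contDiffOn_one_of_succ h1) p.1 hp.2

theorem contDiffOn_pd_of_le {f : ℝ → ℝ → ℝ} {m : ℕ} (n a b : ℕ)
    (hf : ContDiffOn ℝ (m : WithTop ℕ∞) (Function.uncurry f) strip) (hm : n + a + b ≤ m) :
    ContDiffOn ℝ (n : WithTop ℕ∞) (Function.uncurry (pd a b f)) strip :=
  contDiffOn_pd a b (hf.of_le (by exact_mod_cast hm))

theorem hasDerivAt_pd {f : ℝ → ℝ → ℝ} {m : ℕ} {a b : ℕ}
    (hf : ContDiffOn ℝ (m : WithTop ℕ∞) (Function.uncurry f) strip) (hm : a + b + 1 ≤ m) (x : ℝ)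
    {y : ℝ} (hy : y ∈ Set.Icc (0 : ℝ) 1) :
    HasDerivAt (fun x' => pd a b f x' y) (pd (a + 1) b f x y) x := by
  have h1 : ContDiffOn ℝ 1 (Function.uncurry (pd a b f)) strip := by
    exact_mod_cast contDiffOn_pd_of_le 1 a b hf (by omega)
  rw [pd_succ_left_eq_dX h1 x hy]
  exact hasDerivAt_dX h1 x hy

/-- The new `y`-derivative is innermost in `pd`; it is moved outside past one `x`-derivative at a
time by `dX_dY_comm`. -/
theorem pd_succ_right_eq_dY {f : ℝ → ℝ → ℝ} {m : ℕ} (a : ℕ) {b : ℕ}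
    (hf : ContDiffOn ℝ (m : WithTop ℕ∞) (Function.uncurry f) strip) (hm : a + b + 1 ≤ m) (x : ℝ)
    {y : ℝ} (hy : y ∈ Set.Icc (0 : ℝ) 1) : pd a (b + 1) f x y = dY (pd a b f) x y := by
  induction a generalizing x y with
  | zero => exact pd_zero_succ_eq_dY (by exact_mod_cast contDiffOn_pd_of_le 1 0 b hf (by omega)) x hy
  | succ a ih =>
    have h1 : ContDiffOn ℝ 1 (Function.uncurry (pd a (b + 1) f)) strip := by
      exact_mod_cast contDiffOn_pd_of_le 1 a (b + 1) hf (by omega)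
    have h2 : ContDiffOn ℝ 2 (Function.uncurry (pd a b f)) strip := by
      exact_mod_cast contDiffOn_pd_of_le 2 a b hf (by omega)
    rw [pd_succ_left_eq_dX h1 x hy, dX_congr (fun x y hy => ih (by omega) x hy) x hy,
      dX_dY_comm h2 x hy]
    exact dY_congr (fun x y hy => (pd_succ_left_eq_dX (h2.of_le (by norm_num)) x hy).symm) x hy

theorem hasDerivWithinAt_pd {f : ℝ → ℝ → ℝ} {m : ℕ} {a b : ℕ}
    (hf : ContDiffOn ℝ (m : WithTop ℕ∞) (Function.uncurry f) strip) (hm : a + b + 1 ≤ m) (x : ℝ)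
    {y : ℝ} (hy : y ∈ Set.Icc (0 : ℝ) 1) :
    HasDerivWithinAt (fun y' => pd a b f x y') (pd a (b + 1) f x y) (Set.Icc 0 1) y := by
  rw [pd_succ_right_eq_dY a hf hm x hy]
  exact hasDerivWithinAt_dY (by exact_mod_cast contDiffOn_pd_of_le 1 a b hf (by omega)) x hy

theorem continuous_pd_x {f : ℝ → ℝ → ℝ} {m : ℕ} {a b : ℕ}
    (hf : ContDiffOn ℝ (m : WithTop ℕ∞) (Function.uncurry f) strip) (hm : a + b ≤ m)
    {y : ℝ} (hy : y ∈ Set.Icc (0 : ℝ) 1) : Continuous fun x => pd a b f x y := by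
  have h1 := (contDiffOn_pd_of_le 0 a b hf (by omega)).continuousOn
  exact h1.comp_continuous (f := fun x => (x, y)) (by fun_prop) fun x => mem_strip hy

theorem continuousOn_pd_y {f : ℝ → ℝ → ℝ} {m : ℕ} {a b : ℕ}
    (hf : ContDiffOn ℝ (m : WithTop ℕ∞) (Function.uncurry f) strip) (hm : a + b ≤ m) (x : ℝ) :
    ContinuousOn (fun y => pd a b f x y) (Set.Icc 0 1) := by
  have h1 := (contDiffOn_pd_of_le 0 a b hf (by omega)).continuousOn
  exact h1.comp (f := fun y => (x, y)) (by fun_prop) fun y hy => mem_strip hy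

theorem pd_periodic {f : ℝ → ℝ → ℝ} (hp : ∀ x, ∀ y ∈ Set.Icc (0 : ℝ) 1, f (x + 1) y = f x y)
    (a b : ℕ) {y : ℝ} (hy : y ∈ Set.Icc (0 : ℝ) 1) : Function.Periodic (fun x => pd a b f x y) 1 := by
  intro x
  unfold pd
  set F : ℝ → ℝ := fun x' => iteratedDerivWithin b (fun y' => f x' y') (Set.Icc 0 1) y with hF
  have hFp : (fun z => F (z + 1)) = F := by
    funext z
    exact iteratedDerivWithin_congr (fun y' hy' => hp z y' hy') hy
  have h1 := iteratedDeriv_comp_add_const a F 1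
  rw [hFp] at h1
  exact (congrFun h1 x).symm

/-! ### Spatial consistency for a smooth function -/

theorem iteratedDerivWithin_chain {S : Set ℝ} (hS : UniqueDiffOn ℝ S) {g : ℕ → ℝ → ℝ} {n : ℕ}
    (hg : ∀ k < n, ∀ y ∈ S, HasDerivWithinAt (g k) (g (k + 1) y) S y) {k : ℕ} (hk : k ≤ n) :
    ∀ y ∈ S, iteratedDerivWithin k (g 0) S y = g k y := by
  induction k with
  | zero => intro y _; simp
  | succ k ih =>
    intro y hy
    rw [iteratedDerivWithin_succ, derivWithin_congr (ih (by omega)) (ih (by omega) y hy)]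
    exact (hg k (by omega) y hy).derivWithin (hS y hy)

theorem deriv_floryHuggins {θ₀ s : ℝ} (h1 : 0 < 1 + s) (h2 : 0 < 1 - s) :
    deriv (floryHuggins θ₀) s = logPart s - θ₀ * s := by
  have a1 : HasDerivAt (fun s : ℝ => 1 + s) 1 s := (hasDerivAt_id s).const_add 1
  have a2 : HasDerivAt (fun s : ℝ => 1 - s) (-1) s := (hasDerivAt_id s).const_sub 1
  have h := ((a1.mul (a1.log h1.ne')).add (a2.mul (a2.log h2.ne'))).sub
    (((hasDerivAt_id s).fun_pow 2).const_mul (θ₀ / 2))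
  have h' : HasDerivAt (floryHuggins θ₀) (logPart s - θ₀ * s) s := by
    refine HasDerivAt.congr_deriv h ?_
    have := h1.ne'
    have := h2.ne'
    simp only [logPart, id]
    field_simp
    push_cast
    ring
  exact h'.deriv

/-- Six times differentiable functions on the strip with bounded derivatives, periodic in `x` and
separated from `±1`. -/
structure SmoothProfile (ε₀ B : ℝ) (f : ℝ → ℝ → ℝ) : Prop where
  contDiff : ContDiffOn ℝ ((6 : ℕ) : WithTop ℕ∞) (Function.uncurry f) strip
  bound : ∀ a b : ℕ, a + b ≤ 6 → ∀ x : ℝ, ∀ y ∈ Set.Icc (0 : ℝ) 1, |pd a b f x y| ≤ B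
  periodic : ∀ x, ∀ y ∈ Set.Icc (0 : ℝ) 1, f (x + 1) y = f x y
  sep : ∀ x : ℝ, ∀ y ∈ Set.Icc (0 : ℝ) 1, ε₀ ≤ 1 + f x y ∧ ε₀ ≤ 1 - f x y

/-- The `x`-derivatives of the bulk chemical potential. -/
noncomputable def potChainX (ε θ₀ : ℝ) (f : ℝ → ℝ → ℝ) (y : ℝ) (k : ℕ) (x : ℝ) : ℝ :=
  logChain (fun k x => pd k 0 f x y) k x - θ₀ * pd k 0 f x y
    - ε ^ 2 * (pd (k + 2) 0 f x y + pd k 2 f x y)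

/-- The `y`-derivatives of the bulk chemical potential. -/
noncomputable def potChainY (ε θ₀ : ℝ) (f : ℝ → ℝ → ℝ) (x : ℝ) (k : ℕ) (y : ℝ) : ℝ :=
  logChain (fun k y => pd 0 k f x y) k y - θ₀ * pd 0 k f x y
    - ε ^ 2 * (pd 2 k f x y + pd 0 (k + 2) f x y)

/-- The derivatives of the surface chemical potential; `σ` is the sign of the normal. -/
noncomputable def surfChain (ε κ θ₀ σ : ℝ) (f : ℝ → ℝ → ℝ) (y : ℝ) (k : ℕ) (x : ℝ) : ℝ :=
  logChain (fun k x => pd k 0 f x y) k x - θ₀ * pd k 0 f x y - κ * ε * pd (k + 2) 0 f x y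
    + ε ^ 2 * (σ * pd k 1 f x y)

/-- A common constant for the spatial consistency estimates. -/
noncomputable def spaceConst (ε κ θ₀ ε₀ B : ℝ) : ℝ :=
  logBound ε₀ B + (|θ₀| + 2 * ε ^ 2 + κ * ε + 1) * B

section

variable {ε κ θ₀ ε₀ B : ℝ} {f : ℝ → ℝ → ℝ}

theorem SmoothProfile.bound_nonneg (hf : SmoothProfile ε₀ B f) : 0 ≤ B :=
  (abs_nonneg _).trans (hf.bound 0 0 (by omega) 0 0 ⟨le_rfl, zero_le_one⟩)

theorem SmoothProfile.hasDerivX (hf : SmoothProfile ε₀ B f) {a b : ℕ} (h : a + b + 1 ≤ 6) (x : ℝ)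
    {y : ℝ} (hy : y ∈ Set.Icc (0 : ℝ) 1) :
    HasDerivWithinAt (fun x' => pd a b f x' y) (pd (a + 1) b f x y) Set.univ x :=
  (hasDerivAt_pd hf.contDiff h x hy).hasDerivWithinAt

theorem SmoothProfile.hasDerivY (hf : SmoothProfile ε₀ B f) {a b : ℕ} (h : a + b + 1 ≤ 6) (x : ℝ)
    {y : ℝ} (hy : y ∈ Set.Icc (0 : ℝ) 1) :
    HasDerivWithinAt (fun y' => pd a b f x y') (pd a (b + 1) f x y) (Set.Icc 0 1) y :=
  hasDerivWithinAt_pd hf.contDiff h x hy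

theorem SmoothProfile.sep_pos (hf : SmoothProfile ε₀ B f) (hε₀ : 0 < ε₀) (x : ℝ) {y : ℝ}
    (hy : y ∈ Set.Icc (0 : ℝ) 1) : 0 < 1 + pd 0 0 f x y ∧ 0 < 1 - pd 0 0 f x y := by
  rw [pd_zero_zero]
  have := hf.sep x y hy
  constructor <;> linarith [this.1, this.2]

theorem SmoothProfile.logChainX (hf : SmoothProfile ε₀ B f) (hε₀ : 0 < ε₀) {y : ℝ}
    (hy : y ∈ Set.Icc (0 : ℝ) 1) : ∀ k < 4, ∀ x ∈ Set.univ,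
    HasDerivWithinAt (logChain (fun k x => pd k 0 f x y) k)
      (logChain (fun k x => pd k 0 f x y) (k + 1) x) Set.univ x :=
  logChain_hasDeriv (fun k hk x _ => hf.hasDerivX (by omega) x hy)
    fun x _ => hf.sep_pos hε₀ x hy

theorem SmoothProfile.potChainX (hf : SmoothProfile ε₀ B f) (hε₀ : 0 < ε₀) {y : ℝ}
    (hy : y ∈ Set.Icc (0 : ℝ) 1) : ∀ k < 4, ∀ x ∈ Set.univ,
    HasDerivWithinAt (potChainX ε θ₀ f y k) (potChainX ε θ₀ f y (k + 1) x) Set.univ x := by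
  intro k hk x hx
  refine ((hf.logChainX hε₀ hy k hk x hx).sub ((hf.hasDerivX (by omega) x hy).const_mul θ₀)).sub
    (HasDerivWithinAt.const_mul (ε ^ 2) (HasDerivWithinAt.add ?_ (hf.hasDerivX (by omega) x hy)))
  rw [show k + 1 + 2 = (k + 2) + 1 by ring]
  exact hf.hasDerivX (by omega) x hy

theorem SmoothProfile.potChainY (hf : SmoothProfile ε₀ B f) (hε₀ : 0 < ε₀) (x : ℝ) :
    ∀ k < 4, ∀ y ∈ Set.Icc (0 : ℝ) 1,
    HasDerivWithinAt (potChainY ε θ₀ f x k) (potChainY ε θ₀ f x (k + 1) y) (Set.Icc 0 1) y := by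
  intro k hk y hy
  have hl := logChain_hasDeriv (S := Set.Icc 0 1) (g := fun k y => pd 0 k f x y)
    (fun k hk y hy => hf.hasDerivY (by omega) x hy) (fun y hy => hf.sep_pos hε₀ x hy) k hk y hy
  refine (hl.sub ((hf.hasDerivY (by omega) x hy).const_mul θ₀)).sub
    (HasDerivWithinAt.const_mul (ε ^ 2) (HasDerivWithinAt.add (hf.hasDerivY (by omega) x hy) ?_))
  rw [show k + 1 + 2 = (k + 2) + 1 by ring]
  exact hf.hasDerivY (by omega) x hy

theorem SmoothProfile.surfChain (hf : SmoothProfile ε₀ B f) (hε₀ : 0 < ε₀) (σ : ℝ) {y : ℝ}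
    (hy : y ∈ Set.Icc (0 : ℝ) 1) : ∀ k < 4, ∀ x ∈ Set.univ,
    HasDerivWithinAt (surfChain ε κ θ₀ σ f y k) (surfChain ε κ θ₀ σ f y (k + 1) x) Set.univ x := by
  intro k hk x hx
  refine (((hf.logChainX hε₀ hy k hk x hx).sub ((hf.hasDerivX (by omega) x hy).const_mul θ₀)).sub
    (HasDerivWithinAt.const_mul (κ * ε) ?_)).add
    (HasDerivWithinAt.const_mul (ε ^ 2) ((hf.hasDerivX (by omega) x hy).const_mul σ))
  rw [show k + 1 + 2 = (k + 2) + 1 by ring]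
  exact hf.hasDerivX (by omega) x hy

/-- Four derivatives of the potential involve six derivatives of `f`; this is where `C⁶` regularity
is spent. -/
theorem SmoothProfile.abs_potChainX_le (hf : SmoothProfile ε₀ B f) (hε₀ : 0 < ε₀) (hε : 0 < ε)
    (hκ : 0 < κ) {k : ℕ} (h3 : 3 ≤ k) (h4 : k ≤ 4) (x : ℝ) {y : ℝ} (hy : y ∈ Set.Icc (0 : ℝ) 1) :
    |_root_.potChainX ε θ₀ f y k x| ≤ spaceConst ε κ θ₀ ε₀ B := by
  have l := abs_le.1 (abs_logChain_le (g := fun k x => pd k 0 f x y) (y := x) hε₀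
    (by rw [pd_zero_zero]; exact hf.sep x y hy) (fun k hk => hf.bound k 0 (by omega) x y hy) h3 h4)
  have a1 := abs_le.1 (abs_mul_le_mul (le_refl |θ₀|) (hf.bound k 0 (by omega) x y hy))
  have a2 := abs_le.1 (abs_mul_le_mul (le_refl |ε ^ 2|) (hf.bound (k + 2) 0 (by omega) x y hy))
  have a3 := abs_le.1 (abs_mul_le_mul (le_refl |ε ^ 2|) (hf.bound k 2 (by omega) x y hy))
  rw [abs_of_pos (show 0 < ε ^ 2 by positivity)] at a2 a3
  have hB := hf.bound_nonneg
  have : 0 ≤ κ * ε * B := by positivity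
  unfold _root_.potChainX spaceConst
  rw [abs_le]
  constructor <;> linarith [l.1, l.2, a1.1, a1.2, a2.1, a2.2, a3.1, a3.2]

/-- Order four serves the centred quotient at interior rows, order three the one-sided quotient at
boundary rows. -/
theorem SmoothProfile.abs_potChainY_le (hf : SmoothProfile ε₀ B f) (hε₀ : 0 < ε₀) (hε : 0 < ε)
    (hκ : 0 < κ) {k : ℕ} (h3 : 3 ≤ k) (h4 : k ≤ 4) (x : ℝ) {y : ℝ} (hy : y ∈ Set.Icc (0 : ℝ) 1) :
    |_root_.potChainY ε θ₀ f x k y| ≤ spaceConst ε κ θ₀ ε₀ B := by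
  have l := abs_le.1 (abs_logChain_le (g := fun k y => pd 0 k f x y) (y := y) hε₀
    (by rw [pd_zero_zero]; exact hf.sep x y hy) (fun k hk => hf.bound 0 k (by omega) x y hy) h3 h4)
  have a1 := abs_le.1 (abs_mul_le_mul (le_refl |θ₀|) (hf.bound 0 k (by omega) x y hy))
  have a2 := abs_le.1 (abs_mul_le_mul (le_refl |ε ^ 2|) (hf.bound 2 k (by omega) x y hy))
  have a3 := abs_le.1 (abs_mul_le_mul (le_refl |ε ^ 2|) (hf.bound 0 (k + 2) (by omega) x y hy))
  rw [abs_of_pos (show 0 < ε ^ 2 by positivity)] at a2 a3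
  have hB := hf.bound_nonneg
  have : 0 ≤ κ * ε * B := by positivity
  unfold _root_.potChainY spaceConst
  rw [abs_le]
  constructor <;> linarith [l.1, l.2, a1.1, a1.2, a2.1, a2.2, a3.1, a3.2]

theorem SmoothProfile.abs_surfChain_le (hf : SmoothProfile ε₀ B f) (hε₀ : 0 < ε₀) (hε : 0 < ε)
    (hκ : 0 < κ) {σ : ℝ} (hσ : |σ| = 1) (x : ℝ) {y : ℝ} (hy : y ∈ Set.Icc (0 : ℝ) 1) :
    |_root_.surfChain ε κ θ₀ σ f y 4 x| ≤ spaceConst ε κ θ₀ ε₀ B := by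
  have l := abs_le.1 (abs_logChain_le (g := fun k x => pd k 0 f x y) (y := x) (k := 4) hε₀
    (by rw [pd_zero_zero]; exact hf.sep x y hy) (fun k hk => hf.bound k 0 (by omega) x y hy)
    (by omega) le_rfl)
  have a1 := abs_le.1 (abs_mul_le_mul (le_refl |θ₀|) (hf.bound 4 0 (by omega) x y hy))
  have a2 := abs_le.1 (abs_mul_le_mul (le_refl |κ * ε|) (hf.bound 6 0 (by omega) x y hy))
  have a3 := abs_le.1 (abs_mul_le_mul (le_refl |ε ^ 2|) (abs_mul_le_mul hσ.le
    (hf.bound 4 1 (by omega) x y hy)))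
  rw [abs_of_pos (show 0 < κ * ε by positivity)] at a2
  rw [abs_of_pos (show 0 < ε ^ 2 by positivity)] at a3
  have hB := hf.bound_nonneg
  have : 0 ≤ ε ^ 2 * B := by positivity
  unfold _root_.surfChain spaceConst
  rw [abs_le]
  constructor <;> linarith [l.1, l.2, a1.1, a1.2, a2.1, a2.2, a3.1, a3.2]

theorem SmoothProfile.bound_le_spaceConst (hf : SmoothProfile ε₀ B f) (hε₀ : 0 < ε₀) (hε : 0 < ε)
    (hκ : 0 < κ) : B ≤ spaceConst ε κ θ₀ ε₀ B ∧ logBound ε₀ B ≤ spaceConst ε κ θ₀ ε₀ B := by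
  have hB := hf.bound_nonneg
  have h1 := logBound_nonneg hε₀ hB
  have h2 : 0 ≤ (|θ₀| + 2 * ε ^ 2 + κ * ε) * B := by positivity
  unfold spaceConst
  constructor <;> linarith

theorem bulkPot_eq {x y : ℝ} (h1 : 0 < 1 + f x y) (h2 : 0 < 1 - f x y) :
    bulkPot ε θ₀ f x y = logPart (f x y) - θ₀ * f x y - ε ^ 2 * lap f x y := by
  rw [bulkPot, deriv_floryHuggins h1 h2]

theorem pd_two_zero (f : ℝ → ℝ → ℝ) (x y : ℝ) :
    pd 2 0 f x y = iteratedDeriv 2 (fun x' => f x' y) x := by simp [pd]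

theorem botPot_eq {x : ℝ} (h1 : 0 < 1 + f x 0) (h2 : 0 < 1 - f x 0) :
    botPot ε κ θ₀ f x = logPart (f x 0) - θ₀ * f x 0 - κ * ε * pd 2 0 f x 0
      - ε ^ 2 * pd 0 1 f x 0 := by
  rw [botPot, deriv_floryHuggins h1 h2, pd_two_zero]; ring

theorem topPot_eq {x : ℝ} (h1 : 0 < 1 + f x 1) (h2 : 0 < 1 - f x 1) :
    topPot ε κ θ₀ f x = logPart (f x 1) - θ₀ * f x 1 - κ * ε * pd 2 0 f x 1
      + ε ^ 2 * pd 0 1 f x 1 := by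
  rw [topPot, deriv_floryHuggins h1 h2, pd_two_zero]

theorem SmoothProfile.bulkPot_eq_chainX (hf : SmoothProfile ε₀ B f) (hε₀ : 0 < ε₀) (x : ℝ) {y : ℝ}
    (hy : y ∈ Set.Icc (0 : ℝ) 1) : bulkPot ε θ₀ f x y = _root_.potChainX ε θ₀ f y 0 x := by
  have := hf.sep_pos hε₀ x hy
  rw [pd_zero_zero] at this
  rw [bulkPot_eq this.1 this.2, _root_.potChainX]
  simp only [logChain, pd_zero_zero, lap, zero_add]

theorem SmoothProfile.bulkPot_eq_chainY (hf : SmoothProfile ε₀ B f) (hε₀ : 0 < ε₀) (x : ℝ) {y : ℝ}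
    (hy : y ∈ Set.Icc (0 : ℝ) 1) : bulkPot ε θ₀ f x y = _root_.potChainY ε θ₀ f x 0 y := by
  have := hf.sep_pos hε₀ x hy
  rw [pd_zero_zero] at this
  rw [bulkPot_eq this.1 this.2, _root_.potChainY]
  simp only [logChain, pd_zero_zero, lap, zero_add]

theorem SmoothProfile.lap_bulkPot (hf : SmoothProfile ε₀ B f) (hε₀ : 0 < ε₀) (x : ℝ) {y : ℝ}
    (hy : y ∈ Set.Icc (0 : ℝ) 1) : lap (bulkPot ε θ₀ f) x y =
      _root_.potChainX ε θ₀ f y 2 x + _root_.potChainY ε θ₀ f x 2 y := by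
  unfold lap
  congr 1
  · rw [pd_two_zero, funext fun x' => hf.bulkPot_eq_chainX hε₀ x' hy, ← iteratedDerivWithin_univ]
    exact iteratedDerivWithin_chain uniqueDiffOn_univ (hf.potChainX hε₀ hy) (by omega) x trivial
  · have : pd 0 2 (bulkPot ε θ₀ f) x y =
        iteratedDerivWithin 2 (fun y' => bulkPot ε θ₀ f x y') (Set.Icc 0 1) y := by simp [pd]
    rw [this, iteratedDerivWithin_congr (fun y' hy' => hf.bulkPot_eq_chainY hε₀ x hy') hy]
    exact iteratedDerivWithin_chain (uniqueDiffOn_Icc zero_lt_one) (hf.potChainY hε₀ x) (by omega)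
      y hy

theorem SmoothProfile.pd_zero_one_bulkPot (hf : SmoothProfile ε₀ B f) (hε₀ : 0 < ε₀) (x : ℝ)
    {y : ℝ} (hy : y ∈ Set.Icc (0 : ℝ) 1) :
    pd 0 1 (bulkPot ε θ₀ f) x y = _root_.potChainY ε θ₀ f x 1 y := by
  have : pd 0 1 (bulkPot ε θ₀ f) x y =
      iteratedDerivWithin 1 (fun y' => bulkPot ε θ₀ f x y') (Set.Icc 0 1) y := by simp [pd]
  rw [this, iteratedDerivWithin_congr (fun y' hy' => hf.bulkPot_eq_chainY hε₀ x hy') hy]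
  exact iteratedDerivWithin_chain (uniqueDiffOn_Icc zero_lt_one) (hf.potChainY hε₀ x) (by omega)
    y hy

theorem SmoothProfile.botPot_eq_chain (hf : SmoothProfile ε₀ B f) (hε₀ : 0 < ε₀) :
    botPot ε κ θ₀ f = _root_.surfChain ε κ θ₀ (-1) f 0 0 := by
  funext x
  have := hf.sep_pos hε₀ x (y := 0) ⟨le_rfl, zero_le_one⟩
  rw [pd_zero_zero] at this
  rw [botPot_eq this.1 this.2, _root_.surfChain]
  simp only [logChain, pd_zero_zero, zero_add]; ring

theorem SmoothProfile.topPot_eq_chain (hf : SmoothProfile ε₀ B f) (hε₀ : 0 < ε₀) :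
    topPot ε κ θ₀ f = _root_.surfChain ε κ θ₀ 1 f 1 0 := by
  funext x
  have := hf.sep_pos hε₀ x (y := 1) ⟨zero_le_one, le_rfl⟩
  rw [pd_zero_zero] at this
  rw [topPot_eq this.1 this.2, _root_.surfChain]
  simp only [logChain, pd_zero_zero, zero_add]; ring

theorem SmoothProfile.iteratedDeriv_surfChain (hf : SmoothProfile ε₀ B f) (hε₀ : 0 < ε₀) (σ : ℝ)
    {y : ℝ} (hy : y ∈ Set.Icc (0 : ℝ) 1) (x : ℝ) :
    iteratedDeriv 2 (_root_.surfChain ε κ θ₀ σ f y 0) x = _root_.surfChain ε κ θ₀ σ f y 2 x := by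
  rw [← iteratedDerivWithin_univ]
  exact iteratedDerivWithin_chain uniqueDiffOn_univ (hf.surfChain hε₀ σ hy) (by omega) x trivial

/-- Five-point Laplacian of a function of two real variables. -/
noncomputable def lapFD (h : ℝ) (f : ℝ → ℝ → ℝ) (x y : ℝ) : ℝ :=
  diff2 h (fun x' => f x' y) x + diff2 h (fun y' => f x y') y

/-- The discrete Laplacian at the boundary point `y`, with neighbour in direction `s`. -/
noncomputable def lapBd (h s y : ℝ) (f : ℝ → ℝ → ℝ) (x : ℝ) : ℝ :=
  diff2 h (fun x' => f x' y) x + 2 / h ^ 2 * (f x (y + s * h) - f x y)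

theorem SmoothProfile.lapFD_bulkPot (hf : SmoothProfile ε₀ B f) (hε₀ : 0 < ε₀) (hε : 0 < ε)
    (hκ : 0 < κ) {h : ℝ} (hh : 0 < h) (x : ℝ) {y : ℝ} (hm : 0 ≤ y - h) (hp : y + h ≤ 1) :
    |lapFD h (bulkPot ε θ₀ f) x y - lap (bulkPot ε θ₀ f) x y| ≤
      4 * spaceConst ε κ θ₀ ε₀ B * h ^ 2 := by
  have hy : y ∈ Set.Icc (0 : ℝ) 1 := ⟨by linarith, by linarith⟩
  have hyp : y + h ∈ Set.Icc (0 : ℝ) 1 := ⟨by linarith, by linarith⟩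
  have hym : y - h ∈ Set.Icc (0 : ℝ) 1 := ⟨by linarith, by linarith⟩
  have h1 := abs_le.1 (diff2_sub_le convex_univ hh (hf.potChainX (ε := ε) (θ₀ := θ₀) hε₀ hy)
    (fun x _ => hf.abs_potChainX_le (κ := κ) hε₀ hε hκ (by omega) le_rfl x hy)
    (Set.mem_univ x) trivial trivial)
  have h2 := abs_le.1 (diff2_sub_le (convex_Icc 0 1) hh (hf.potChainY (ε := ε) (θ₀ := θ₀) hε₀ x)
    (fun y hy => hf.abs_potChainY_le (κ := κ) hε₀ hε hκ (by omega) le_rfl x hy) hy hyp hym)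
  have e : diff2 h (fun y' => bulkPot ε θ₀ f x y') y = diff2 h (_root_.potChainY ε θ₀ f x 0) y := by
    simp only [diff2]
    rw [hf.bulkPot_eq_chainY hε₀ x hy, hf.bulkPot_eq_chainY hε₀ x hyp,
      hf.bulkPot_eq_chainY hε₀ x hym]
  rw [lapFD, funext fun x' => hf.bulkPot_eq_chainX hε₀ x' hy, e, hf.lap_bulkPot hε₀ x hy, abs_le]
  constructor <;> linarith [h1.1, h1.2, h2.1, h2.2]

/-- The no-flux condition removes the singular term of order `1/h`. The remaining accuracy of order
`h` is what the duality bound `abs_ip_le_of_rows` tolerates on boundary rows. -/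
theorem SmoothProfile.lapBd_bulkPot (hf : SmoothProfile ε₀ B f) (hε₀ : 0 < ε₀) (hε : 0 < ε)
    (hκ : 0 < κ) {h s : ℝ} (hh : 0 < h) (hh1 : h ≤ 1) (hs : |s| = 1) (x : ℝ) {y : ℝ}
    (hy : y ∈ Set.Icc (0 : ℝ) 1) (hyp : y + s * h ∈ Set.Icc (0 : ℝ) 1)
    (hflux : pd 0 1 (bulkPot ε θ₀ f) x y = 0) :
    |lapBd h s y (bulkPot ε θ₀ f) x - lap (bulkPot ε θ₀ f) x y| ≤
      4 * spaceConst ε κ θ₀ ε₀ B * h := by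
  rw [hf.pd_zero_one_bulkPot hε₀ x hy] at hflux
  have h1 := abs_le.1 (diff2_sub_le convex_univ hh (hf.potChainX (ε := ε) (θ₀ := θ₀) hε₀ hy)
    (fun x _ => hf.abs_potChainX_le (κ := κ) hε₀ hε hκ (by omega) le_rfl x hy)
    (Set.mem_univ x) trivial trivial)
  have h2 := onesided_sub_le (convex_Icc 0 1) hh hs
    (fun k hk y hy => hf.potChainY (ε := ε) (θ₀ := θ₀) hε₀ x k (by omega) y hy)
    (fun y hy => hf.abs_potChainY_le (κ := κ) hε₀ hε hκ le_rfl (by omega) x hy) hy hyp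
  rw [hflux, mul_zero, sub_zero] at h2
  have h2 := abs_le.1 h2
  have hC : 0 ≤ spaceConst ε κ θ₀ ε₀ B :=
    hf.bound_nonneg.trans (hf.bound_le_spaceConst hε₀ hε hκ).1
  have h3 : 2 * spaceConst ε κ θ₀ ε₀ B * h ^ 2 ≤ 2 * spaceConst ε κ θ₀ ε₀ B * h := by
    nlinarith [mul_nonneg hC (mul_nonneg hh.le (sub_nonneg.2 hh1))]
  rw [lapBd, funext fun x' => hf.bulkPot_eq_chainX hε₀ x' hy, hf.lap_bulkPot hε₀ x hy,
    hf.bulkPot_eq_chainY hε₀ x hy, hf.bulkPot_eq_chainY hε₀ x hyp, abs_le]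
  constructor <;> linarith [h1.1, h1.2, h2.1, h2.2]

theorem SmoothProfile.diff2_surfChain (hf : SmoothProfile ε₀ B f) (hε₀ : 0 < ε₀) (hε : 0 < ε)
    (hκ : 0 < κ) {h σ : ℝ} (hh : 0 < h) (hσ : |σ| = 1) (x : ℝ) {y : ℝ}
    (hy : y ∈ Set.Icc (0 : ℝ) 1) :
    |diff2 h (_root_.surfChain ε κ θ₀ σ f y 0) x - _root_.surfChain ε κ θ₀ σ f y 2 x| ≤
      4 * spaceConst ε κ θ₀ ε₀ B * h ^ 2 := by
  have h1 := diff2_sub_le convex_univ hh (hf.surfChain (ε := ε) (κ := κ) (θ₀ := θ₀) hε₀ σ hy)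
    (fun x _ => hf.abs_surfChain_le hε₀ hε hκ hσ x hy) (Set.mem_univ x) trivial trivial
  have hC : 0 ≤ spaceConst ε κ θ₀ ε₀ B :=
    hf.bound_nonneg.trans (hf.bound_le_spaceConst hε₀ hε hκ).1
  have : 0 ≤ spaceConst ε κ θ₀ ε₀ B * h ^ 2 := by positivity
  linarith

theorem SmoothProfile.diff2_x (hf : SmoothProfile ε₀ B f) {h : ℝ} (hh : 0 < h) (x : ℝ) {y : ℝ}
    (hy : y ∈ Set.Icc (0 : ℝ) 1) :
    |diff2 h (fun x' => f x' y) x - pd 2 0 f x y| ≤ 2 * B * h ^ 2 := by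
  have h1 := diff2_sub_le (g := fun k x' => pd k 0 f x' y) convex_univ hh
    (fun k hk x _ => hf.hasDerivX (by omega) x hy)
    (fun x _ => hf.bound 4 0 (by omega) x y hy) (Set.mem_univ x) trivial trivial
  simp only [pd_zero_zero] at h1
  exact h1

theorem SmoothProfile.lapFD_self (hf : SmoothProfile ε₀ B f) {h : ℝ} (hh : 0 < h) (x : ℝ) {y : ℝ}
    (hm : 0 ≤ y - h) (hp : y + h ≤ 1) : |lapFD h f x y - lap f x y| ≤ 4 * B * h ^ 2 := by
  have hy : y ∈ Set.Icc (0 : ℝ) 1 := ⟨by linarith, by linarith⟩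
  have h1 := abs_le.1 (hf.diff2_x hh x hy)
  have h2 := diff2_sub_le (g := fun k y' => pd 0 k f x y') (convex_Icc 0 1) hh
    (fun k hk y hy => hf.hasDerivY (by omega) x hy)
    (fun y hy => hf.bound 0 4 (by omega) x y hy) hy ⟨by linarith, by linarith⟩
    ⟨by linarith, by linarith⟩
  simp only [pd_zero_zero] at h2
  have h2 := abs_le.1 h2
  rw [lapFD, lap, abs_le]
  constructor <;> linarith [h1.1, h1.2, h2.1, h2.2]

/-- The normal derivative of the phase variable need not vanish, so the term of order `1/h` stays;
it is later matched by the ghost flux. -/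
theorem SmoothProfile.lapBd_self (hf : SmoothProfile ε₀ B f) {h s : ℝ} (hh : 0 < h) (hh1 : h ≤ 1)
    (hs : |s| = 1) (x : ℝ) {y : ℝ} (hy : y ∈ Set.Icc (0 : ℝ) 1)
    (hyp : y + s * h ∈ Set.Icc (0 : ℝ) 1) :
    |lapBd h s y f x - lap f x y - 2 / h * s * pd 0 1 f x y| ≤ 4 * B * h := by
  have h1 := abs_le.1 (hf.diff2_x hh x hy)
  have h2 := onesided_sub_le (g := fun k y' => pd 0 k f x y') (convex_Icc 0 1) hh hs
    (fun k hk y hy => hf.hasDerivY (by omega) x hy)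
    (fun y hy => hf.bound 0 3 (by omega) x y hy) hy hyp
  simp only [pd_zero_zero] at h2
  have h2 := abs_le.1 h2
  have hB := hf.bound_nonneg
  have h3 : 2 * B * h ^ 2 ≤ 2 * B * h := by
    nlinarith [mul_nonneg hB (mul_nonneg hh.le (sub_nonneg.2 hh1))]
  rw [lapBd, lap, abs_le]
  constructor <;> linarith [h1.1, h1.2, h2.1, h2.2]

theorem SmoothProfile.partialSum_self (hf : SmoothProfile ε₀ B f) {K : ℕ} (hK : 1 ≤ K) (x : ℝ)
    {y : ℝ} (hy : y ∈ Set.Icc (0 : ℝ) 1) :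
    |partialSum K (fun x' => f x' y) x - f x y| ≤ fourierConst * B * mesh K ^ 2 := by
  have := partialSum_sub_le (g := fun k x' => pd k 0 f x' y) hK
    (pd_periodic hf.periodic 0 0 hy) (fun m hm x => hasDerivAt_pd hf.contDiff (by omega) x hy)
    (continuous_pd_x hf.contDiff (by omega) hy) (fun x => hf.bound 4 0 (by omega) x y hy) x
  simpa only [pd_zero_zero] using this

/-- The projection does not commute with the logarithm, so the composition, which is as smooth as
`f` by the separation from `±1`, is approximated on its own. -/
theorem SmoothProfile.partialSum_logPart (hf : SmoothProfile ε₀ B f) (hε₀ : 0 < ε₀) {K : ℕ}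
    (hK : 1 ≤ K) (x : ℝ) {y : ℝ} (hy : y ∈ Set.Icc (0 : ℝ) 1) :
    |partialSum K (fun x' => logPart (f x' y)) x - logPart (f x y)| ≤
      fourierConst * logBound ε₀ B * mesh K ^ 2 := by
  have hc : ∀ k ≤ 4, Continuous fun x => pd k 0 f x y := fun k hk =>
    continuous_pd_x hf.contDiff (by omega) hy
  have hsep := fun x => hf.sep_pos hε₀ x hy
  have hcont : Continuous (logChain (fun k x' => pd k 0 f x' y) 4) := by
    have c0 := hc 0 (by omega)
    have c1 := hc 1 (by omega)
    have c2 := hc 2 (by omega)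
    have c3 := hc 3 (by omega)
    have c4 := hc 4 (by omega)
    have cP : Continuous fun x => (1 + pd 0 0 f x y)⁻¹ :=
      (continuous_const.add c0).inv₀ fun x => (hsep x).1.ne'
    have cQ : Continuous fun x => (1 - pd 0 0 f x y)⁻¹ :=
      (continuous_const.sub c0).inv₀ fun x => (hsep x).2.ne'
    exact (((((continuous_const.mul ((cQ.pow 4).sub (cP.pow 4))).mul (c1.pow 4)).add
      ((continuous_const.mul ((cP.pow 3).add (cQ.pow 3))).mul ((c1.pow 2).mul c2))).add
      ((continuous_const.mul ((cQ.pow 2).sub (cP.pow 2))).mul (c2.pow 2))).add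
      ((continuous_const.mul ((cQ.pow 2).sub (cP.pow 2))).mul (c1.mul c3))).add
      ((cP.add cQ).mul c4)
  have := partialSum_sub_le (g := logChain fun k x' => pd k 0 f x' y) hK
    (fun x => by
      have := pd_periodic hf.periodic 0 0 hy x
      simp only [logChain] at this ⊢
      rw [this])
    (fun m hm x => by
      have := hf.logChainX hε₀ hy m hm x trivial
      rwa [hasDerivWithinAt_univ] at this) hcont
    (fun x => abs_logChain_le hε₀ (by rw [pd_zero_zero]; exact hf.sep x y hy)
      (fun k hk => hf.bound k 0 (by omega) x y hy) (by omega) le_rfl) x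
  have e : logChain (fun k x' => pd k 0 f x' y) 0 = fun x' => logPart (f x' y) := by
    funext x'; simp only [logChain, pd_zero_zero]
  rwa [e] at this

/-- The integrand is the `x`-derivative of a periodic function. This is conservation of mass on a
boundary section. -/
theorem SmoothProfile.integral_surfChain (hf : SmoothProfile ε₀ B f) (hε₀ : 0 < ε₀) (σ : ℝ)
    {y : ℝ} (hy : y ∈ Set.Icc (0 : ℝ) 1) :
    ∫ x in (0 : ℝ)..1, _root_.surfChain ε κ θ₀ σ f y 2 x = 0 := by
  have hd := hf.surfChain (ε := ε) (κ := κ) (θ₀ := θ₀) hε₀ σ hy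
  have h1 : ∀ x, HasDerivAt (_root_.surfChain ε κ θ₀ σ f y 1) (_root_.surfChain ε κ θ₀ σ f y 2 x) x :=
    fun x => by simpa only [hasDerivWithinAt_univ] using hd 1 (by omega) x trivial
  have hc : Continuous (_root_.surfChain ε κ θ₀ σ f y 2) :=
    continuous_iff_continuousAt.2 fun x => by
      have := hd 2 (by omega) x trivial
      rw [hasDerivWithinAt_univ] at this
      exact this.continuousAt
  rw [intervalIntegral.integral_eq_sub_of_hasDerivAt (fun x _ => h1 x) (hc.intervalIntegrable _ _)]
  have hp : ∀ a b, pd a b f 1 y = pd a b f 0 y := fun a b => by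
    simpa using pd_periodic hf.periodic a b hy 0
  simp only [_root_.surfChain, logChain, hp, sub_self]

end

/-! ### Time regularity -/

section

variable {E : Type*} [NormedAddCommGroup E] [NormedSpace ℝ E]

theorem HasTimeDeriv.intervalIntegrable {T : ℝ} (hT : 0 < T) {u v : ℝ → E}
    (h : HasTimeDeriv T u v) : IntervalIntegrable v volume 0 T :=
  (intervalIntegrable_iff_integrableOn_Ioc_of_le hT.le).2 (h.1.integrable (by norm_num))

theorem HasTimeDeriv.intervalIntegrable_sub {T : ℝ} (hT : 0 < T) {u v : ℝ → E}
    (h : HasTimeDeriv T u v) {s t : ℝ} (hs : s ∈ Set.Icc 0 T) (ht : t ∈ Set.Icc 0 T) :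
    IntervalIntegrable v volume s t :=
  (h.intervalIntegrable hT).mono_set (by
    rw [Set.uIcc_of_le hT.le]; exact Set.uIcc_subset_Icc hs ht)

theorem HasTimeDeriv.sub_eq {T : ℝ} (hT : 0 < T) {u v : ℝ → E}
    (h : HasTimeDeriv T u v) {s t : ℝ} (hs : s ∈ Set.Icc 0 T) (ht : t ∈ Set.Icc 0 T) :
    u t - u s = ∫ r in s..t, v r := by
  have h0 : (0 : ℝ) ∈ Set.Icc 0 T := ⟨le_rfl, hT.le⟩
  rw [h.2 t ht, h.2 s hs, add_sub_add_left_eq_sub, intervalIntegral.integral_interval_sub_left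
    (h.intervalIntegrable_sub hT h0 ht) (h.intervalIntegrable_sub hT h0 hs)]

theorem HasTimeDeriv.continuousOn {T : ℝ} (hT : 0 < T) {u v : ℝ → E} (h : HasTimeDeriv T u v) :
    ContinuousOn u (Set.Icc 0 T) := by
  have h1 : IntegrableOn v (Set.uIcc 0 T) := by
    rw [Set.uIcc_of_le hT.le, integrableOn_Icc_iff_integrableOn_Ioc]
    exact h.1.integrable (by norm_num)
  have h2 := intervalIntegral.continuousOn_primitive_interval h1
  rw [Set.uIcc_of_le hT.le] at h2
  exact (continuousOn_const.add h2).congr fun t ht => h.2 t ht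

theorem HasTimeDeriv.hasDerivAt [CompleteSpace E] {T : ℝ} (hT : 0 < T) {u v : ℝ → E}
    (h : HasTimeDeriv T u v)
    (hv : ContinuousOn v (Set.Icc 0 T)) {t : ℝ} (ht : t ∈ Set.Ioo 0 T) : HasDerivAt u (v t) t := by
  have ht' : t ∈ Set.Icc 0 T := Set.Ioo_subset_Icc_self ht
  have hnhds : Set.Icc 0 T ∈ nhds t := Icc_mem_nhds ht.1 ht.2
  have h1 : HasDerivAt (fun s => ∫ r in (0 : ℝ)..s, v r) (v t) t := by
    refine intervalIntegral.integral_hasDerivAt_right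
      (h.intervalIntegrable_sub hT ⟨le_rfl, hT.le⟩ ht') ?_ (hv.continuousAt hnhds)
    exact (hv.mono Set.Ioo_subset_Icc_self).stronglyMeasurableAtFilter isOpen_Ioo t ht
  refine (h1.const_add (u 0)).congr_of_eventuallyEq ?_
  filter_upwards [hnhds] with s hs using h.2 s hs

/-- Time consistency of the backward difference quotient. -/
theorem HasTimeDeriv.backward_difference_le [CompleteSpace E] {T : ℝ} (hT : 0 < T) {u v w : ℝ → E}
    (hu : HasTimeDeriv T u v) (hv : HasTimeDeriv T v w) {s t : ℝ} (hs : s ∈ Set.Icc 0 T)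
    (ht : t ∈ Set.Icc 0 T) (hst : s ≤ t) :
    ‖u t - u s - (t - s) • v t‖ ≤ (t - s) * ∫ r in s..t, ‖w r‖ := by
  have hvi := hu.intervalIntegrable_sub hT hs ht
  have hwi := hv.intervalIntegrable_sub hT hs ht
  -- Each difference `v r - v t` is at most the integral of `‖w‖` over `[r, t]`, hence over `[s,
  -- t]`.
  have h1 : u t - u s - (t - s) • v t = ∫ r in s..t, (v r - v t) := by
    rw [intervalIntegral.integral_sub hvi intervalIntegrable_const, ← hu.sub_eq hT hs ht,
      intervalIntegral.integral_const]
  rw [h1]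
  have := intervalIntegral.norm_integral_le_of_norm_le_const (a := s) (b := t)
    (f := fun r => v r - v t) (C := ∫ r in s..t, ‖w r‖) fun r hr => by
      rw [Set.uIoc_of_le hst] at hr
      have hr' : r ∈ Set.Icc 0 T := ⟨hs.1.trans hr.1.le, hr.2.trans ht.2⟩
      rw [norm_sub_rev, hv.sub_eq hT hr' ht]
      refine (intervalIntegral.norm_integral_le_integral_norm hr.2).trans ?_
      exact intervalIntegral.integral_mono_interval hr.1.le hr.2 le_rfl
        (ae_of_all _ fun _ => norm_nonneg _) hwi.norm
  rw [abs_of_nonneg (sub_nonneg.2 hst), mul_comm] at this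
  exact this

/-- Cauchy-Schwarz in time. -/
theorem HasTimeDeriv.sq_integral_norm_le {T : ℝ} (hT : 0 < T) {u v : ℝ → E}
    (h : HasTimeDeriv T u v) {s t : ℝ} (hs : s ∈ Set.Icc 0 T) (ht : t ∈ Set.Icc 0 T)
    (hst : s ≤ t) : (∫ r in s..t, ‖v r‖) ^ 2 ≤
      (t - s) * ((∫ r in (0 : ℝ)..t, ‖v r‖ ^ 2) - ∫ r in (0 : ℝ)..s, ‖v r‖ ^ 2) := by
  have h0 : (0 : ℝ) ∈ Set.Icc 0 T := ⟨le_rfl, hT.le⟩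
  have hsq : IntervalIntegrable (fun r => ‖v r‖ ^ 2) volume 0 T :=
    (intervalIntegrable_iff_integrableOn_Ioc_of_le hT.le).2 h.1.integrable_norm_pow'
  have hsub : ∀ a ∈ Set.Icc 0 T, ∀ b ∈ Set.Icc 0 T,
      IntervalIntegrable (fun r => ‖v r‖ ^ 2) volume a b := fun a ha b hb =>
    hsq.mono_set (by rw [Set.uIcc_of_le hT.le]; exact Set.uIcc_subset_Icc ha hb)
  rw [intervalIntegral.integral_interval_sub_left (hsub 0 h0 t ht) (hsub 0 h0 s hs)]
  rcases hst.eq_or_lt with rfl | hlt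
  · simp
  have hvi := (h.intervalIntegrable_sub hT hs ht).norm
  set I := ∫ r in s..t, ‖v r‖ with hI
  set a := I / (t - s) with ha
  have hpos : 0 < t - s := sub_pos.2 hlt
  -- Cauchy-Schwarz as nonnegativity of the variance about the average `a`.
  have h1 : 0 ≤ ∫ r in s..t, (‖v r‖ - a) ^ 2 :=
    intervalIntegral.integral_nonneg hst fun r _ => sq_nonneg _
  have h2 : ∫ r in s..t, (‖v r‖ - a) ^ 2 =
      (∫ r in s..t, ‖v r‖ ^ 2) - (2 * a) * I + (t - s) * a ^ 2 := by
    have e : ∀ r, (‖v r‖ - a) ^ 2 = ‖v r‖ ^ 2 - (2 * a) * ‖v r‖ + a ^ 2 := fun r => by ring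
    simp only [e]
    rw [intervalIntegral.integral_add ((hsub s hs t ht).sub (hvi.const_mul _))
      intervalIntegrable_const, intervalIntegral.integral_sub (hsub s hs t ht) (hvi.const_mul _),
      intervalIntegral.integral_const_mul, intervalIntegral.integral_const, smul_eq_mul]
  rw [h2] at h1
  have h3 : (∫ r in s..t, ‖v r‖ ^ 2) - 2 * a * I + (t - s) * a ^ 2 =
      (∫ r in s..t, ‖v r‖ ^ 2) - I ^ 2 / (t - s) := by rw [ha]; field_simp; ring
  rw [h3] at h1
  have h4 : I ^ 2 / (t - s) ≤ ∫ r in s..t, ‖v r‖ ^ 2 := by linarith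
  rwa [div_le_iff₀' hpos] at h4

end

/-- An inequality between continuous functions of time that holds almost everywhere holds
everywhere. -/
theorem le_of_ae_le_of_continuousOn {X : ℝ → ℝ} {T C : ℝ} (hT : 0 < T)
    (hX : ContinuousOn X (Set.Icc 0 T))
    (h : ∀ᵐ t ∂(volume.restrict (Set.Ioo 0 T)), X t ≤ C) : ∀ t ∈ Set.Icc 0 T, X t ≤ C := by
  -- The inequality is rewritten as an equality of continuous functions, since such equalities pass
  -- from almost every to every point.
  have h1 : (fun t => max (X t) C) =ᵐ[volume.restrict (Set.Icc 0 T)] fun _ => C := by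
    rw [← Measure.restrict_congr_set (Ioo_ae_eq_Icc (μ := volume) (a := (0 : ℝ)) (b := T))]
    filter_upwards [h] with t ht using max_eq_right ht
  have h2 := Measure.eqOn_Icc_of_ae_eq volume hT.ne h1 (hX.sup continuousOn_const) continuousOn_const
  intro t ht
  exact max_eq_right_iff.1 (h2 ht)

/-- The projection of `ℝ × ℝ` onto the unit square. -/
noncomputable def toSquare (x y : ℝ) : unitInterval × unitInterval :=
  (Set.projIcc 0 1 zero_le_one x, Set.projIcc 0 1 zero_le_one y)

theorem Represents.apply {T : ℝ} {Φ : ℝ → ℝ → ℝ → ℝ} {u : ℝ → C(unitInterval × unitInterval, ℝ)}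
    (h : Represents T Φ u) {t : ℝ} (ht : t ∈ Set.Icc 0 T) {x y : ℝ} (hx : x ∈ Set.Icc (0 : ℝ) 1)
    (hy : y ∈ Set.Icc (0 : ℝ) 1) : u t (toSquare x y) = Φ t x y := by
  rw [h t ht, toSquare, Set.projIcc_of_mem zero_le_one hx, Set.projIcc_of_mem zero_le_one hy]

theorem continuousOn_eval {T : ℝ} {u : ℝ → C(unitInterval × unitInterval, ℝ)}
    (hu : ContinuousOn u (Set.Icc 0 T)) (p : unitInterval × unitInterval) :
    ContinuousOn (fun t => u t p) (Set.Icc 0 T) :=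
  (ContinuousMap.evalCLM ℝ p : C(unitInterval × unitInterval, ℝ) →L[ℝ] ℝ).continuous.comp_continuousOn hu

/-! ### Continuity in time of the potentials, and the equations at almost every time -/

section

variable {ε κ θ₀ T ε₀ : ℝ} {Φ : ℝ → ℝ → ℝ → ℝ}

/-- The curves of the regularity class live on the unit square; periodicity carries their continuity
to every `x`, including the shifted points `x ± h`. -/
theorem ClassR.pd_fract (hreg : ClassR T Φ) (a b : ℕ) {t : ℝ} (ht : t ∈ Set.Icc 0 T) (x : ℝ)
    {y : ℝ} (hy : y ∈ Set.Icc (0 : ℝ) 1) : pd a b (Φ t) (Int.fract x) y = pd a b (Φ t) x y := by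
  have := (pd_periodic (hreg.periodic t ht) a b hy).sub_zsmul_eq ⌊x⌋ (x := x)
  rw [zsmul_eq_mul, mul_one] at this
  exact this

theorem fract_mem_Icc (x : ℝ) : Int.fract x ∈ Set.Icc (0 : ℝ) 1 :=
  ⟨Int.fract_nonneg x, (Int.fract_lt_one x).le⟩

theorem ClassR.continuousOn_pd (hreg : ClassR T Φ) (hT : 0 < T) {a b : ℕ} (hab : a + b ≤ 2)
    (x : ℝ) {y : ℝ} (hy : y ∈ Set.Icc (0 : ℝ) 1) :
    ContinuousOn (fun t => pd a b (Φ t) x y) (Set.Icc 0 T) := by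
  obtain ⟨u, hu, v, hv⟩ := hreg.h1_C2 a b hab
  refine (continuousOn_eval (hv.continuousOn hT) (toSquare (Int.fract x) y)).congr fun t ht => ?_
  change pd a b (Φ t) x y = u t (toSquare (Int.fract x) y)
  rw [hu.apply ht (fract_mem_Icc x) hy, hreg.pd_fract a b ht x hy]

theorem ClassR.continuousOn_self (hreg : ClassR T Φ) (hT : 0 < T)
    (x : ℝ) {y : ℝ} (hy : y ∈ Set.Icc (0 : ℝ) 1) :
    ContinuousOn (fun t => Φ t x y) (Set.Icc 0 T) := by
  have := hreg.continuousOn_pd hT (a := 0) (b := 0) (by omega) x hy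
  simpa only [pd_zero_zero] using this

/-- Separation of the solution from the pure phases. -/
def Separated (T ε₀ : ℝ) (Φ : ℝ → ℝ → ℝ → ℝ) : Prop :=
  ∀ t ∈ Set.Icc 0 T, ∀ x : ℝ, ∀ y ∈ Set.Icc (0 : ℝ) 1, ε₀ ≤ 1 + Φ t x y ∧ ε₀ ≤ 1 - Φ t x y

theorem continuousAt_logPart {s : ℝ} (h1 : 0 < 1 + s) (h2 : 0 < 1 - s) : ContinuousAt logPart s := by
  unfold logPart
  exact ((continuousAt_const.add continuousAt_id).log h1.ne').sub
    ((continuousAt_const.sub continuousAt_id).log h2.ne')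

/-- The potential involves only derivatives of order at most two, which are continuous in time by
`H¹(0,T;C²)`. Thus its finite differences are continuous in time, although its Laplacian is
controlled only at almost every time. -/
theorem ClassR.continuousOn_bulkPot (hreg : ClassR T Φ) (hT : 0 < T) (hε₀ : 0 < ε₀)
    (hsep : Separated T ε₀ Φ) (x : ℝ) {y : ℝ} (hy : y ∈ Set.Icc (0 : ℝ) 1) :
    ContinuousOn (fun t => bulkPot ε θ₀ (Φ t) x y) (Set.Icc 0 T) := by
  have c0 := hreg.continuousOn_self hT x hy
  have c1 : ContinuousOn (fun t => logPart (Φ t x y)) (Set.Icc 0 T) := fun t ht => by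
    have := hsep t ht x y hy
    exact (continuousAt_logPart (by linarith [this.1]) (by linarith [this.2])).comp_continuousWithinAt
      (f := fun t => Φ t x y) (c0 t ht)
  refine ((c1.sub ((continuousOn_const (c := θ₀)).mul c0)).sub ((continuousOn_const (c := ε ^ 2)).mul
    ((hreg.continuousOn_pd hT (a := 2) (b := 0) (by omega) x hy).add
      (hreg.continuousOn_pd hT (a := 0) (b := 2) (by omega) x hy)))).congr fun t ht => ?_
  have := hsep t ht x y hy
  exact bulkPot_eq (by linarith [this.1]) (by linarith [this.2])

theorem ClassR.continuousOn_botPot (hreg : ClassR T Φ) (hT : 0 < T) (hε₀ : 0 < ε₀)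
    (hsep : Separated T ε₀ Φ) (x : ℝ) :
    ContinuousOn (fun t => botPot ε κ θ₀ (Φ t) x) (Set.Icc 0 T) := by
  have hy : (0 : ℝ) ∈ Set.Icc (0 : ℝ) 1 := ⟨le_rfl, zero_le_one⟩
  have c0 := hreg.continuousOn_self hT x hy
  have c1 : ContinuousOn (fun t => logPart (Φ t x 0)) (Set.Icc 0 T) := fun t ht => by
    have := hsep t ht x 0 hy
    exact (continuousAt_logPart (by linarith [this.1]) (by linarith [this.2])).comp_continuousWithinAt
      (f := fun t => Φ t x 0) (c0 t ht)
  refine (((c1.sub ((continuousOn_const (c := θ₀)).mul c0)).sub ((continuousOn_const (c := κ * ε)).mul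
    (hreg.continuousOn_pd hT (a := 2) (b := 0) (by omega) x hy))).sub
      ((continuousOn_const (c := ε ^ 2)).mul (hreg.continuousOn_pd hT (a := 0) (b := 1) (by omega) x hy))).congr
    fun t ht => ?_
  have := hsep t ht x 0 hy
  exact botPot_eq (by linarith [this.1]) (by linarith [this.2])

theorem ClassR.continuousOn_topPot (hreg : ClassR T Φ) (hT : 0 < T) (hε₀ : 0 < ε₀)
    (hsep : Separated T ε₀ Φ) (x : ℝ) :
    ContinuousOn (fun t => topPot ε κ θ₀ (Φ t) x) (Set.Icc 0 T) := by
  have hy : (1 : ℝ) ∈ Set.Icc (0 : ℝ) 1 := ⟨zero_le_one, le_rfl⟩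
  have c0 := hreg.continuousOn_self hT x hy
  have c1 : ContinuousOn (fun t => logPart (Φ t x 1)) (Set.Icc 0 T) := fun t ht => by
    have := hsep t ht x 1 hy
    exact (continuousAt_logPart (by linarith [this.1]) (by linarith [this.2])).comp_continuousWithinAt
      (f := fun t => Φ t x 1) (c0 t ht)
  refine (((c1.sub ((continuousOn_const (c := θ₀)).mul c0)).sub ((continuousOn_const (c := κ * ε)).mul
    (hreg.continuousOn_pd hT (a := 2) (b := 0) (by omega) x hy))).add
      ((continuousOn_const (c := ε ^ 2)).mul (hreg.continuousOn_pd hT (a := 0) (b := 1) (by omega) x hy))).congr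
    fun t ht => ?_
  have := hsep t ht x 1 hy
  exact topPot_eq (by linarith [this.1]) (by linarith [this.2])

theorem continuousOn_diff2 {F : ℝ → ℝ → ℝ} {S : Set ℝ} {h x : ℝ}
    (hp : ContinuousOn (fun t => F t (x + h)) S) (h0 : ContinuousOn (fun t => F t x) S)
    (hm : ContinuousOn (fun t => F t (x - h)) S) : ContinuousOn (fun t => diff2 h (F t) x) S :=
  ((hp.sub (continuousOn_const.mul h0)).add hm).div_const _

/-- The properties that the solution has at almost every time; `V` is the time derivative. -/
structure GoodTime (ε κ θ₀ ε₀ B : ℝ) (f V : ℝ → ℝ → ℝ) : Prop where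
  smooth : SmoothProfile ε₀ B f
  bulk : ∀ x ∈ Set.Icc (0 : ℝ) 1, ∀ y ∈ Set.Icc (0 : ℝ) 1, V x y = lap (bulkPot ε θ₀ f) x y
  flux_bot : ∀ x, pd 0 1 (bulkPot ε θ₀ f) x 0 = 0
  flux_top : ∀ x, pd 0 1 (bulkPot ε θ₀ f) x 1 = 0
  bot : ∀ x ∈ Set.Icc (0 : ℝ) 1, V x 0 = surfChain ε κ θ₀ (-1) f 0 2 x
  top : ∀ x ∈ Set.Icc (0 : ℝ) 1, V x 1 = surfChain ε κ θ₀ 1 f 1 2 x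

/-- The bulk equation is given for `0 < y < 1`, but the scheme imposes it also at the boundary
nodes; continuity in `y` carries it there. -/
theorem SmoothProfile.continuousOn_lap_bulkPot {B : ℝ} {f : ℝ → ℝ → ℝ} (hf : SmoothProfile ε₀ B f)
    (hε₀ : 0 < ε₀) (x : ℝ) : ContinuousOn (fun y => lap (bulkPot ε θ₀ f) x y) (Set.Icc 0 1) := by
  have hc : ∀ a b, a + b ≤ 6 → ContinuousOn (fun y => pd a b f x y) (Set.Icc 0 1) :=
    fun a b h => continuousOn_pd_y hf.contDiff h x
  have cP : ContinuousOn (fun y => (1 + pd 0 0 f x y)⁻¹) (Set.Icc 0 1) :=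
    (continuousOn_const.add (hc 0 0 (by omega))).inv₀ fun y hy => (hf.sep_pos hε₀ x hy).1.ne'
  have cQ : ContinuousOn (fun y => (1 - pd 0 0 f x y)⁻¹) (Set.Icc 0 1) :=
    (continuousOn_const.sub (hc 0 0 (by omega))).inv₀ fun y hy => (hf.sep_pos hε₀ x hy).2.ne'
  have c1 : ContinuousOn (fun y => _root_.potChainX ε θ₀ f y 2 x) (Set.Icc 0 1) :=
    (((((cQ.pow 2).sub (cP.pow 2)).mul ((hc 1 0 (by omega)).pow 2)).add
      ((cP.add cQ).mul (hc 2 0 (by omega)))).sub (continuousOn_const.mul (hc 2 0 (by omega)))).sub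
      (continuousOn_const.mul ((hc 4 0 (by omega)).add (hc 2 2 (by omega))))
  have c2 : ContinuousOn (_root_.potChainY ε θ₀ f x 2) (Set.Icc 0 1) := fun y hy =>
    (hf.potChainY hε₀ x 2 (by omega) y hy).continuousWithinAt
  exact (c1.add c2).congr fun y hy => hf.lap_bulkPot hε₀ x hy

/-- The pointwise time derivative equals the value of the continuous curve `v`, by evaluation at a
point. At almost every time the equations thus express `v`, which exists at all times, through the
potentials. -/
theorem ae_goodTime (hT : 0 < T) (hε₀ : 0 < ε₀) (hreg : ClassR T Φ)
    (hsol : SolvesCahnHilliard ε κ θ₀ T Φ) (hsep : Separated T ε₀ Φ)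
    {u v : ℝ → C(unitInterval × unitInterval, ℝ)} (hu : Represents T Φ u)
    (huv : HasTimeDeriv T u v) (hv : ContinuousOn v (Set.Icc 0 T)) :
    ∃ B, ∀ᵐ t ∂(volume.restrict (Set.Ioo 0 T)),
      GoodTime ε κ θ₀ ε₀ B (Φ t) fun x y => v t (toSquare x y) := by
  obtain ⟨B, hB⟩ := hreg.linf_C6
  refine ⟨B, ?_⟩
  filter_upwards [hB, hsol, ae_restrict_mem measurableSet_Ioo] with t htB hts htT
  have htI := Set.Ioo_subset_Icc_self htT
  have hf : SmoothProfile ε₀ B (Φ t) := ⟨by exact_mod_cast htB.1, htB.2, hreg.periodic t htI, hsep t htI⟩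
  have hder : ∀ x ∈ Set.Icc (0 : ℝ) 1, ∀ y ∈ Set.Icc (0 : ℝ) 1,
      deriv (fun s => Φ s x y) t = v t (toSquare x y) := by
    intro x hx y hy
    have h1 := huv.hasDerivAt hT hv htT
    have h2 : HasDerivAt (fun s => u s (toSquare x y)) (v t (toSquare x y)) t :=
      (ContinuousMap.evalCLM ℝ (toSquare x y) :
        C(unitInterval × unitInterval, ℝ) →L[ℝ] ℝ).hasFDerivAt.comp_hasDerivAt t h1
    refine (h2.congr_of_eventuallyEq ?_).deriv
    filter_upwards [Icc_mem_nhds htT.1 htT.2] with s hs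
    rw [hu.apply hs hx hy]
  have h0 : (0 : ℝ) ∈ Set.Icc (0 : ℝ) 1 := ⟨le_rfl, zero_le_one⟩
  have h1 : (1 : ℝ) ∈ Set.Icc (0 : ℝ) 1 := ⟨zero_le_one, le_rfl⟩
  refine ⟨hf, ?_, fun x => (hts x).2.1, fun x => (hts x).2.2.1, ?_, ?_⟩
  · intro x hx y hy
    have he : Set.EqOn (fun y => v t (toSquare x y)) (fun y => lap (bulkPot ε θ₀ (Φ t)) x y)
        (Set.Ioo 0 1) := fun y hy => by
      change v t (toSquare x y) = lap (bulkPot ε θ₀ (Φ t)) x y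
      rw [← (hts x).1 y hy, hder x hx y (Set.Ioo_subset_Icc_self hy)]
    have hc : Continuous fun y => v t (toSquare x y) := by
      refine (v t).continuous.comp ?_
      unfold toSquare
      exact continuous_const.prodMk continuous_projIcc
    exact he.of_subset_closure hc.continuousOn (hf.continuousOn_lap_bulkPot hε₀ x)
      Set.Ioo_subset_Icc_self (by rw [closure_Ioo zero_ne_one]) hy
  · intro x hx
    rw [← hder x hx 0 h0, (hts x).2.2.2.1, hf.botPot_eq_chain hε₀,
      hf.iteratedDeriv_surfChain hε₀ _ h0]
  · intro x hx
    rw [← hder x hx 1 h1, (hts x).2.2.2.2, hf.topPot_eq_chain hε₀,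
      hf.iteratedDeriv_surfChain hε₀ _ h1]

end

/-! ### Consistency at all times -/

section

variable {ε κ θ₀ T ε₀ : ℝ} {Φ : ℝ → ℝ → ℝ → ℝ}

theorem ClassR.contDiff_two (hreg : ClassR T Φ) {t : ℝ} (ht : t ∈ Set.Icc 0 T) :
    ContDiffOn ℝ ((2 : ℕ) : WithTop ℕ∞) (Function.uncurry (Φ t)) strip := by
  exact_mod_cast hreg.contDiff2 t ht

theorem ClassR.continuous_pd (hreg : ClassR T Φ) {t : ℝ} (ht : t ∈ Set.Icc 0 T) {a b : ℕ}
    (hab : a + b ≤ 2) {y : ℝ} (hy : y ∈ Set.Icc (0 : ℝ) 1) :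
    Continuous fun x => pd a b (Φ t) x y :=
  continuous_pd_x (hreg.contDiff_two ht) hab hy

theorem ClassR.periodic_pd (hreg : ClassR T Φ) {t : ℝ} (ht : t ∈ Set.Icc 0 T) (a b : ℕ) {y : ℝ}
    (hy : y ∈ Set.Icc (0 : ℝ) 1) : Function.Periodic (fun x => pd a b (Φ t) x y) 1 :=
  pd_periodic (hreg.periodic t ht) a b hy

theorem ClassR.continuous_x (hreg : ClassR T Φ) {t : ℝ} (ht : t ∈ Set.Icc 0 T) {y : ℝ}
    (hy : y ∈ Set.Icc (0 : ℝ) 1) : Continuous fun x => Φ t x y := by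
  have := hreg.continuous_pd ht (a := 0) (b := 0) (by omega) hy
  simpa only [pd_zero_zero] using this

theorem Separated.pos (hsep : Separated T ε₀ Φ) (hε₀ : 0 < ε₀) {t : ℝ} (ht : t ∈ Set.Icc 0 T)
    (x : ℝ) {y : ℝ} (hy : y ∈ Set.Icc (0 : ℝ) 1) : 0 < 1 + Φ t x y ∧ 0 < 1 - Φ t x y := by
  have := hsep t ht x y hy
  constructor <;> linarith [this.1, this.2]

theorem ClassR.continuous_logPart (hreg : ClassR T Φ) (hε₀ : 0 < ε₀) (hsep : Separated T ε₀ Φ)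
    {t : ℝ} (ht : t ∈ Set.Icc 0 T) {y : ℝ} (hy : y ∈ Set.Icc (0 : ℝ) 1) :
    Continuous fun x => logPart (Φ t x y) :=
  continuous_iff_continuousAt.2 fun x => by
    have := hsep.pos hε₀ ht x hy
    exact (continuousAt_logPart this.1 this.2).comp (f := fun x => Φ t x y)
      (hreg.continuous_x ht hy).continuousAt

theorem ClassR.continuous_lap (hreg : ClassR T Φ) {t : ℝ} (ht : t ∈ Set.Icc 0 T) {y : ℝ}
    (hy : y ∈ Set.Icc (0 : ℝ) 1) : Continuous fun x => lap (Φ t) x y :=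
  (hreg.continuous_pd ht (by omega) hy).add (hreg.continuous_pd ht (by omega) hy)

theorem ClassR.continuous_bulkPot (hreg : ClassR T Φ) (hε₀ : 0 < ε₀) (hsep : Separated T ε₀ Φ)
    {t : ℝ} (ht : t ∈ Set.Icc 0 T) {y : ℝ} (hy : y ∈ Set.Icc (0 : ℝ) 1) :
    Continuous fun x => bulkPot ε θ₀ (Φ t) x y := by
  have h : (fun x => bulkPot ε θ₀ (Φ t) x y) = fun x =>
      logPart (Φ t x y) - θ₀ * Φ t x y - ε ^ 2 * lap (Φ t) x y := by
    funext x
    have := hsep.pos hε₀ ht x hy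
    exact bulkPot_eq this.1 this.2
  rw [h]
  exact ((hreg.continuous_logPart hε₀ hsep ht hy).sub
    (continuous_const.mul (hreg.continuous_x ht hy))).sub
      (continuous_const.mul (hreg.continuous_lap ht hy))

theorem ClassR.periodic_bulkPot (hreg : ClassR T Φ) {t : ℝ} (ht : t ∈ Set.Icc 0 T) {y : ℝ}
    (hy : y ∈ Set.Icc (0 : ℝ) 1) : Function.Periodic (fun x => bulkPot ε θ₀ (Φ t) x y) 1 := by
  intro x
  have h1 := hreg.periodic_pd ht 2 0 hy x
  have h2 := hreg.periodic_pd ht 0 2 hy x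
  simp only at h1 h2
  simp only [bulkPot, lap, hreg.periodic t ht x y hy, h1, h2]

theorem ClassR.continuous_botPot (hreg : ClassR T Φ) (hε₀ : 0 < ε₀) (hsep : Separated T ε₀ Φ)
    {t : ℝ} (ht : t ∈ Set.Icc 0 T) : Continuous (botPot ε κ θ₀ (Φ t)) := by
  have hy : (0 : ℝ) ∈ Set.Icc (0 : ℝ) 1 := ⟨le_rfl, zero_le_one⟩
  have h : botPot ε κ θ₀ (Φ t) = fun x => logPart (Φ t x 0) - θ₀ * Φ t x 0
      - κ * ε * pd 2 0 (Φ t) x 0 - ε ^ 2 * pd 0 1 (Φ t) x 0 := by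
    funext x
    have := hsep.pos hε₀ ht x hy
    exact botPot_eq this.1 this.2
  rw [h]
  exact (((hreg.continuous_logPart hε₀ hsep ht hy).sub
    (continuous_const.mul (hreg.continuous_x ht hy))).sub
      (continuous_const.mul (hreg.continuous_pd ht (by omega) hy))).sub
      (continuous_const.mul (hreg.continuous_pd ht (by omega) hy))

theorem ClassR.periodic_botPot (hreg : ClassR T Φ) {t : ℝ} (ht : t ∈ Set.Icc 0 T) :
    Function.Periodic (botPot ε κ θ₀ (Φ t)) 1 := by
  intro x
  have hy : (0 : ℝ) ∈ Set.Icc (0 : ℝ) 1 := ⟨le_rfl, zero_le_one⟩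
  have h1 := hreg.periodic_pd ht 2 0 hy x
  have h2 := hreg.periodic_pd ht 0 1 hy x
  simp only at h1 h2
  simp only [botPot, ← pd_two_zero, hreg.periodic t ht x 0 hy, h1, h2]

theorem ClassR.continuous_topPot (hreg : ClassR T Φ) (hε₀ : 0 < ε₀) (hsep : Separated T ε₀ Φ)
    {t : ℝ} (ht : t ∈ Set.Icc 0 T) : Continuous (topPot ε κ θ₀ (Φ t)) := by
  have hy : (1 : ℝ) ∈ Set.Icc (0 : ℝ) 1 := ⟨zero_le_one, le_rfl⟩
  have h : topPot ε κ θ₀ (Φ t) = fun x => logPart (Φ t x 1) - θ₀ * Φ t x 1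
      - κ * ε * pd 2 0 (Φ t) x 1 + ε ^ 2 * pd 0 1 (Φ t) x 1 := by
    funext x
    have := hsep.pos hε₀ ht x hy
    exact topPot_eq this.1 this.2
  rw [h]
  exact (((hreg.continuous_logPart hε₀ hsep ht hy).sub
    (continuous_const.mul (hreg.continuous_x ht hy))).sub
      (continuous_const.mul (hreg.continuous_pd ht (by omega) hy))).add
      (continuous_const.mul (hreg.continuous_pd ht (by omega) hy))

theorem ClassR.periodic_topPot (hreg : ClassR T Φ) {t : ℝ} (ht : t ∈ Set.Icc 0 T) :
    Function.Periodic (topPot ε κ θ₀ (Φ t)) 1 := by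
  intro x
  have hy : (1 : ℝ) ∈ Set.Icc (0 : ℝ) 1 := ⟨zero_le_one, le_rfl⟩
  have h1 := hreg.periodic_pd ht 2 0 hy x
  have h2 := hreg.periodic_pd ht 0 1 hy x
  simp only at h1 h2
  simp only [topPot, ← pd_two_zero, hreg.periodic t ht x 1 hy, h1, h2]

/-- Follows from `log (x / y) ≤ x / y - 1`, applied to both logarithms and in both directions. -/
theorem logPart_sub_le {a b c : ℝ} (hc : 0 < c) (ha : c ≤ 1 + a ∧ c ≤ 1 - a)
    (hb : c ≤ 1 + b ∧ c ≤ 1 - b) : |logPart a - logPart b| ≤ 2 / c * |a - b| := by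
  have key : ∀ x y, c ≤ x → c ≤ y → Real.log x - Real.log y ≤ 1 / c * |x - y| := by
    intro x y hx hy
    have hx0 : 0 < x := by linarith
    have hy0 : 0 < y := by linarith
    rw [← Real.log_div hx0.ne' hy0.ne']
    refine (Real.log_le_sub_one_of_pos (div_pos hx0 hy0)).trans ?_
    rw [show x / y - 1 = 1 / y * (x - y) by field_simp]
    exact (mul_le_mul_of_nonneg_left (le_abs_self _) (by positivity)).trans
      (mul_le_mul_of_nonneg_right (one_div_le_one_div_of_le hc hy) (abs_nonneg _))
  have h1 := key _ _ ha.1 hb.1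
  have h2 := key _ _ hb.1 ha.1
  have h3 := key _ _ ha.2 hb.2
  have h4 := key _ _ hb.2 ha.2
  have e1 : |1 + a - (1 + b)| = |a - b| := by rw [add_sub_add_left_eq_sub]
  have e2 : |1 + b - (1 + a)| = |a - b| := by rw [add_sub_add_left_eq_sub, abs_sub_comm]
  have e3 : |1 - a - (1 - b)| = |a - b| := by rw [sub_sub_sub_cancel_left, abs_sub_comm]
  have e4 : |1 - b - (1 - a)| = |a - b| := by rw [sub_sub_sub_cancel_left]
  rw [e1] at h1; rw [e2] at h2; rw [e3] at h3; rw [e4] at h4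
  rw [show 2 / c * |a - b| = 1 / c * |a - b| + 1 / c * |a - b| by ring, abs_le]
  unfold logPart
  constructor <;> linarith

theorem continuousOn_of_norm_sub_le {E F : Type*} [NormedAddCommGroup E] [NormedAddCommGroup F]
    {S : Set ℝ} {f : ℝ → E} {u : ℝ → F} {L : ℝ} (hu : ContinuousOn u S)
    (h : ∀ s ∈ S, ∀ t ∈ S, ‖f s - f t‖ ≤ L * ‖u s - u t‖) : ContinuousOn f S := by
  intro t ht
  refine tendsto_iff_norm_sub_tendsto_zero.2 (squeeze_zero' (Filter.Eventually.of_forall fun _ =>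
    norm_nonneg _) (g := fun s => L * ‖u s - u t‖) ?_ ?_)
  · filter_upwards [self_mem_nhdsWithin] with s hs using h s hs t ht
  · have := (tendsto_iff_norm_sub_tendsto_zero.1 (hu t ht)).const_mul L
    rwa [mul_zero] at this

/-- Each of the finitely many Fourier coefficients inherits the modulus of continuity of `u`. This
is needed to extend the projection error estimates from almost every time to every time. -/
theorem continuousOn_partialSum {F : Type*} [NormedAddCommGroup F] {S : Set ℝ} {u : ℝ → F}
    {G : ℝ → ℝ → ℝ} {L : ℝ} (hu : ContinuousOn u S)
    (hG : ∀ t ∈ S, Continuous (G t))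
    (h : ∀ s ∈ S, ∀ t ∈ S, ∀ x ∈ Set.Icc (0 : ℝ) 1, |G s x - G t x| ≤ L * ‖u s - u t‖)
    (K : ℕ) (x : ℝ) : ContinuousOn (fun t => partialSum K (G t) x) S := by
  have hc : ∀ k, ContinuousOn (fun t => coeffK (G t) k) S := fun k =>
    continuousOn_of_norm_sub_le (L := L) hu fun s hs t ht => by
      have e : coeffK (G s) k = coeffK (fun x => G t x + (G s x - G t x)) k := by
        congr 1; funext x; ring
      rw [e, coeffK_add (g := fun x => G s x - G t x) (hG t ht).continuousOn
        ((hG s hs).sub (hG t ht)).continuousOn, add_sub_cancel_left]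
      exact norm_coeffK_le (h s hs t ht) k
  unfold partialSum
  exact Complex.continuous_re.comp_continuousOn
    (continuousOn_finsetSum _ fun k _ => (hc k).mul continuousOn_const)

/-- Integration of a continuous function on the square along a horizontal line. -/
noncomputable def lineIntegral (y : ℝ) : C(unitInterval × unitInterval, ℝ) →L[ℝ] ℝ :=
  LinearMap.mkContinuous
    { toFun := fun f => ∫ x in (0 : ℝ)..1, f (toSquare x y)
      map_add' := fun f g => intervalIntegral.integral_add
        (Continuous.intervalIntegrable (by unfold toSquare; fun_prop) _ _)
        (Continuous.intervalIntegrable (by unfold toSquare; fun_prop) _ _)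
      map_smul' := fun c f => intervalIntegral.integral_smul c _ } 1 fun f => by
    have := intervalIntegral.norm_integral_le_of_norm_le_const (a := (0 : ℝ)) (b := 1)
      (f := fun x => f (toSquare x y)) fun x _ => f.norm_coe_le_norm (toSquare x y)
    simpa using this

/-- Integration along a row is a continuous functional, so it commutes with the time integral of
`v`, whose row integral vanishes almost everywhere. -/
theorem integral_row_eq (hT : 0 < T) {u v : ℝ → C(unitInterval × unitInterval, ℝ)}
    (hu : Represents T Φ u) (huv : HasTimeDeriv T u v) {y : ℝ} (hy : y ∈ Set.Icc (0 : ℝ) 1)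
    (h : ∀ᵐ t ∂(volume.restrict (Set.Ioo 0 T)), ∫ x in (0 : ℝ)..1, v t (toSquare x y) = 0)
    {t : ℝ} (ht : t ∈ Set.Icc 0 T) :
    ∫ x in (0 : ℝ)..1, Φ t x y = ∫ x in (0 : ℝ)..1, Φ 0 x y := by
  have h0 : (0 : ℝ) ∈ Set.Icc 0 T := ⟨le_rfl, hT.le⟩
  have e : ∀ s ∈ Set.Icc 0 T, lineIntegral y (u s) = ∫ x in (0 : ℝ)..1, Φ s x y := fun s hs =>
    intervalIntegral.integral_congr fun x hx => by
      rw [Set.uIcc_of_le zero_le_one] at hx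
      exact hu.apply hs hx hy
  rw [← e t ht, ← e 0 h0, ← sub_eq_zero, ← map_sub, huv.sub_eq hT h0 ht,
    ← ContinuousLinearMap.intervalIntegral_comp_comm _ (huv.intervalIntegrable_sub hT h0 ht)]
  refine intervalIntegral.integral_zero_ae ?_
  have h' := (ae_restrict_iff' measurableSet_Ioo).1 h
  have hne : ∀ᵐ s : ℝ, s ≠ T := by simp [ae_iff]
  filter_upwards [h', hne] with s hs hsT hst
  rw [Set.uIoc_of_le ht.1] at hst
  exact hs ⟨hst.1, lt_of_le_of_ne (hst.2.trans ht.2) hsT⟩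

/-- Consistency of the discretization with the exact solution at all times. The increments of
`p` and `q` bound the integrals of the second time derivative and of its square. -/
structure Consistent (ε κ θ₀ T C : ℝ) (Φ : ℝ → ℝ → ℝ → ℝ) (p q : ℝ → ℝ) : Prop where
  p_zero : p 0 = 0
  p_mono : ∀ s ∈ Set.Icc 0 T, ∀ t ∈ Set.Icc 0 T, s ≤ t → p s ≤ p t
  p_le : ∀ t ∈ Set.Icc 0 T, p t ≤ C
  q_zero : q 0 = 0
  q_le : ∀ t ∈ Set.Icc 0 T, q t ≤ C
  sq_le : ∀ s ∈ Set.Icc 0 T, ∀ t ∈ Set.Icc 0 T, s ≤ t → (p t - p s) ^ 2 ≤ (t - s) * (q t - q s)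
  lip : ∀ s ∈ Set.Icc 0 T, ∀ t ∈ Set.Icc 0 T, s ≤ t → ∀ x ∈ Set.Icc (0 : ℝ) 1,
    ∀ y ∈ Set.Icc (0 : ℝ) 1, |Φ t x y - Φ s x y| ≤ C * (t - s)
  bulk : ∀ s ∈ Set.Icc 0 T, ∀ t ∈ Set.Icc 0 T, s < t → ∀ h, 0 < h → ∀ x ∈ Set.Icc (0 : ℝ) 1,
    ∀ y, 0 ≤ y - h → y + h ≤ 1 →
    |lapFD h (bulkPot ε θ₀ (Φ t)) x y - (Φ t x y - Φ s x y) / (t - s)| ≤ C * h ^ 2 + (p t - p s)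
  bulk_bd : ∀ s ∈ Set.Icc 0 T, ∀ t ∈ Set.Icc 0 T, s < t → ∀ h, 0 < h → h ≤ 1 →
    ∀ x ∈ Set.Icc (0 : ℝ) 1, ∀ σ y, (σ = 1 ∧ y = 0 ∨ σ = -1 ∧ y = 1) →
    |lapBd h σ y (bulkPot ε θ₀ (Φ t)) x - (Φ t x y - Φ s x y) / (t - s)| ≤ C * h + (p t - p s)
  surf_bot : ∀ s ∈ Set.Icc 0 T, ∀ t ∈ Set.Icc 0 T, s < t → ∀ h, 0 < h → ∀ x ∈ Set.Icc (0 : ℝ) 1,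
    |diff2 h (botPot ε κ θ₀ (Φ t)) x - (Φ t x 0 - Φ s x 0) / (t - s)| ≤ C * h ^ 2 + (p t - p s)
  surf_top : ∀ s ∈ Set.Icc 0 T, ∀ t ∈ Set.Icc 0 T, s < t → ∀ h, 0 < h → ∀ x ∈ Set.Icc (0 : ℝ) 1,
    |diff2 h (topPot ε κ θ₀ (Φ t)) x - (Φ t x 1 - Φ s x 1) / (t - s)| ≤ C * h ^ 2 + (p t - p s)
  lapFD_self : ∀ t ∈ Set.Icc 0 T, ∀ h, 0 < h → ∀ x y, 0 ≤ y - h → y + h ≤ 1 →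
    |lapFD h (Φ t) x y - lap (Φ t) x y| ≤ C * h ^ 2
  diff2_self : ∀ t ∈ Set.Icc 0 T, ∀ h, 0 < h → ∀ x, ∀ y ∈ Set.Icc (0 : ℝ) 1,
    |diff2 h (fun x' => Φ t x' y) x - pd 2 0 (Φ t) x y| ≤ C * h ^ 2
  lapBd_self : ∀ t ∈ Set.Icc 0 T, ∀ h, 0 < h → h ≤ 1 → ∀ x, ∀ σ y,
    (σ = 1 ∧ y = 0 ∨ σ = -1 ∧ y = 1) →
    |lapBd h σ y (Φ t) x - lap (Φ t) x y - 2 / h * σ * pd 0 1 (Φ t) x y| ≤ C * h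
  partialSum_self : ∀ t ∈ Set.Icc 0 T, ∀ K : ℕ, 1 ≤ K → ∀ x, ∀ y ∈ Set.Icc (0 : ℝ) 1,
    |partialSum K (fun x' => Φ t x' y) x - Φ t x y| ≤ C * mesh K ^ 2
  partialSum_logPart : ∀ t ∈ Set.Icc 0 T, ∀ K : ℕ, 1 ≤ K → ∀ x, ∀ y ∈ Set.Icc (0 : ℝ) 1,
    |partialSum K (fun x' => logPart (Φ t x' y)) x - logPart (Φ t x y)| ≤ C * mesh K ^ 2
  mass_bot : ∀ t ∈ Set.Icc 0 T, ∫ x in (0 : ℝ)..1, Φ t x 0 = ∫ x in (0 : ℝ)..1, Φ 0 x 0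
  mass_top : ∀ t ∈ Set.Icc 0 T, ∫ x in (0 : ℝ)..1, Φ t x 1 = ∫ x in (0 : ℝ)..1, Φ 0 x 1

set_option maxHeartbeats 800000 in
/-- The solution is consistent with the discretization. -/
theorem exists_consistent (hT : 0 < T) (hε : 0 < ε) (hκ : 0 < κ) (hε₀ : 0 < ε₀)
    (hreg : ClassR T Φ) (hsol : SolvesCahnHilliard ε κ θ₀ T Φ) (hsep : Separated T ε₀ Φ) :
    ∃ C p q, Consistent ε κ θ₀ T C Φ p q := by
  obtain ⟨u, hu, v, huv, w, hvw⟩ := hreg.h2_C0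
  have hv := hvw.continuousOn hT
  have huc := huv.continuousOn hT
  obtain ⟨B, hB⟩ := ae_goodTime hT hε₀ hreg hsol hsep hu huv hv
  obtain ⟨A, hA⟩ := isCompact_Icc.exists_bound_of_continuousOn hv
  have h0T : (0 : ℝ) ∈ Set.Icc 0 T := ⟨le_rfl, hT.le⟩
  have hTT : T ∈ Set.Icc 0 T := ⟨hT.le, le_rfl⟩
  have hA0 : 0 ≤ A := (norm_nonneg _).trans (hA 0 h0T)
  have hy0 : (0 : ℝ) ∈ Set.Icc (0 : ℝ) 1 := ⟨le_rfl, zero_le_one⟩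
  have hy1 : (1 : ℝ) ∈ Set.Icc (0 : ℝ) 1 := ⟨zero_le_one, le_rfl⟩
  set p : ℝ → ℝ := fun t => ∫ r in (0 : ℝ)..t, ‖w r‖ with hp
  set q : ℝ → ℝ := fun t => ∫ r in (0 : ℝ)..t, ‖w r‖ ^ 2 with hq
  have hps : ∀ s ∈ Set.Icc 0 T, ∀ t ∈ Set.Icc 0 T, p t - p s = ∫ r in s..t, ‖w r‖ :=
    fun s hs t ht => intervalIntegral.integral_interval_sub_left
      (hvw.intervalIntegrable_sub hT h0T ht).norm (hvw.intervalIntegrable_sub hT h0T hs).norm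
  have hpm : ∀ s ∈ Set.Icc 0 T, ∀ t ∈ Set.Icc 0 T, s ≤ t → p s ≤ p t := fun s hs t ht hst => by
    have := intervalIntegral.integral_nonneg (μ := volume) hst fun r _ => norm_nonneg (w r)
    rw [← hps s hs t ht] at this
    linarith
  have hqT : ∀ t ∈ Set.Icc 0 T, q t ≤ q T := fun t ht =>
    intervalIntegral.integral_mono_interval le_rfl ht.1 ht.2
      (ae_of_all _ fun _ => sq_nonneg _)
      ((intervalIntegrable_iff_integrableOn_Ioc_of_le hT.le).2 hvw.1.integrable_norm_pow')
  set S := spaceConst ε κ θ₀ ε₀ B with hSdef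
  have hC : ∃ C, p T ≤ C ∧ q T ≤ C ∧ A ≤ C ∧ 4 * S ≤ C ∧ 4 * B ≤ C ∧ 2 * B ≤ C ∧
      fourierConst * B ≤ C ∧ fourierConst * logBound ε₀ B ≤ C := by
    refine ⟨|p T| + |q T| + A + |4 * S| + |4 * B| + |2 * B| + |fourierConst * B| +
      |fourierConst * logBound ε₀ B|, ?_⟩
    have b1 := le_abs_self (p T); have c1 := abs_nonneg (p T)
    have b2 := le_abs_self (q T); have c2 := abs_nonneg (q T)
    have b3 := le_abs_self (4 * S); have c3 := abs_nonneg (4 * S)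
    have b4 := le_abs_self (4 * B); have c4 := abs_nonneg (4 * B)
    have b5 := le_abs_self (2 * B); have c5 := abs_nonneg (2 * B)
    have b6 := le_abs_self (fourierConst * B); have c6 := abs_nonneg (fourierConst * B)
    have b7 := le_abs_self (fourierConst * logBound ε₀ B)
    have c7 := abs_nonneg (fourierConst * logBound ε₀ B)
    refine ⟨?_, ?_, ?_, ?_, ?_, ?_, ?_, ?_⟩ <;> linarith
  obtain ⟨C, hCp, hCq, hCA, hCS, hC4, hC2, hCF, hCL⟩ := hC
  -- The time derivative at the new time is replaced by the backward quotient at the price of `∫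
  -- ‖∂ₜ²Φ‖` over the step.
  have hback : ∀ s ∈ Set.Icc 0 T, ∀ t ∈ Set.Icc 0 T, s < t → ∀ x ∈ Set.Icc (0 : ℝ) 1,
      ∀ y ∈ Set.Icc (0 : ℝ) 1,
      |v t (toSquare x y) - (Φ t x y - Φ s x y) / (t - s)| ≤ p t - p s := by
    intro s hs t ht hst x hx y hy
    have hpos : 0 < t - s := sub_pos.2 hst
    have h1 := huv.backward_difference_le hT hvw hs ht hst.le
    have h2 := ((u t - u s - (t - s) • v t).norm_coe_le_norm (toSquare x y)).trans h1
    rw [← hps s hs t ht] at h2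
    simp only [ContinuousMap.sub_apply, ContinuousMap.smul_apply, smul_eq_mul, Real.norm_eq_abs,
      hu.apply hs hx hy, hu.apply ht hx hy] at h2
    have h3 : v t (toSquare x y) - (Φ t x y - Φ s x y) / (t - s) =
        -((Φ t x y - Φ s x y - (t - s) * v t (toSquare x y)) / (t - s)) := by field_simp; ring
    rw [h3, abs_neg, abs_div, abs_of_pos hpos, div_le_iff₀' hpos]
    exact h2
  have combine : ∀ {a b c m n : ℝ}, |a - b| ≤ m → |b - c| ≤ n → |a - c| ≤ m + n :=
    fun h1 h2 => (abs_sub_le _ _ _).trans (add_le_add h1 h2)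
  -- The mechanism for every estimate below: prove it at good times, where six derivatives are
  -- bounded, and extend it by continuity of `X` and `Y` in time.
  have close : ∀ {X Y : ℝ → ℝ} {c m : ℝ}, ContinuousOn X (Set.Icc 0 T) →
      ContinuousOn Y (Set.Icc 0 T) → c ≤ C → 0 ≤ m →
      (∀ t, GoodTime ε κ θ₀ ε₀ B (Φ t) (fun x y => v t (toSquare x y)) → |X t - Y t| ≤ c * m) →
      ∀ t ∈ Set.Icc 0 T, |X t - Y t| ≤ C * m := fun hX hY hc hm h =>
    le_of_ae_le_of_continuousOn hT (hX.sub hY).abs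
      (hB.mono fun t ht => (h t ht).trans (mul_le_mul_of_nonneg_right hc hm))
  have cu := fun x {y : ℝ} (hy : y ∈ Set.Icc (0 : ℝ) 1) => hreg.continuousOn_self hT x hy
  have cp := fun {a b : ℕ} (hab : a + b ≤ 2) x {y : ℝ} (hy : y ∈ Set.Icc (0 : ℝ) 1) =>
    hreg.continuousOn_pd hT hab x hy
  have cb := fun x {y : ℝ} (hy : y ∈ Set.Icc (0 : ℝ) 1) =>
    hreg.continuousOn_bulkPot (ε := ε) (θ₀ := θ₀) hT hε₀ hsep x hy
  have cl := fun x {y : ℝ} (hy : y ∈ Set.Icc (0 : ℝ) 1) =>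
    (cp (a := 2) (b := 0) (by omega) x hy).add (cp (a := 0) (b := 2) (by omega) x hy)
  have cv := fun x y => continuousOn_eval hv (toSquare x y)
  have hnb : ∀ {h σ y : ℝ}, 0 < h → h ≤ 1 → (σ = 1 ∧ y = 0 ∨ σ = -1 ∧ y = 1) →
      |σ| = 1 ∧ y ∈ Set.Icc (0 : ℝ) 1 ∧ y + σ * h ∈ Set.Icc (0 : ℝ) 1 := by
    rintro h σ y hh h1 (⟨rfl, rfl⟩ | ⟨rfl, rfl⟩)
    · exact ⟨abs_one, hy0, ⟨by linarith, by linarith⟩⟩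
    · exact ⟨by simp, hy1, ⟨by linarith, by linarith⟩⟩
  have hub : ∀ s ∈ Set.Icc 0 T, ∀ t ∈ Set.Icc 0 T, ∀ x ∈ Set.Icc (0 : ℝ) 1,
      ∀ y ∈ Set.Icc (0 : ℝ) 1, |Φ s x y - Φ t x y| ≤ ‖u s - u t‖ := fun s hs t ht x hx y hy => by
    have := (u s - u t).norm_coe_le_norm (toSquare x y)
    rwa [ContinuousMap.sub_apply, hu.apply hs hx hy, hu.apply ht hx hy, Real.norm_eq_abs] at this
  refine ⟨C, p, q, ?_⟩
  constructor
  case p_zero => exact intervalIntegral.integral_same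
  case p_mono => exact hpm
  case p_le => exact fun t ht => (hpm t ht T hTT ht.2).trans hCp
  case q_zero => exact intervalIntegral.integral_same
  case q_le => exact fun t ht => (hqT t ht).trans hCq
  case sq_le =>
    intro s hs t ht hst
    rw [hps s hs t ht]
    exact hvw.sq_integral_norm_le hT hs ht hst
  case lip =>
    intro s hs t ht hst x hx y hy
    refine (hub t ht s hs x hx y hy).trans ?_
    rw [huv.sub_eq hT hs ht]
    have := intervalIntegral.norm_integral_le_of_norm_le_const (a := s) (b := t) (f := v) (C := A)
      fun r hr => by
        rw [Set.uIoc_of_le hst] at hr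
        exact hA r ⟨hs.1.trans hr.1.le, hr.2.trans ht.2⟩
    rw [abs_of_nonneg (sub_nonneg.2 hst)] at this
    exact this.trans (mul_le_mul_of_nonneg_right hCA (sub_nonneg.2 hst))
  case bulk =>
    intro s hs t ht hst h hh x hx y hm hp
    have hy : y ∈ Set.Icc (0 : ℝ) 1 := ⟨by linarith, by linarith⟩
    -- The intermediate quantity is `v` and not the Laplacian of the potential, because only `v` is
    -- known to be continuous in time.
    refine combine ?_ (hback s hs t ht hst x hx y hy)
    refine close (X := fun t => lapFD h (bulkPot ε θ₀ (Φ t)) x y)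
      (Y := fun t => v t (toSquare x y)) ?_ (cv x y) hCS (sq_nonneg h) (fun t ht => ?_) t ht
    · exact (continuousOn_diff2 (F := fun t x' => bulkPot ε θ₀ (Φ t) x' y) (cb _ hy) (cb _ hy) (cb _ hy)).add
        (continuousOn_diff2 (F := fun t y' => bulkPot ε θ₀ (Φ t) x y')
          (cb _ ⟨by linarith, hp⟩) (cb _ hy) (cb _ ⟨hm, by linarith⟩))
    · rw [ht.bulk x hx y hy]
      exact ht.smooth.lapFD_bulkPot hε₀ hε hκ hh x hm hp
  case bulk_bd =>
    intro s hs t ht hst h hh h1 x hx σ y hσ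
    obtain ⟨e1, hy, e2⟩ := hnb hh h1 hσ
    refine combine ?_ (hback s hs t ht hst x hx y hy)
    refine close (X := fun t => lapBd h σ y (bulkPot ε θ₀ (Φ t)) x)
      (Y := fun t => v t (toSquare x y)) ?_ (cv x y) hCS hh.le (fun t ht => ?_) t ht
    · exact (continuousOn_diff2 (F := fun t x' => bulkPot ε θ₀ (Φ t) x' y) (cb _ hy) (cb _ hy) (cb _ hy)).add
        (continuousOn_const.mul ((cb _ e2).sub (cb _ hy)))
    · rw [ht.bulk x hx y hy]
      refine ht.smooth.lapBd_bulkPot hε₀ hε hκ hh h1 e1 x hy e2 ?_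
      rcases hσ with ⟨-, rfl⟩ | ⟨-, rfl⟩
      exacts [ht.flux_bot x, ht.flux_top x]
  case surf_bot =>
    intro s hs t ht hst h hh x hx
    refine combine ?_ (hback s hs t ht hst x hx 0 hy0)
    have c := fun x => hreg.continuousOn_botPot (ε := ε) (κ := κ) (θ₀ := θ₀) hT hε₀ hsep x
    refine close (X := fun t => diff2 h (botPot ε κ θ₀ (Φ t)) x)
      (Y := fun t => v t (toSquare x 0)) (continuousOn_diff2 (F := fun t => botPot ε κ θ₀ (Φ t)) (c _) (c _) (c _))
      (cv x 0) hCS (sq_nonneg h)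
      (fun t ht => ?_) t ht
    rw [ht.bot x hx, ht.smooth.botPot_eq_chain hε₀]
    exact ht.smooth.diff2_surfChain hε₀ hε hκ hh (by simp) x hy0
  case surf_top =>
    intro s hs t ht hst h hh x hx
    refine combine ?_ (hback s hs t ht hst x hx 1 hy1)
    have c := fun x => hreg.continuousOn_topPot (ε := ε) (κ := κ) (θ₀ := θ₀) hT hε₀ hsep x
    refine close (X := fun t => diff2 h (topPot ε κ θ₀ (Φ t)) x)
      (Y := fun t => v t (toSquare x 1)) (continuousOn_diff2 (F := fun t => topPot ε κ θ₀ (Φ t)) (c _) (c _) (c _))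
      (cv x 1) hCS (sq_nonneg h)
      (fun t ht => ?_) t ht
    rw [ht.top x hx, ht.smooth.topPot_eq_chain hε₀]
    exact ht.smooth.diff2_surfChain hε₀ hε hκ hh (by simp) x hy1
  case lapFD_self =>
    intro t ht h hh x y hm hp
    have hy : y ∈ Set.Icc (0 : ℝ) 1 := ⟨by linarith, by linarith⟩
    refine close (X := fun t => lapFD h (Φ t) x y) (Y := fun t => lap (Φ t) x y)
      ?_ (cl x hy) hC4 (sq_nonneg h) (fun t ht => ht.smooth.lapFD_self hh x hm hp) t ht
    exact (continuousOn_diff2 (F := fun t x' => Φ t x' y) (cu _ hy) (cu _ hy) (cu _ hy)).add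
      (continuousOn_diff2 (F := fun t y' => Φ t x y')
        (cu _ ⟨by linarith, hp⟩) (cu _ hy) (cu _ ⟨hm, by linarith⟩))
  case diff2_self =>
    intro t ht h hh x y hy
    exact close (X := fun t => diff2 h (fun x' => Φ t x' y) x) (Y := fun t => pd 2 0 (Φ t) x y)
      (continuousOn_diff2 (F := fun t x' => Φ t x' y) (cu _ hy) (cu _ hy) (cu _ hy)) (cp (by omega) x hy) hC2
      (sq_nonneg h) (fun t ht => ht.smooth.diff2_x hh x hy) t ht
  case lapBd_self =>
    intro t ht h hh h1 x σ y hσ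
    obtain ⟨e1, hy, e2⟩ := hnb hh h1 hσ
    refine close (X := fun t => lapBd h σ y (Φ t) x - lap (Φ t) x y)
      (Y := fun t => 2 / h * σ * pd 0 1 (Φ t) x y) ?_ (continuousOn_const.mul (cp (a := 0) (b := 1) (by omega) x hy)) hC4 hh.le
      (fun t ht => ht.smooth.lapBd_self hh h1 e1 x hy e2) t ht
    exact ((continuousOn_diff2 (F := fun t x' => Φ t x' y) (cu _ hy) (cu _ hy) (cu _ hy)).add
        (continuousOn_const.mul ((cu _ e2).sub (cu _ hy)))).sub (cl x hy)
  case partialSum_self =>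
    intro t ht K hK x y hy
    refine close (X := fun t => partialSum K (fun x' => Φ t x' y) x) (Y := fun t => Φ t x y)
      (continuousOn_partialSum (L := 1) huc (fun t ht => hreg.continuous_x ht hy)
      (fun s hs t ht x hx => by rw [one_mul]; exact hub s hs t ht x hx y hy) K x) (cu x hy) hCF
      (sq_nonneg _) (fun t ht => ht.smooth.partialSum_self hK x hy) t ht
  case partialSum_logPart =>
    intro t ht K hK x y hy
    refine close (X := fun t => partialSum K (fun x' => logPart (Φ t x' y)) x)
      (Y := fun t => logPart (Φ t x y)) (continuousOn_partialSum (L := 2 / ε₀) huc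
      (fun t ht => hreg.continuous_logPart hε₀ hsep ht hy)
      (fun s hs t ht x hx => (logPart_sub_le hε₀ (hsep s hs x y hy) (hsep t ht x y hy)).trans
        (mul_le_mul_of_nonneg_left (hub s hs t ht x hx y hy) (by positivity))) K x) ?_ hCL
      (sq_nonneg _) (fun t ht => ht.smooth.partialSum_logPart hε₀ hK x hy) t ht
    intro r hr
    have := hsep.pos hε₀ hr x hy
    exact (continuousAt_logPart this.1 this.2).comp_continuousWithinAt
      (f := fun t => Φ t x y) (cu x hy r hr)
  case mass_bot =>
    refine fun t ht => integral_row_eq hT hu huv hy0 (hB.mono fun t ht => ?_) ht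
    refine Eq.trans ?_
      (ht.smooth.integral_surfChain (ε := ε) (κ := κ) (θ₀ := θ₀) hε₀ (-1) hy0)
    exact intervalIntegral.integral_congr fun x hx => by
      rw [Set.uIcc_of_le zero_le_one] at hx
      exact ht.bot x hx
  case mass_top =>
    refine fun t ht => integral_row_eq hT hu huv hy1 (hB.mono fun t ht => ?_) ht
    refine Eq.trans ?_
      (ht.smooth.integral_surfChain (ε := ε) (κ := κ) (θ₀ := θ₀) hε₀ 1 hy1)
    exact intervalIntegral.integral_congr fun x hx => by
      rw [Set.uIcc_of_le zero_le_one] at hx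
      exact ht.top x hx

end

/-! ### The Fourier projection and the discrete operators -/

section

variable {K : ℕ}

/-- The discrete `ℓ²` norm of a row is at most `a`. -/
def RowLe (f : BdGrid K) (a : ℝ) : Prop := 0 ≤ a ∧ bdIp f f ≤ a ^ 2

theorem RowLe.add {f g : BdGrid K} {a b : ℝ} (hf : RowLe f a) (hg : RowLe g b) :
    RowLe (fun i => f i + g i) (a + b) :=
  ⟨add_nonneg hf.1 hg.1, bdIp_add_self_le hf.1 hg.1 hf.2 hg.2⟩

theorem RowLe.smul {f : BdGrid K} {a : ℝ} (hf : RowLe f a) (c : ℝ) :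
    RowLe (fun i => c * f i) (|c| * a) :=
  ⟨mul_nonneg (abs_nonneg _) hf.1, bdIp_smul_self_le hf.2⟩

theorem RowLe.mono {f : BdGrid K} {a b : ℝ} (hf : RowLe f a) (h : a ≤ b) : RowLe f b :=
  ⟨hf.1.trans h, hf.2.trans (pow_le_pow_left₀ hf.1 h 2)⟩

theorem RowLe.of_abs_le {f : BdGrid K} {a : ℝ} (h : ∀ i, |f i| ≤ a) : RowLe f a :=
  ⟨(abs_nonneg _).trans (h 0), bdIp_self_le_of_abs_le h⟩

theorem RowLe.rowProj {g : ℝ → ℝ} {a : ℝ} (hg : Continuous g)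
    (h : ∀ x ∈ Set.Icc (0 : ℝ) 1, |g x| ≤ a) : RowLe (rowProj K g) a :=
  ⟨(abs_nonneg _).trans (h 0 ⟨le_rfl, zero_le_one⟩), bdIp_rowProj_le K hg.continuousOn h⟩

theorem RowLe.congr {f g : BdGrid K} {a : ℝ} (hf : RowLe f a) (h : ∀ i, g i = f i) : RowLe g a := by
  rwa [funext h]

theorem RowLe.abs_bdMean_le {f : BdGrid K} {a : ℝ} (hf : RowLe f a) : |bdMean f| ≤ a := by
  have := abs_bdIp_le (g := fun _ : ZMod (cells K) => (1 : ℝ)) hf.1 zero_le_one hf.2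
    (bdIp_self_le_of_abs_le fun _ => by simp)
  rwa [mul_one] at this

/-- Grid values of the Fourier projection in `x`. -/
noncomputable def projGrid (K : ℕ) (f : ℝ → ℝ → ℝ) : Grid K :=
  fun i j => rowProj K (fun x => f x (j * mesh K)) i

theorem rowProj_diff2 {g : ℝ → ℝ} (hg : Continuous g) (hp : Function.Periodic g 1)
    (i : ZMod (cells K)) : rowProj K (diff2 (mesh K) g) i = bdD2x (rowProj K g) i := by
  have e : diff2 (mesh K) g = fun x => (1 / mesh K ^ 2) *
      ((g (x + mesh K) - 2 * g x) + g (x - mesh K)) := by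
    funext x; unfold diff2; ring
  have c1 : Continuous fun x => g (x + mesh K) := hg.comp (by fun_prop)
  have c2 : Continuous fun x => g (x - mesh K) := hg.comp (by fun_prop)
  have c3 : Continuous fun x => 2 * g x := continuous_const.mul hg
  rw [e, rowProj_smul, rowProj_add K (f := fun x => g (x + mesh K) - 2 * g x)
    (c1.sub c3).continuousOn c2.continuousOn,
    rowProj_sub K c1.continuousOn c3.continuousOn, rowProj_smul, rowProj_shift K hp,
    rowProj_shift_neg K hp, bdD2x]
  ring

theorem continuous_diff2 {g : ℝ → ℝ} (hg : Continuous g) (h : ℝ) : Continuous (diff2 h g) := by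
  unfold diff2
  have c1 : Continuous fun x => g (x + h) := hg.comp (by fun_prop)
  have c2 : Continuous fun x => g (x - h) := hg.comp (by fun_prop)
  exact ((c1.sub (continuous_const.mul hg)).add c2).div_const _

theorem row_mem {j : ℕ} (hj : j ≤ cells K) : (j : ℝ) * mesh K ∈ Set.Icc (0 : ℝ) 1 := by
  refine ⟨mul_nonneg (Nat.cast_nonneg j) (mesh_pos K).le, ?_⟩
  rw [← mesh_mul_cells K, mul_comm (mesh K)]
  exact mul_le_mul_of_nonneg_right (by exact_mod_cast hj) (mesh_pos K).le

theorem cells_mul_mesh (K : ℕ) : (cells K : ℝ) * mesh K = 1 := by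
  rw [mul_comm, mesh_mul_cells]

/-- Functions that are continuous and periodic on every horizontal line of the strip. -/
structure RowRegular (f : ℝ → ℝ → ℝ) : Prop where
  cont : ∀ y ∈ Set.Icc (0 : ℝ) 1, Continuous fun x => f x y
  per : ∀ y ∈ Set.Icc (0 : ℝ) 1, Function.Periodic (fun x => f x y) 1

variable {f : ℝ → ℝ → ℝ}

theorem RowRegular.continuous_lapFD (hf : RowRegular f) {h y : ℝ} (hy : y ∈ Set.Icc (0 : ℝ) 1)
    (hyp : y + h ∈ Set.Icc (0 : ℝ) 1) (hym : y - h ∈ Set.Icc (0 : ℝ) 1) :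
    Continuous fun x => lapFD h f x y :=
  (continuous_diff2 (hf.cont y hy) h).add
    ((((hf.cont _ hyp).sub (continuous_const.mul (hf.cont y hy))).add (hf.cont _ hym)).div_const _)

theorem RowRegular.continuous_lapBd (hf : RowRegular f) {h σ y : ℝ} (hy : y ∈ Set.Icc (0 : ℝ) 1)
    (hyp : y + σ * h ∈ Set.Icc (0 : ℝ) 1) : Continuous (lapBd h σ y f) :=
  (continuous_diff2 (hf.cont y hy) h).add
    (continuous_const.mul ((hf.cont _ hyp).sub (hf.cont y hy)))

theorem inner_row {j : ℕ} (h0 : j ≠ 0) (hN : j < cells K) :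
    0 ≤ (j : ℝ) * mesh K - mesh K ∧ (j : ℝ) * mesh K + mesh K ≤ 1 := by
  have h := mesh_pos K
  have h1 : (1 : ℝ) ≤ j := by exact_mod_cast Nat.one_le_iff_ne_zero.2 h0
  have h2 : (j : ℝ) + 1 ≤ cells K := by exact_mod_cast hN
  constructor
  · nlinarith
  · have := cells_mul_mesh K
    nlinarith

/-- The projection acts only in `x` and commutes with shifts by `h`. Hence the discrete Laplacian of
a projected function is the projection of its finite-difference Laplacian, and pointwise truncation
estimates become row estimates. -/
theorem RowRegular.neg_negLap_projGrid (hf : RowRegular f) (i : ZMod (cells K)) {j : ℕ}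
    (h0 : j ≠ 0) (hN : j < cells K) :
    -negLap (projGrid K f) i j = rowProj K (fun x => lapFD (mesh K) f x (j * mesh K)) i := by
  obtain ⟨hm, hpl⟩ := inner_row h0 hN
  have hpos := mesh_pos K
  have hy : (j : ℝ) * mesh K ∈ Set.Icc (0 : ℝ) 1 := row_mem hN.le
  have hyp : (j : ℝ) * mesh K + mesh K ∈ Set.Icc (0 : ℝ) 1 := ⟨by linarith [hy.1], hpl⟩
  have hym : (j : ℝ) * mesh K - mesh K ∈ Set.Icc (0 : ℝ) 1 := ⟨hm, by linarith [hy.2]⟩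
  have e : (fun x => lapFD (mesh K) f x (j * mesh K)) = fun x =>
      diff2 (mesh K) (fun x' => f x' (j * mesh K)) x + (1 / mesh K ^ 2) *
      ((f x (j * mesh K + mesh K) - 2 * f x (j * mesh K)) + f x (j * mesh K - mesh K)) := by
    funext x
    rw [lapFD, diff2.eq_1 (mesh K) (fun y' => f x y')]
    ring
  have c0 := hf.cont _ hy
  have cp := hf.cont _ hyp
  have cm := hf.cont _ hym
  have c2 : Continuous fun x => 2 * f x (j * mesh K) := continuous_const.mul c0
  have c3 : Continuous fun x => (1 / mesh K ^ 2) *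
      ((f x (j * mesh K + mesh K) - 2 * f x (j * mesh K)) + f x (j * mesh K - mesh K)) :=
    continuous_const.mul ((cp.sub c2).add cm)
  rw [e, rowProj_add K (continuous_diff2 c0 _).continuousOn c3.continuousOn,
    rowProj_diff2 c0 (hf.per _ hy), rowProj_smul,
    rowProj_add K (f := fun x => f x (j * mesh K + mesh K) - 2 * f x (j * mesh K))
    (cp.sub c2).continuousOn cm.continuousOn,
    rowProj_sub K cp.continuousOn c2.continuousOn, rowProj_smul]
  have h0' : (j : ℤ) ≠ 0 := by omega
  have hN' : (j : ℤ) ≠ cells K := by omega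
  rw [negLap, if_neg h0', if_neg hN', lapH, D2x, D2y, bdD2x]
  have ep : ((j : ℝ) + 1) * mesh K = j * mesh K + mesh K := by ring
  have em : ((j : ℝ) - 1) * mesh K = j * mesh K - mesh K := by ring
  simp only [projGrid, Int.cast_add, Int.cast_sub, Int.cast_one, Int.cast_natCast, ep, em]
  ring

theorem RowRegular.rowProj_lapBd (hf : RowRegular f) (i : ZMod (cells K)) {σ y : ℝ}
    (hy : y ∈ Set.Icc (0 : ℝ) 1) (hyp : y + σ * mesh K ∈ Set.Icc (0 : ℝ) 1) :
    rowProj K (lapBd (mesh K) σ y f) i = bdD2x (rowProj K fun x => f x y) i +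
      2 / mesh K ^ 2 * (rowProj K (fun x => f x (y + σ * mesh K)) i
        - rowProj K (fun x => f x y) i) := by
  have c0 := hf.cont _ hy
  have cp := hf.cont _ hyp
  have e : lapBd (mesh K) σ y f = fun x => diff2 (mesh K) (fun x' => f x' y) x +
      2 / mesh K ^ 2 * (f x (y + σ * mesh K) - f x y) := rfl
  have c3 : Continuous fun x => 2 / mesh K ^ 2 * (f x (y + σ * mesh K) - f x y) :=
    continuous_const.mul (cp.sub c0)
  rw [e, rowProj_add K (continuous_diff2 c0 _).continuousOn c3.continuousOn,
    rowProj_diff2 c0 (hf.per _ hy), rowProj_smul, rowProj_sub K cp.continuousOn c0.continuousOn]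

theorem mesh_le_one (K : ℕ) : mesh K ≤ 1 := by
  have h := mesh_mul_cells K
  have h1 : (1 : ℝ) ≤ cells K := by exact_mod_cast Nat.succ_le_succ (Nat.zero_le (2 * K))
  nlinarith [mesh_pos K]

theorem RowRegular.neg_negLap_projGrid_bot (hf : RowRegular f) (i : ZMod (cells K)) :
    -negLap (projGrid K f) i 0 = rowProj K (lapBd (mesh K) 1 0 f) i := by
  have := mesh_pos K
  have := mesh_le_one K
  rw [hf.rowProj_lapBd i ⟨le_rfl, zero_le_one⟩ ⟨by linarith, by linarith⟩]
  simp only [negLap, if_true, D2x, bdD2x, projGrid, Int.cast_zero, Int.cast_one, zero_mul, one_mul,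
    zero_add]
  ring

theorem RowRegular.neg_negLap_projGrid_top (hf : RowRegular f) (i : ZMod (cells K)) :
    -negLap (projGrid K f) i (cells K) = rowProj K (lapBd (mesh K) (-1) 1 f) i := by
  have := mesh_pos K
  have := mesh_le_one K
  rw [hf.rowProj_lapBd i ⟨zero_le_one, le_rfl⟩ ⟨by linarith, by linarith⟩]
  have h0 : ((cells K : ℕ) : ℤ) ≠ 0 := by simp only [cells]; omega
  rw [negLap, if_neg h0, if_pos rfl]
  have e : ((cells K : ℝ) - 1) * mesh K = 1 + -1 * mesh K := by
    rw [sub_mul, cells_mul_mesh]; ring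
  simp only [D2x, bdD2x, projGrid, Int.cast_sub, Int.cast_one, Int.cast_natCast, cells_mul_mesh, e]
  ring

/-! ### The profile of the mass correction -/

/-- Row values of the profile `1 - cos 2πy`. -/
noncomputable def cosRow (K : ℕ) (j : ℤ) : ℝ := 1 - Real.cos (2 * Real.pi * (j * mesh K))

theorem cosRow_zero (K : ℕ) : cosRow K 0 = 0 := by simp [cosRow]

theorem cosRow_cells (K : ℕ) : cosRow K (cells K) = 0 := by
  rw [cosRow, Int.cast_natCast, cells_mul_mesh, mul_one, Real.cos_two_pi, sub_self]

theorem abs_cosRow_le (K : ℕ) (j : ℤ) : |cosRow K j| ≤ 2 := by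
  unfold cosRow
  rw [abs_le]
  constructor <;> linarith [Real.cos_le_one (2 * Real.pi * (j * mesh K)),
    Real.neg_one_le_cos (2 * Real.pi * (j * mesh K))]

theorem one_sub_cos_mesh_le (K : ℕ) : 1 - Real.cos (2 * Real.pi * mesh K) ≤ 20 * mesh K ^ 2 := by
  have h1 := Real.one_sub_sq_div_two_le_cos (x := 2 * Real.pi * mesh K)
  -- From `1 - cos x ≤ x²/2` with `x = 2πh` the bound is `2π²h²`, hence the constant `20`.
  have h2 : Real.pi ^ 2 ≤ 10 := by nlinarith [Real.pi_lt_d2, Real.pi_pos]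
  nlinarith [sq_nonneg (mesh K)]

theorem abs_cosRow_one_le (K : ℕ) : |cosRow K 1| ≤ 20 * mesh K ^ 2 := by
  have h := one_sub_cos_mesh_le K
  have h1 : cosRow K 1 = 1 - Real.cos (2 * Real.pi * mesh K) := by simp [cosRow]
  rw [h1, abs_of_nonneg (by linarith [Real.cos_le_one (2 * Real.pi * mesh K)])]
  exact h

theorem abs_cosRow_cells_sub_one_le (K : ℕ) : |cosRow K ((cells K : ℤ) - 1)| ≤ 20 * mesh K ^ 2 := by
  have h1 : cosRow K ((cells K : ℤ) - 1) = cosRow K 1 := by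
    simp only [cosRow, Int.cast_sub, Int.cast_natCast, Int.cast_one, one_mul]
    rw [sub_mul, cells_mul_mesh, one_mul, mul_sub, mul_one, Real.cos_two_pi_sub]
  rw [h1]
  exact abs_cosRow_one_le K

theorem abs_diff_cosRow_le (K : ℕ) (j : ℤ) :
    |(cosRow K (j + 1) - 2 * cosRow K j + cosRow K (j - 1)) / mesh K ^ 2| ≤ 40 := by
  have hm := mesh_pos K
  have e : cosRow K (j + 1) - 2 * cosRow K j + cosRow K (j - 1) =
      2 * Real.cos (2 * Real.pi * (j * mesh K)) * (1 - Real.cos (2 * Real.pi * mesh K)) := by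
    simp only [cosRow, Int.cast_sub, Int.cast_add, Int.cast_one]
    rw [show 2 * Real.pi * (((j : ℝ) + 1) * mesh K) =
      2 * Real.pi * (j * mesh K) + 2 * Real.pi * mesh K by ring,
      show 2 * Real.pi * (((j : ℝ) - 1) * mesh K) =
      2 * Real.pi * (j * mesh K) - 2 * Real.pi * mesh K by ring, Real.cos_add, Real.cos_sub]
    ring
  rw [e, abs_div, abs_of_pos (pow_pos hm 2), div_le_iff₀ (pow_pos hm 2), abs_mul, abs_mul,
    abs_of_nonneg (a := 1 - Real.cos (2 * Real.pi * mesh K))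
      (by linarith [Real.cos_le_one (2 * Real.pi * mesh K)]), abs_two]
  have h1 := Real.abs_cos_le_one (2 * Real.pi * (j * mesh K))
  have h2 := one_sub_cos_mesh_le K
  have h3 : 0 ≤ 1 - Real.cos (2 * Real.pi * mesh K) := by
    linarith [Real.cos_le_one (2 * Real.pi * mesh K)]
  nlinarith [abs_nonneg (Real.cos (2 * Real.pi * (j * mesh K)))]

/-- The cosines are real parts of the `N`-th roots of unity, whose sum vanishes for `N > 1`; the
half weights do not matter because the profile vanishes on the boundary rows. Unit mean makes the
mass correction exact. -/
theorem mean_cosRow (hK : 1 ≤ K) : mean (fun _ j => cosRow K j : Grid K) = 1 := by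
  rw [mean_eq_rowSum]
  simp only [bdMean_const]
  unfold rowSum
  have h1 : ∀ j ∈ range (cells K + 1), wt K j * cosRow K (j : ℕ) = cosRow K (j : ℕ) := by
    intro j _
    unfold wt
    split_ifs with h
    · rcases h with rfl | rfl
      · rw [Nat.cast_zero, cosRow_zero, mul_zero]
      · rw [cosRow_cells, mul_zero]
    · rw [one_mul]
  rw [sum_congr rfl h1, sum_range_succ, cosRow_cells, add_zero]
  have h2 := (Complex.isPrimitiveRoot_exp (cells K) (by simp [cells])).geom_sum_eq_zero
    (by simp only [cells]; omega)
  have h3 : ∑ j ∈ range (cells K), Real.cos (2 * Real.pi * (((j : ℕ) : ℝ) * mesh K)) = 0 := by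
    have := congrArg Complex.re h2
    rw [Complex.re_sum, Complex.zero_re] at this
    rw [← this]
    refine sum_congr rfl fun j _ => ?_
    rw [← Complex.exp_nat_mul, show (j : ℂ) * (2 * Real.pi * Complex.I / (cells K : ℕ)) =
      ((2 * Real.pi * ((j : ℝ) * mesh K) : ℝ) : ℂ) * Complex.I by
        unfold mesh; push_cast; ring, Complex.exp_ofReal_mul_I_re]
  simp only [cosRow, Int.cast_natCast, sum_sub_distrib, h3, sum_const, card_range, nsmul_eq_mul,
    mul_one, sub_zero, mesh_mul_cells]

/-! ### The corrected solution -/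

/-- The deviation of the discrete mass of the projected solution from its initial value. -/
noncomputable def massDefect (K : ℕ) (Φ : ℝ → ℝ → ℝ → ℝ) (t : ℝ) : ℝ :=
  mean (projGrid K (Φ t)) - mean (projGrid K (Φ 0))

/-- Holds by unfolding: `sample` evaluates at exactly the points `xpt K i` and `j * mesh K` used by
`projGrid`. -/
theorem corrected_apply (K : ℕ) (Φ : ℝ → ℝ → ℝ → ℝ) (t : ℝ) (i : ZMod (cells K)) (j : ℤ) :
    corrected K Φ t i j = projGrid K (Φ t) i j - massDefect K Φ t * cosRow K j := rfl

theorem mean_sub_smul (f g : Grid K) (c : ℝ) :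
    mean (fun i j => f i j - c * g i j) = mean f - c * mean g := by
  have := mean_add f (fun i j => (-c) * g i j)
  rw [mean_smul] at this
  simp only [neg_mul, ← sub_eq_add_neg] at this
  exact this

theorem mean_corrected (hK : 1 ≤ K) (Φ : ℝ → ℝ → ℝ → ℝ) (t : ℝ) :
    mean (corrected K Φ t) = mean (projGrid K (Φ 0)) := by
  have : corrected K Φ t = fun i j => projGrid K (Φ t) i j -
      massDefect K Φ t * (fun _ j => cosRow K j : Grid K) i j := rfl
  rw [this, mean_sub_smul, mean_cosRow hK, massDefect]
  ring

theorem bot_corrected (Φ : ℝ → ℝ → ℝ → ℝ) (t : ℝ) :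
    bot (corrected K Φ t) = rowProj K fun x => Φ t x 0 := by
  funext i
  rw [bot, corrected_apply, cosRow_zero, mul_zero, sub_zero, projGrid]
  simp

theorem top_corrected (Φ : ℝ → ℝ → ℝ → ℝ) (t : ℝ) :
    top (corrected K Φ t) = rowProj K fun x => Φ t x 1 := by
  funext i
  rw [top, corrected_apply, cosRow_cells, mul_zero, sub_zero, projGrid]
  simp only [Int.cast_natCast, cells_mul_mesh]

theorem negLap_corrected (Φ : ℝ → ℝ → ℝ → ℝ) (t : ℝ) (i : ZMod (cells K)) (j : ℤ) :
    negLap (corrected K Φ t) i j = negLap (projGrid K (Φ t)) i j -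
      massDefect K Φ t * negLap (fun _ j => cosRow K j) i j := by
  rw [← negLap_smul (massDefect K Φ t) (fun _ j => cosRow K j), ← negLap_sub]
  rfl

theorem abs_negLap_cosRow_le (i : ZMod (cells K)) {j : ℕ} (h0 : j ≠ 0) (hN : j < cells K) :
    |negLap (fun _ j => cosRow K j) i j| ≤ 40 := by
  have h0' : (j : ℤ) ≠ 0 := by omega
  have hN' : (j : ℤ) ≠ cells K := by omega
  rw [negLap, if_neg h0', if_neg hN', abs_neg, lapH, D2x, D2y]
  refine le_trans (le_of_eq ?_) (abs_diff_cosRow_le K j)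
  congr 1
  ring

/-- The profile has zero slope at the boundary, so it is of size `h²` on the neighbouring row. The
mass correction therefore does not spoil the ghost flux. -/
theorem abs_half_mesh_negLap_cosRow_le (i : ZMod (cells K)) {j : ℤ} (hj : j = 0 ∨ j = cells K) :
    |mesh K / 2 * negLap (fun _ j => cosRow K j) i j| ≤ 20 := by
  have hm := mesh_pos K
  have hm1 := mesh_le_one K
  have key : ∀ c : ℝ, |c| ≤ 20 * mesh K ^ 2 → |mesh K / 2 * (-2 * (c / mesh K ^ 2))| ≤ 20 := by
    intro c hc
    have e : mesh K / 2 * (-2 * (c / mesh K ^ 2)) = -(c / mesh K) := by field_simp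
    rw [e, abs_neg, abs_div, abs_of_pos hm, div_le_iff₀ hm]
    nlinarith
  rcases hj with rfl | rfl
  · have e : negLap (fun _ j => cosRow K j) i 0 = -2 * (cosRow K 1 / mesh K ^ 2) := by
      simp only [negLap, if_true, D2x, cosRow_zero]; ring
    rw [e]
    exact key _ (abs_cosRow_one_le K)
  · have h0 : ((cells K : ℕ) : ℤ) ≠ 0 := by simp only [cells]; omega
    have e : negLap (fun _ j => cosRow K j) i (cells K) =
        -2 * (cosRow K ((cells K : ℤ) - 1) / mesh K ^ 2) := by
      rw [negLap, if_neg h0, if_pos rfl]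
      simp only [D2x, cosRow_cells]; ring
    rw [e]
    exact key _ (abs_cosRow_cells_sub_one_le K)

end

/-! ### Residuals of the corrected solution -/

section

variable {ε κ θ₀ T ε₀ C : ℝ} {Φ : ℝ → ℝ → ℝ → ℝ} {p q : ℝ → ℝ} {K : ℕ}

theorem Consistent.const_nonneg (hC : Consistent ε κ θ₀ T C Φ p q) (hT : 0 < T) : 0 ≤ C := by
  have := hC.p_le 0 ⟨le_rfl, hT.le⟩
  rwa [hC.p_zero] at this

theorem ClassR.rowRegular (hreg : ClassR T Φ) {t : ℝ} (ht : t ∈ Set.Icc 0 T) : RowRegular (Φ t) :=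
  ⟨fun _ hy => hreg.continuous_x ht hy, fun _ hy x => hreg.periodic t ht x _ hy⟩

theorem ClassR.rowRegular_bulkPot (hreg : ClassR T Φ) (hε₀ : 0 < ε₀) (hsep : Separated T ε₀ Φ)
    {t : ℝ} (ht : t ∈ Set.Icc 0 T) : RowRegular (bulkPot ε θ₀ (Φ t)) :=
  ⟨fun _ hy => hreg.continuous_bulkPot hε₀ hsep ht hy, fun _ hy => hreg.periodic_bulkPot ht hy⟩

theorem projGrid_natCast (f : ℝ → ℝ → ℝ) (i : ZMod (cells K)) (j : ℕ) :
    projGrid K f i j = rowProj K (fun x => f x (j * mesh K)) i := by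
  simp only [projGrid, Int.cast_natCast]

theorem projGrid_zero (f : ℝ → ℝ → ℝ) (i : ZMod (cells K)) :
    projGrid K f i 0 = rowProj K (fun x => f x 0) i := by
  simp only [projGrid, Int.cast_zero, zero_mul]

theorem projGrid_cells (f : ℝ → ℝ → ℝ) (i : ZMod (cells K)) :
    projGrid K f i (cells K) = rowProj K (fun x => f x 1) i := by
  rw [projGrid_natCast, cells_mul_mesh]

theorem rowProj_sub_div {f g k : ℝ → ℝ} (hf : Continuous f) (hg : Continuous g)
    (hk : Continuous k) (d : ℝ) (i : ZMod (cells K)) :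
    rowProj K (fun x => f x - (g x - k x) / d) i =
      rowProj K f i - (rowProj K g i - rowProj K k i) / d := by
  have e : (fun x => f x - (g x - k x) / d) = fun x => f x - d⁻¹ * (g x - k x) := by
    funext x; ring
  have c : Continuous fun x => d⁻¹ * (g x - k x) := continuous_const.mul (hg.sub hk)
  rw [e, rowProj_sub K hf.continuousOn c.continuousOn, rowProj_smul,
    rowProj_sub K hg.continuousOn hk.continuousOn]
  ring

/-- The pointwise residual of the exact solution is projected row by row. Its order drops to `h` on
the two boundary rows. -/
theorem Consistent.bulk_row (hC : Consistent ε κ θ₀ T C Φ p q) (hε₀ : 0 < ε₀)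
    (hreg : ClassR T Φ) (hsep : Separated T ε₀ Φ) {s t : ℝ} (hs : s ∈ Set.Icc 0 T)
    (ht : t ∈ Set.Icc 0 T) (hst : s < t) {j : ℕ} (hj : j ≤ cells K) :
    RowLe (fun i => -negLap (projGrid K (bulkPot ε θ₀ (Φ t))) i j -
      (projGrid K (Φ t) i j - projGrid K (Φ s) i j) / (t - s))
      (if j = 0 ∨ j = cells K then C * mesh K + (p t - p s)
        else C * mesh K ^ 2 + (p t - p s)) := by
  have hm := mesh_pos K
  have hm1 := mesh_le_one K
  have hb := hreg.rowRegular_bulkPot (ε := ε) (θ₀ := θ₀) hε₀ hsep ht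
  have cont : ∀ {D : ℝ → ℝ} {y : ℝ}, Continuous D → y ∈ Set.Icc (0 : ℝ) 1 →
      Continuous fun x => D x - (Φ t x y - Φ s x y) / (t - s) := fun hD hy =>
    hD.sub (((hreg.continuous_x ht hy).sub (hreg.continuous_x hs hy)).div_const _)
  have hy0 : (0 : ℝ) ∈ Set.Icc (0 : ℝ) 1 := ⟨le_rfl, zero_le_one⟩
  have hy1 : (1 : ℝ) ∈ Set.Icc (0 : ℝ) 1 := ⟨zero_le_one, le_rfl⟩
  by_cases h0 : j = 0
  · subst h0
    rw [if_pos (Or.inl rfl)]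
    have cD := hb.continuous_lapBd (h := mesh K) (σ := 1) hy0 ⟨by linarith, by linarith⟩
    refine (RowLe.rowProj (cont cD hy0) fun x hx =>
      hC.bulk_bd s hs t ht hst _ hm hm1 x hx 1 0 (Or.inl ⟨rfl, rfl⟩)).congr fun i => ?_
    rw [Nat.cast_zero, hb.neg_negLap_projGrid_bot, projGrid_zero, projGrid_zero,
      rowProj_sub_div cD (hreg.continuous_x ht hy0) (hreg.continuous_x hs hy0)]
  by_cases hN : j = cells K
  · subst hN
    rw [if_pos (Or.inr rfl)]
    have cD := hb.continuous_lapBd (h := mesh K) (σ := -1) hy1 ⟨by linarith, by linarith⟩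
    refine (RowLe.rowProj (cont cD hy1) fun x hx =>
      hC.bulk_bd s hs t ht hst _ hm hm1 x hx (-1) 1 (Or.inr ⟨rfl, rfl⟩)).congr fun i => ?_
    rw [hb.neg_negLap_projGrid_top, projGrid_cells, projGrid_cells,
      rowProj_sub_div cD (hreg.continuous_x ht hy1) (hreg.continuous_x hs hy1)]
  · rw [if_neg (by tauto)]
    have hlt : j < cells K := lt_of_le_of_ne hj hN
    obtain ⟨h1, h2⟩ := inner_row h0 hlt
    have hy := row_mem hj
    have cD := hb.continuous_lapFD (h := mesh K) hy ⟨by linarith, h2⟩ ⟨h1, by linarith⟩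
    refine (RowLe.rowProj (cont cD hy) fun x hx =>
      hC.bulk s hs t ht hst _ hm x hx _ h1 h2).congr fun i => ?_
    rw [hb.neg_negLap_projGrid i h0 hlt, projGrid_natCast, projGrid_natCast,
      rowProj_sub_div cD (hreg.continuous_x ht hy) (hreg.continuous_x hs hy)]

theorem abs_rowSum_le {a b : ℕ → ℝ} (h : ∀ j ≤ cells K, |a j| ≤ b j) :
    |rowSum K a| ≤ rowSum K b := by
  have h1 := rowSum_mono fun j hj => (abs_le.1 (h j hj)).2
  have h2 := rowSum_mono (K := K) (a := fun j => (-1) * b j) (b := a) fun j hj => by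
    linarith [(abs_le.1 (h j hj)).1]
  rw [rowSum_smul] at h2
  exact abs_le.2 ⟨by linarith, h1⟩

/-- The image of `L_h` has mean zero, so the mean of the bulk residual is minus the difference
quotient of the defect. The boundary rows of size `C h` have weight `h/2` each and add one more `C
h²`. -/
theorem Consistent.massDefect_increment (hC : Consistent ε κ θ₀ T C Φ p q) (hε₀ : 0 < ε₀)
    (hT : 0 < T) (hreg : ClassR T Φ) (hsep : Separated T ε₀ Φ) {s t : ℝ} (hs : s ∈ Set.Icc 0 T)
    (ht : t ∈ Set.Icc 0 T) (hst : s < t) :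
    |massDefect K Φ t - massDefect K Φ s| ≤ (t - s) * (2 * C * mesh K ^ 2 + (p t - p s)) := by
  have hpos : 0 < t - s := sub_pos.2 hst
  have hC0 := hC.const_nonneg hT
  have hm := mesh_pos K
  have hm1 := mesh_le_one K
  set ν := projGrid K (bulkPot ε θ₀ (Φ t)) with hν
  set F : Grid K := fun i j => -negLap ν i j -
    (projGrid K (Φ t) i j - projGrid K (Φ s) i j) / (t - s) with hF
  have h1 : mean F = -((massDefect K Φ t - massDefect K Φ s) / (t - s)) := by
    have e : F = fun i j => (-1) * negLap ν i j + (fun i j => (-(t - s)⁻¹) * projGrid K (Φ t) i j +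
        (t - s)⁻¹ * projGrid K (Φ s) i j : Grid K) i j := by
      funext i j; simp only [hF]; ring
    rw [e, mean_add (fun i j => (-1) * negLap ν i j), mean_smul, mean_negLap,
      mean_add (fun i j => (-(t - s)⁻¹) * projGrid K (Φ t) i j), mean_smul, mean_smul,
      massDefect, massDefect]
    ring
  have h2 : |mean F| ≤ 2 * C * mesh K ^ 2 + (p t - p s) := by
    rw [mean_eq_rowSum]
    refine (abs_rowSum_le (b := fun j => (C * mesh K ^ 2 + (p t - p s)) +
      (if j = 0 then C * mesh K else if j = cells K then C * mesh K else 0)) fun j hj => ?_).trans ?_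
    · refine (hC.bulk_row hε₀ hreg hsep hs ht hst hj).abs_bdMean_le.trans ?_
      have h3 : 0 ≤ C * mesh K ^ 2 := by positivity
      by_cases h0 : j = 0
      · simp only [h0, true_or, if_true]; linarith
      by_cases hN : j = cells K
      · rw [if_pos (Or.inr hN), if_neg h0, if_pos hN]; linarith
      · rw [if_neg (by tauto), if_neg h0, if_neg hN]; linarith
    · rw [rowSum_add (fun _ => C * mesh K ^ 2 + (p t - p s)), rowSum_const, rowSum_ends]
      apply le_of_eq
      ring
  rw [h1, abs_neg, abs_div, abs_of_pos hpos, div_le_iff₀' hpos] at h2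
  exact h2

/-- Both the projected logarithm and the logarithm of `U` are compared with the logarithm of the
exact solution. The smallness `b ≤ ε₀/2` keeps `U` at distance `ε₀/2` from `±1`, where the Lipschitz
constant is `4/ε₀`. -/
theorem Consistent.logPart_row (hC : Consistent ε κ θ₀ T C Φ p q) (hε₀ : 0 < ε₀)
    (hsep : Separated T ε₀ Φ) (hK : 1 ≤ K) {t : ℝ}
    (ht : t ∈ Set.Icc 0 T) {y b : ℝ} (hy : y ∈ Set.Icc (0 : ℝ) 1) {U : BdGrid K}
    (hU : ∀ i, |U i - Φ t (xpt K i) y| ≤ b) (hb : b ≤ ε₀ / 2) :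
    RowLe (fun i => rowProj K (fun x => logPart (Φ t x y)) i - logPart (U i))
      (C * mesh K ^ 2 + 4 / ε₀ * b) := by
  refine RowLe.of_abs_le fun i => (abs_sub_le _ (logPart (Φ t (xpt K i) y)) _).trans
    (add_le_add (hC.partialSum_logPart t ht K hK (xpt K i) y hy) ?_)
  have h1 := hsep t ht (xpt K i) y hy
  have h2 := abs_le.1 (hU i)
  refine (logPart_sub_le (half_pos hε₀) ⟨by linarith [h1.1], by linarith [h1.2]⟩
    ⟨by linarith [h1.1], by linarith [h1.2]⟩).trans ?_
  rw [abs_sub_comm, show 2 / (ε₀ / 2) = 4 / ε₀ by field_simp; norm_num]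
  exact mul_le_mul_of_nonneg_left (hU i) (by positivity)

/-- This is the price of treating the concave term at the old time level. -/
theorem Consistent.increment_row (hC : Consistent ε κ θ₀ T C Φ p q) (hreg : ClassR T Φ) {s t : ℝ}
    (hs : s ∈ Set.Icc 0 T) (ht : t ∈ Set.Icc 0 T) (hst : s ≤ t) {y : ℝ}
    (hy : y ∈ Set.Icc (0 : ℝ) 1) :
    RowLe (fun i => rowProj K (fun x => Φ t x y) i - rowProj K (fun x => Φ s x y) i)
      (C * (t - s)) := by
  have c1 := hreg.continuous_x ht hy
  have c2 := hreg.continuous_x hs hy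
  refine (RowLe.rowProj (g := fun x => Φ t x y - Φ s x y) (c1.sub c2) fun x hx =>
    hC.lip s hs t ht hst x hx y hy).congr fun i => ?_
  rw [rowProj_sub K c1.continuousOn c2.continuousOn]

theorem Consistent.abs_corrected_sub_le (hC : Consistent ε κ θ₀ T C Φ p q) (hK : 1 ≤ K) {t : ℝ}
    (ht : t ∈ Set.Icc 0 T) (i : ZMod (cells K)) {j : ℕ} (hj : j ≤ cells K) :
    |corrected K Φ t i j - Φ t (xpt K i) (j * mesh K)| ≤
      C * mesh K ^ 2 + 2 * |massDefect K Φ t| := by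
  have h1 := hC.partialSum_self t ht K hK (xpt K i) _ (row_mem hj)
  have h2 := mul_le_mul_of_nonneg_left (abs_cosRow_le K j) (abs_nonneg (massDefect K Φ t))
  rw [corrected_apply, projGrid_natCast, rowProj]
  rw [← abs_mul] at h2
  rw [abs_le] at h1 h2 ⊢
  constructor <;> linarith [h1.1, h1.2, h2.1, h2.2]

/-- The Laplacian of the exact solution against the discrete one of the corrected solution. -/
theorem Consistent.lap_row (hC : Consistent ε κ θ₀ T C Φ p q) (hreg : ClassR T Φ) {t : ℝ}
    (ht : t ∈ Set.Icc 0 T) {j : ℕ} (h0 : j ≠ 0) (hN : j < cells K) :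
    RowLe (fun i => negLap (corrected K Φ t) i j + rowProj K (fun x => lap (Φ t) x (j * mesh K)) i)
      (C * mesh K ^ 2 + 40 * |massDefect K Φ t|) := by
  have hm := mesh_pos K
  obtain ⟨h1, h2⟩ := inner_row h0 hN
  have hy := row_mem hN.le
  have hr := hreg.rowRegular ht
  have c1 := hr.continuous_lapFD (h := mesh K) hy ⟨by linarith, h2⟩ ⟨h1, by linarith⟩
  have c2 := hreg.continuous_lap ht hy
  have r1 := (RowLe.rowProj (K := K) (g := fun x => lapFD (mesh K) (Φ t) x (j * mesh K) -
    lap (Φ t) x (j * mesh K)) (c1.sub c2) fun x _ =>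
    hC.lapFD_self t ht _ hm x _ h1 h2).smul (-1)
  have r2 := (RowLe.of_abs_le fun i => abs_negLap_cosRow_le (K := K) i h0 hN).smul
    (-massDefect K Φ t)
  refine ((r1.add r2).mono (le_of_eq ?_)).congr fun i => ?_
  · rw [abs_neg, abs_neg, abs_one]; ring
  · have e := hr.neg_negLap_projGrid i h0 hN
    rw [rowProj_sub K c1.continuousOn c2.continuousOn, negLap_corrected, ← e]
    ring

/-- The ghost value that makes the boundary Laplacian exact approximates the normal derivative. -/
theorem Consistent.normal_row (hC : Consistent ε κ θ₀ T C Φ p q) (hreg : ClassR T Φ) {t : ℝ}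
    (ht : t ∈ Set.Icc 0 T) {σ y : ℝ} {j : ℤ}
    (hσ : σ = 1 ∧ y = 0 ∧ j = 0 ∨ σ = -1 ∧ y = 1 ∧ j = cells K) :
    RowLe (fun i => mesh K / 2 * (-negLap (corrected K Φ t) i j -
        rowProj K (fun x => lap (Φ t) x y) i) - σ * rowProj K (fun x => pd 0 1 (Φ t) x y) i)
      (C * mesh K ^ 2 + 20 * |massDefect K Φ t|) := by
  have hm := mesh_pos K
  have hm1 := mesh_le_one K
  have hr := hreg.rowRegular ht
  have hσ' : σ = 1 ∧ y = 0 ∨ σ = -1 ∧ y = 1 := by tauto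
  have hj : j = 0 ∨ j = cells K := by tauto
  have hy : y ∈ Set.Icc (0 : ℝ) 1 ∧ y + σ * mesh K ∈ Set.Icc (0 : ℝ) 1 := by
    rcases hσ' with ⟨rfl, rfl⟩ | ⟨rfl, rfl⟩ <;>
      exact ⟨⟨by norm_num, by norm_num⟩, ⟨by linarith, by linarith⟩⟩
  have e : ∀ i : ZMod (cells K),
      -negLap (projGrid K (Φ t)) i j = rowProj K (lapBd (mesh K) σ y (Φ t)) i := by
    intro i
    rcases hσ with ⟨rfl, rfl, rfl⟩ | ⟨rfl, rfl, rfl⟩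
    exacts [hr.neg_negLap_projGrid_bot i, hr.neg_negLap_projGrid_top i]
  have c1 := hr.continuous_lapBd hy.1 hy.2
  have c2 := hreg.continuous_lap ht hy.1
  have c3 : Continuous fun x => 2 / mesh K * σ * pd 0 1 (Φ t) x y :=
    continuous_const.mul (hreg.continuous_pd ht (by omega) hy.1)
  -- Multiplication by `h/2` turns the boundary truncation of order `h` into order `h²` and `(2/h) σ
  -- ∂_yΦ` into `σ ∂_yΦ`.
  have r1 := (RowLe.rowProj (K := K) (g := fun x => lapBd (mesh K) σ y (Φ t) x - lap (Φ t) x y -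
    2 / mesh K * σ * pd 0 1 (Φ t) x y) ((c1.sub c2).sub c3) fun x _ =>
    hC.lapBd_self t ht _ hm hm1 x σ y hσ').smul (mesh K / 2)
  have r2 := (RowLe.of_abs_le fun i => abs_half_mesh_negLap_cosRow_le (K := K) i hj).smul
    (massDefect K Φ t)
  have hC0 : 0 ≤ C * mesh K ^ 2 := by
    have := r1.1
    rw [abs_of_pos (by positivity)] at this
    nlinarith
  refine ((r1.add r2).mono ?_).congr fun i => ?_
  · rw [abs_of_pos (half_pos hm)]
    linarith
  · rw [rowProj_sub K (f := fun x => lapBd (mesh K) σ y (Φ t) x - lap (Φ t) x y)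
      (c1.sub c2).continuousOn c3.continuousOn,
      rowProj_sub K c1.continuousOn c2.continuousOn, rowProj_smul, negLap_corrected, ← e]
    field_simp
    ring

theorem ClassR.rowProj_bulkPot (hreg : ClassR T Φ) (hε₀ : 0 < ε₀) (hsep : Separated T ε₀ Φ)
    {t : ℝ} (ht : t ∈ Set.Icc 0 T) {y : ℝ} (hy : y ∈ Set.Icc (0 : ℝ) 1) (i : ZMod (cells K)) :
    rowProj K (fun x => bulkPot ε θ₀ (Φ t) x y) i = rowProj K (fun x => logPart (Φ t x y)) i
      - θ₀ * rowProj K (fun x => Φ t x y) i - ε ^ 2 * rowProj K (fun x => lap (Φ t) x y) i := by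
  have h : (fun x => bulkPot ε θ₀ (Φ t) x y) = fun x =>
      logPart (Φ t x y) - θ₀ * Φ t x y - ε ^ 2 * lap (Φ t) x y := by
    funext x
    have := hsep.pos hε₀ ht x hy
    exact bulkPot_eq this.1 this.2
  have c1 := hreg.continuous_logPart hε₀ hsep ht hy
  have c2 : Continuous fun x => θ₀ * Φ t x y := continuous_const.mul (hreg.continuous_x ht hy)
  have c3 : Continuous fun x => ε ^ 2 * lap (Φ t) x y :=
    continuous_const.mul (hreg.continuous_lap ht hy)
  rw [h, rowProj_sub K (f := fun x => logPart (Φ t x y) - θ₀ * Φ t x y) (c1.sub c2).continuousOn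
    c3.continuousOn, rowProj_sub K c1.continuousOn c2.continuousOn, rowProj_smul, rowProj_smul]

theorem ClassR.rowProj_surfPot (hreg : ClassR T Φ) (hε₀ : 0 < ε₀) (hsep : Separated T ε₀ Φ)
    {t : ℝ} (ht : t ∈ Set.Icc 0 T) {y : ℝ} (hy : y ∈ Set.Icc (0 : ℝ) 1) (c : ℝ)
    (i : ZMod (cells K)) :
    rowProj K (fun x => logPart (Φ t x y) - θ₀ * Φ t x y - κ * ε * pd 2 0 (Φ t) x y
      - c * pd 0 1 (Φ t) x y) i = rowProj K (fun x => logPart (Φ t x y)) i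
      - θ₀ * rowProj K (fun x => Φ t x y) i - κ * ε * rowProj K (fun x => pd 2 0 (Φ t) x y) i
      - c * rowProj K (fun x => pd 0 1 (Φ t) x y) i := by
  have c1 := hreg.continuous_logPart hε₀ hsep ht hy
  have c2 : Continuous fun x => θ₀ * Φ t x y := continuous_const.mul (hreg.continuous_x ht hy)
  have c3 : Continuous fun x => κ * ε * pd 2 0 (Φ t) x y :=
    continuous_const.mul (hreg.continuous_pd ht (by omega) hy)
  have c4 : Continuous fun x => c * pd 0 1 (Φ t) x y :=
    continuous_const.mul (hreg.continuous_pd ht (by omega) hy)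
  rw [rowProj_sub K (f := fun x => logPart (Φ t x y) - θ₀ * Φ t x y - κ * ε * pd 2 0 (Φ t) x y)
    ((c1.sub c2).sub c3).continuousOn c4.continuousOn,
    rowProj_sub K (f := fun x => logPart (Φ t x y) - θ₀ * Φ t x y) (c1.sub c2).continuousOn
    c3.continuousOn, rowProj_sub K c1.continuousOn c2.continuousOn, rowProj_smul, rowProj_smul,
    rowProj_smul]

/-- The potential equation on a boundary section, up to a small residual. -/
theorem Consistent.surf_row (hC : Consistent ε κ θ₀ T C Φ p q) (hε : 0 < ε) (hκ : 0 < κ)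
    (hε₀ : 0 < ε₀) (hreg : ClassR T Φ) (hsep : Separated T ε₀ Φ) (hK : 1 ≤ K) {s t b c m : ℝ}
    (hs : s ∈ Set.Icc 0 T) (ht : t ∈ Set.Icc 0 T) (hst : s ≤ t) {y : ℝ}
    (hy : y ∈ Set.Icc (0 : ℝ) 1) {G : BdGrid K}
    (hG : RowLe (fun i => G i - rowProj K (fun x => pd 0 1 (Φ t) x y) i) m)
    (hU : ∀ i, |rowProj K (fun x => Φ t x y) i - Φ t (xpt K i) y| ≤ b) (hb : b ≤ ε₀ / 2) :
    RowLe (fun i => rowProj K (fun x => logPart (Φ t x y) - θ₀ * Φ t x y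
        - κ * ε * pd 2 0 (Φ t) x y - c * pd 0 1 (Φ t) x y) i -
      (logPart (rowProj K (fun x => Φ t x y) i) - θ₀ * rowProj K (fun x => Φ s x y) i
        - κ * ε * bdD2x (rowProj K fun x => Φ t x y) i - c * G i))
      (C * mesh K ^ 2 + 4 / ε₀ * b + |θ₀| * (C * (t - s)) + κ * ε * (C * mesh K ^ 2)
        + |c| * m) := by
  have hm := mesh_pos K
  have c0 := hreg.continuous_x ht hy
  have c1 := continuous_diff2 c0 (mesh K)
  have c2 := hreg.continuous_pd ht (a := 2) (b := 0) (by omega) hy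
  have r1 := hC.logPart_row hε₀ hsep hK ht hy hU hb
  have r2 := (hC.increment_row (K := K) hreg hs ht hst hy).smul (-θ₀)
  have r3 := (RowLe.rowProj (K := K) (g := fun x => diff2 (mesh K) (fun x => Φ t x y) x -
    pd 2 0 (Φ t) x y) (c1.sub c2) fun x _ =>
    hC.diff2_self t ht _ hm x y hy).smul (κ * ε)
  have r4 := hG.smul c
  refine ((((r1.add r2).add r3).add r4).mono (le_of_eq ?_)).congr fun i => ?_
  · rw [abs_neg, abs_of_pos (mul_pos hκ hε)]
  · rw [hreg.rowProj_surfPot hε₀ hsep ht hy, rowProj_sub K c1.continuousOn c2.continuousOn,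
      rowProj_diff2 c0 ((hreg.rowRegular ht).per y hy)]
    ring

end

/-! ### The corrected solution satisfies the scheme up to small residuals -/

section

variable {ε κ θ₀ T ε₀ C : ℝ} {Φ : ℝ → ℝ → ℝ → ℝ} {p q : ℝ → ℝ} {K : ℕ}

/-- The inward normal difference on `y = 0` that makes the discrete Laplacian exact. -/
noncomputable def ghostBot (K : ℕ) (Φ : ℝ → ℝ → ℝ → ℝ) (t : ℝ) : BdGrid K := fun i =>
  mesh K / 2 * (-negLap (corrected K Φ t) i 0 - rowProj K (fun x => lap (Φ t) x 0) i)

/-- The outward normal difference on `y = 1` that makes the discrete Laplacian exact. -/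
noncomputable def ghostTop (K : ℕ) (Φ : ℝ → ℝ → ℝ → ℝ) (t : ℝ) : BdGrid K := fun i =>
  -(mesh K / 2 * (-negLap (corrected K Φ t) i (cells K) - rowProj K (fun x => lap (Φ t) x 1) i))

/-- On the boundary rows the left-hand side vanishes identically, by the choice of the ghost fluxes;
only interior rows contribute. -/
theorem Consistent.ghost_lap_row (hC : Consistent ε κ θ₀ T C Φ p q) (hT : 0 < T)
    (hreg : ClassR T Φ) {t : ℝ} (ht : t ∈ Set.Icc 0 T) {j : ℕ} (hj : j ≤ cells K) :
    RowLe (fun i => negLap (corrected K Φ t) i j + 2 / mesh K * (if j = 0 then ghostBot K Φ t i else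
        if j = cells K then -ghostTop K Φ t i else 0) +
        rowProj K (fun x => lap (Φ t) x (j * mesh K)) i)
      (C * mesh K ^ 2 + 40 * |massDefect K Φ t|) := by
  have hm := mesh_pos K
  have hC0 := hC.const_nonneg hT
  by_cases h0 : j = 0
  · subst h0
    refine (RowLe.of_abs_le (f := fun _ => 0) fun _ => ?_).congr fun i => ?_
    · rw [abs_zero]; positivity
    · simp only [if_true, ghostBot, Nat.cast_zero, zero_mul]
      field_simp
      ring
  by_cases hN : j = cells K
  · subst hN
    refine (RowLe.of_abs_le (f := fun _ => 0) fun _ => ?_).congr fun i => ?_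
    · rw [abs_zero]; positivity
    · simp only [if_neg h0, if_true, ghostTop, cells_mul_mesh]
      field_simp
      ring
  · refine (hC.lap_row hreg ht h0 (lt_of_le_of_ne hj hN)).congr fun i => ?_
    rw [if_neg h0, if_neg hN, mul_zero, add_zero]

/-- Four sources of error: the logarithm of a projection, the explicit treatment of the concave
term, the mass correction at the old time, and the discrete Laplacian. -/
theorem Consistent.pot_row (hC : Consistent ε κ θ₀ T C Φ p q) (hT : 0 < T) (hε₀ : 0 < ε₀)
    (hreg : ClassR T Φ) (hsep : Separated T ε₀ Φ) (hK : 1 ≤ K) {s t : ℝ} (hs : s ∈ Set.Icc 0 T)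
    (ht : t ∈ Set.Icc 0 T) (hst : s ≤ t)
    (hb : C * mesh K ^ 2 + 2 * |massDefect K Φ t| ≤ ε₀ / 2) {j : ℕ} (hj : j ≤ cells K) :
    RowLe (fun i => projGrid K (bulkPot ε θ₀ (Φ t)) i j -
      (logPart (corrected K Φ t i j) - θ₀ * corrected K Φ s i j +
        ε ^ 2 * (negLap (corrected K Φ t) i j + 2 / mesh K * (if j = 0 then ghostBot K Φ t i else
        if j = cells K then -ghostTop K Φ t i else 0))))
      (C * mesh K ^ 2 + 4 / ε₀ * (C * mesh K ^ 2 + 2 * |massDefect K Φ t|) +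
        |θ₀| * (C * (t - s)) + |θ₀| * (2 * |massDefect K Φ s|) +
        ε ^ 2 * (C * mesh K ^ 2 + 40 * |massDefect K Φ t|)) := by
  have hy := row_mem hj
  have r1 := hC.logPart_row hε₀ hsep hK ht hy (U := fun i => corrected K Φ t i j)
    (fun i => hC.abs_corrected_sub_le hK ht i hj) hb
  have r2 := (hC.increment_row (K := K) hreg hs ht hst hy).smul (-θ₀)
  have r3 := ((RowLe.of_abs_le (K := K) (f := fun _ => cosRow K j) (a := 2)
    fun _ => abs_cosRow_le K j).smul (massDefect K Φ s)).smul (-θ₀)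
  have r4 := (hC.ghost_lap_row (K := K) hT hreg ht hj).smul (-ε ^ 2)
  refine ((((r1.add r2).add r3).add r4).mono (le_of_eq ?_)).congr fun i => ?_
  · rw [abs_neg, abs_neg, abs_of_nonneg (sq_nonneg ε)]
    ring
  · rw [projGrid_natCast, hreg.rowProj_bulkPot hε₀ hsep ht hy, corrected_apply K Φ s,
      projGrid_natCast]
    ring

/-- A constant for the residuals of the potential equations. -/
noncomputable def residualConst (ε κ θ₀ ε₀ : ℝ) : ℝ :=
  1 + 8 / ε₀ + 2 * |θ₀| + 40 * ε ^ 2 + κ * ε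

/-- The size of the residuals in a step from time `s` to time `t`. -/
noncomputable def residualBound (ε κ θ₀ ε₀ C : ℝ) (Φ : ℝ → ℝ → ℝ → ℝ) (p : ℝ → ℝ) (K : ℕ)
    (s t : ℝ) : ℝ :=
  residualConst ε κ θ₀ ε₀ * (C * mesh K ^ 2 + C * (t - s) + |massDefect K Φ s| +
    |massDefect K Φ t|) + (5 * C * mesh K ^ 2 + 3 * (p t - p s))

theorem ClassR.bd_flux_row (hreg : ClassR T Φ) {s t m : ℝ}
    (hs : s ∈ Set.Icc 0 T) (ht : t ∈ Set.Icc 0 T) {y : ℝ}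
    (hy : y ∈ Set.Icc (0 : ℝ) 1) {μ : ℝ → ℝ} (hμ : Continuous μ) (hp : Function.Periodic μ 1)
    (h : ∀ x ∈ Set.Icc (0 : ℝ) 1, |diff2 (mesh K) μ x - (Φ t x y - Φ s x y) / (t - s)| ≤ m) :
    RowLe (fun i => bdD2x (rowProj K μ) i - (rowProj K (fun x => Φ t x y) i -
      rowProj K (fun x => Φ s x y) i) / (t - s)) m := by
  have c0 := continuous_diff2 hμ (mesh K)
  have c1 := hreg.continuous_x ht hy
  have c2 := hreg.continuous_x hs hy
  refine (RowLe.rowProj (g := fun x => diff2 (mesh K) μ x - (Φ t x y - Φ s x y) / (t - s))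
    (c0.sub ((c1.sub c2).div_const _)) h).congr fun i => ?_
  rw [rowProj_sub_div c0 c1 c2, rowProj_diff2 hμ hp]

/-- The potentials of the perturbed step are the projections of the exact potentials, and its fluxes
are the ghost fluxes. The residuals are then defined as the defects of the equations, and only their
size has to be checked. -/
theorem Consistent.exists_perturbedStep (hC : Consistent ε κ θ₀ T C Φ p q) (hT : 0 < T)
    (hε : 0 < ε) (hκ : 0 < κ) (hε₀ : 0 < ε₀) (hreg : ClassR T Φ) (hsep : Separated T ε₀ Φ)
    (hK : 1 ≤ K) {s t : ℝ} (hs : s ∈ Set.Icc 0 T) (ht : t ∈ Set.Icc 0 T) (hst : s < t)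
    (hb : C * mesh K ^ 2 + 2 * |massDefect K Φ t| ≤ ε₀ / 2) :
    ∃ (R S : Grid K) (RB RT SB ST : BdGrid K),
      PerturbedStep ε κ θ₀ (t - s) (corrected K Φ s) (corrected K Φ t) R S RB RT SB ST ∧
      (∀ j : ℕ, j ≤ cells K → RowLe (fun i => R i j) (if j = 0 ∨ j = cells K then
        residualBound ε κ θ₀ ε₀ C Φ p K s t / mesh K else residualBound ε κ θ₀ ε₀ C Φ p K s t)) ∧
      (∀ j : ℕ, j ≤ cells K → RowLe (fun i => S i j) (residualBound ε κ θ₀ ε₀ C Φ p K s t)) ∧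
      RowLe RB (residualBound ε κ θ₀ ε₀ C Φ p K s t) ∧
      RowLe RT (residualBound ε κ θ₀ ε₀ C Φ p K s t) ∧
      RowLe SB (residualBound ε κ θ₀ ε₀ C Φ p K s t) ∧
      RowLe ST (residualBound ε κ θ₀ ε₀ C Φ p K s t) := by
  have hm := mesh_pos K
  have hm1 := mesh_le_one K
  have hC0 := hC.const_nonneg hT
  have hts : 0 < t - s := sub_pos.2 hst
  have hτ : 0 ≤ p t - p s := sub_nonneg.2 (hC.p_mono s hs t ht hst.le)
  have hy0 : (0 : ℝ) ∈ Set.Icc (0 : ℝ) 1 := ⟨le_rfl, zero_le_one⟩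
  have hy1 : (1 : ℝ) ∈ Set.Icc (0 : ℝ) 1 := ⟨zero_le_one, le_rfl⟩
  set a := C * mesh K ^ 2 with ha
  set b := C * (t - s) with hbdef
  set d := |massDefect K Φ s| with hd
  set d' := |massDefect K Φ t| with hd'
  set τ := p t - p s with hτdef
  set Q := residualConst ε κ θ₀ ε₀ with hQ
  set σ := residualBound ε κ θ₀ ε₀ C Φ p K s t with hσ
  have ha0 : 0 ≤ a := by positivity
  have hb0 : 0 ≤ b := by positivity
  have hd0 : 0 ≤ d := abs_nonneg _
  have hd0' : 0 ≤ d' := abs_nonneg _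
  have hκε : 0 < κ * ε := mul_pos hκ hε
  have hε2 : 0 ≤ ε ^ 2 := sq_nonneg ε
  have hθ := abs_nonneg θ₀
  have he : 0 < 8 / ε₀ := by positivity
  have hσe : σ = Q * (a + b + d + d') + (5 * a + 3 * τ) := by
    rw [hσ, residualBound, ha]; ring
  have hQe : Q * (a + b + d + d') = (a + b + d + d') + 8 / ε₀ * (a + b + d + d') +
      2 * |θ₀| * (a + b + d + d') + 40 * ε ^ 2 * (a + b + d + d') + κ * ε * (a + b + d + d') := by
    rw [hQ, residualConst]; ring
  have n1 : ∀ c : ℝ, 0 ≤ c → 0 ≤ c * a ∧ 0 ≤ c * b ∧ 0 ≤ c * d ∧ 0 ≤ c * d' := fun c hc =>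
    ⟨mul_nonneg hc ha0, mul_nonneg hc hb0, mul_nonneg hc hd0, mul_nonneg hc hd0'⟩
  obtain ⟨e1, e2, e3, e4⟩ := n1 (8 / ε₀) he.le
  obtain ⟨t1, t2, t3, t4⟩ := n1 (|θ₀|) hθ
  obtain ⟨s1, s2, s3, s4⟩ := n1 (ε ^ 2) hε2
  obtain ⟨k1, k2, k3, k4⟩ := n1 (κ * ε) hκε.le
  have hes : ∀ z, 4 / ε₀ * z = 8 / ε₀ * z / 2 := fun z => by ring
  have hdef := hC.massDefect_increment (K := K) hε₀ hT hreg hsep hs ht hst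
  have hdef' : |(massDefect K Φ t - massDefect K Φ s) / (t - s)| ≤ 2 * a + τ := by
    rw [abs_div, abs_of_pos hts, div_le_iff₀' hts]
    refine hdef.trans (le_of_eq ?_)
    rw [ha, hτdef]; ring
  -- The mass correction contributes nothing to the evolution residual on the boundary rows.
  have hcos : ∀ j : ℕ, j ≤ cells K → |cosRow K j| ≤ if j = 0 ∨ j = cells K then 0 else 2 := by
    intro j _
    split_ifs with h
    · rcases h with rfl | rfl
      · simp [cosRow_zero]
      · rw [cosRow_cells, abs_zero]
    · exact abs_cosRow_le K j
  have hubot : ∀ i, |rowProj K (fun x => Φ t x 0) i - Φ t (xpt K i) 0| ≤ a := fun i =>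
    hC.partialSum_self t ht K hK (xpt K i) 0 hy0
  have hutop : ∀ i, |rowProj K (fun x => Φ t x 1) i - Φ t (xpt K i) 1| ≤ a := fun i =>
    hC.partialSum_self t ht K hK (xpt K i) 1 hy1
  have hab : a ≤ ε₀ / 2 := by linarith
  have ebot : botPot ε κ θ₀ (Φ t) = fun x => logPart (Φ t x 0) - θ₀ * Φ t x 0
      - κ * ε * pd 2 0 (Φ t) x 0 - ε ^ 2 * pd 0 1 (Φ t) x 0 := by
    funext x
    have := hsep.pos hε₀ ht x hy0
    exact botPot_eq this.1 this.2
  have etop : topPot ε κ θ₀ (Φ t) = fun x => logPart (Φ t x 1) - θ₀ * Φ t x 1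
      - κ * ε * pd 2 0 (Φ t) x 1 - (-ε ^ 2) * pd 0 1 (Φ t) x 1 := by
    funext x
    have := hsep.pos hε₀ ht x hy1
    rw [topPot_eq this.1 this.2]
    ring
  have gbot : RowLe (fun i => ghostBot K Φ t i - rowProj K (fun x => pd 0 1 (Φ t) x 0) i)
      (a + 20 * d') :=
    (hC.normal_row hreg ht (Or.inl ⟨rfl, rfl, rfl⟩)).congr fun i => by rw [ghostBot, one_mul]
  have gtop : RowLe (fun i => ghostTop K Φ t i - rowProj K (fun x => pd 0 1 (Φ t) x 1) i)
      (a + 20 * d') := by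
    refine (((hC.normal_row (K := K) hreg ht (Or.inr ⟨rfl, rfl, rfl⟩)).smul (-1)).mono
      (le_of_eq ?_)).congr fun i => ?_
    · rw [abs_neg, abs_one, one_mul]
    · rw [ghostTop]; ring
  refine ⟨fun i j => -negLap (projGrid K (bulkPot ε θ₀ (Φ t))) i j -
      (corrected K Φ t i j - corrected K Φ s i j) / (t - s),
    fun i j => projGrid K (bulkPot ε θ₀ (Φ t)) i j -
      (logPart (corrected K Φ t i j) - θ₀ * corrected K Φ s i j +
        ε ^ 2 * (negLap (corrected K Φ t) i j + 2 / mesh K * (if j = 0 then ghostBot K Φ t i else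
        if j = cells K then -ghostTop K Φ t i else 0))),
    fun i => bdD2x (rowProj K (botPot ε κ θ₀ (Φ t))) i -
      (rowProj K (fun x => Φ t x 0) i - rowProj K (fun x => Φ s x 0) i) / (t - s),
    fun i => bdD2x (rowProj K (topPot ε κ θ₀ (Φ t))) i -
      (rowProj K (fun x => Φ t x 1) i - rowProj K (fun x => Φ s x 1) i) / (t - s),
    fun i => rowProj K (botPot ε κ θ₀ (Φ t)) i -
      (logPart (rowProj K (fun x => Φ t x 0) i) - θ₀ * rowProj K (fun x => Φ s x 0) i
        - κ * ε * bdD2x (rowProj K fun x => Φ t x 0) i - ε ^ 2 * ghostBot K Φ t i),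
    fun i => rowProj K (topPot ε κ θ₀ (Φ t)) i -
      (logPart (rowProj K (fun x => Φ t x 1) i) - θ₀ * rowProj K (fun x => Φ s x 1) i
        - κ * ε * bdD2x (rowProj K fun x => Φ t x 1) i - (-ε ^ 2) * ghostTop K Φ t i),
    ?_, ?_, ?_, ?_, ?_, ?_, ?_⟩
  · refine ⟨projGrid K (bulkPot ε θ₀ (Φ t)), rowProj K (botPot ε κ θ₀ (Φ t)),
      rowProj K (topPot ε κ θ₀ (Φ t)), ghostBot K Φ t, ghostTop K Φ t, ?_, ?_, ?_, ?_, ?_⟩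
    · intro i j hj
      refine ⟨?_, by ring, ?_⟩
      -- The corrected solution differs by at most `ε₀/2` from a function at distance `ε₀` from
      -- `±1`, so its logarithms are defined.
      · have h1 := abs_le.1 ((hC.abs_corrected_sub_le hK ht i hj).trans hb)
        have h2 := hsep t ht (xpt K i) _ (row_mem hj)
        rw [abs_lt]
        constructor <;> linarith [h1.1, h1.2, h2.1, h2.2]
      · simp only [Nat.cast_eq_zero, Nat.cast_inj]
        ring
    · intro i
      simp only [bot_corrected]
      ring
    · intro i
      simp only [top_corrected]
      ring
    · intro i
      simp only [bot_corrected]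
      ring
    · intro i
      simp only [top_corrected]
      ring
  · intro j hj
    have r1 := hC.bulk_row (K := K) hε₀ hreg hsep hs ht hst hj
    have r2 := (RowLe.of_abs_le (K := K) (f := fun _ => cosRow K j) fun _ => hcos j hj).smul
      ((massDefect K Φ t - massDefect K Φ s) / (t - s))
    refine ((r1.add r2).mono ?_).congr fun i => ?_
    · by_cases h : j = 0 ∨ j = cells K
      -- On boundary rows the residual may be of size `σ/h`, and `(C h + τ) h ≤ C h² + τ`.
      · simp only [if_pos h]
        rw [mul_zero, add_zero, le_div_iff₀ hm, hσe]
        have h1 : τ * mesh K ≤ τ := mul_le_of_le_one_right hτ hm1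
        have h2 : (C * mesh K + τ) * mesh K = a + τ * mesh K := by rw [ha]; ring
        have h3 : 0 ≤ Q * (a + b + d + d') := by rw [hQe]; linarith
        rw [h2]
        linarith
      -- Inside, truncation contributes `a + τ` and the change of the mass correction `2 (2a + τ)`;
      -- this is the part `5a + 3τ` of the residual bound.
      · simp only [if_neg h]
        rw [hσe]
        have h3 : 0 ≤ Q * (a + b + d + d') := by rw [hQe]; linarith
        linarith
    · beta_reduce
      rw [corrected_apply, corrected_apply]
      ring
  · intro j hj
    refine ((hC.pot_row hT hε₀ hreg hsep hK hs ht hst.le hb hj).mono ?_).congr fun i => ?_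
    · rw [hσe, hQe, hes]
      linarith
    · simp only [Nat.cast_eq_zero, Nat.cast_inj]
  · refine (hreg.bd_flux_row hs ht hy0 (hreg.continuous_botPot hε₀ hsep ht)
      (hreg.periodic_botPot ht) fun x hx => hC.surf_bot s hs t ht hst _ hm x hx).mono ?_
    rw [hσe, hQe]
    linarith
  · refine (hreg.bd_flux_row hs ht hy1 (hreg.continuous_topPot hε₀ hsep ht)
      (hreg.periodic_topPot ht) fun x hx => hC.surf_top s hs t ht hst _ hm x hx).mono ?_
    rw [hσe, hQe]
    linarith
  · rw [ebot]
    refine (hC.surf_row hε hκ hε₀ hreg hsep hK hs ht hst.le hy0 gbot hubot hab).mono ?_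
    rw [hσe, hQe, hes, abs_of_nonneg hε2]
    linarith
  · rw [etop]
    refine (hC.surf_row hε hκ hε₀ hreg hsep hK hs ht hst.le hy1 gtop hutop hab).mono ?_
    rw [hσe, hQe, hes, abs_neg, abs_of_nonneg hε2]
    linarith

end

/-! ### Convergence -/

section

variable {ε κ θ₀ T ε₀ C : ℝ} {Φ : ℝ → ℝ → ℝ → ℝ} {p q : ℝ → ℝ} {K : ℕ} {Δt : ℝ}

/-- The increments lie in the images of `L_h` and of `D_x²`, which have mean zero. -/
theorem SchemeStep.mean_eq {φ φ' : Grid K} (hΔt : 0 < Δt) (h : SchemeStep ε κ θ₀ Δt φ φ') :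
    mean φ' = mean φ ∧ bdMean (bot φ') = bdMean (bot φ) ∧ bdMean (top φ') = bdMean (top φ) := by
  obtain ⟨ν, νB, νT, G, H, h1, h2, h3, -, -⟩ := h.perturbedStep
  refine ⟨?_, ?_, ?_⟩
  · rw [mean_congr φ' (fun i j => φ i j + (-Δt) * negLap ν i j) fun i j hj => ?_,
      mean_add φ (fun i j => (-Δt) * negLap ν i j), mean_smul, mean_negLap, mul_zero, add_zero]
    have := (h1 i j hj).2.1
    rw [div_eq_iff hΔt.ne'] at this
    simp only [Pi.zero_apply] at this
    linarith
  · have e : bot φ' = bot φ + Δt • bdD2x νB := by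
      funext i
      have := h2 i
      rw [div_eq_iff hΔt.ne'] at this
      simp only [Pi.zero_apply, Pi.add_apply, Pi.smul_apply, smul_eq_mul] at this ⊢
      linarith
    rw [e, bdMean_add, bdMean_smul, bdMean_bdD2x, mul_zero, add_zero]
  · have e : top φ' = top φ + Δt • bdD2x νT := by
      funext i
      have := h3 i
      rw [div_eq_iff hΔt.ne'] at this
      simp only [Pi.zero_apply, Pi.add_apply, Pi.smul_apply, smul_eq_mul] at this ⊢
      linarith
    rw [e, bdMean_add, bdMean_smul, bdMean_bdD2x, mul_zero, add_zero]

theorem bdMean_sub (f g : BdGrid K) : bdMean (fun i => f i - g i) = bdMean f - bdMean g := by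
  have e : (fun i => f i - g i) = f + (-1 : ℝ) • g := by
    funext i; simp only [Pi.add_apply, Pi.smul_apply, smul_eq_mul]; ring
  rw [e, bdMean_add, bdMean_smul]
  ring

theorem time_mem {M n : ℕ} (hΔt : 0 < Δt) (hM : M * Δt ≤ T) (hn : n ≤ M) :
    (n : ℝ) * Δt ∈ Set.Icc 0 T :=
  ⟨by positivity, (mul_le_mul_of_nonneg_right (by exact_mod_cast hn) hΔt.le).trans hM⟩

/-- The error has mean zero in the bulk and on the boundary. -/
theorem Consistent.mean_err (hC : Consistent ε κ θ₀ T C Φ p q) (hK : 1 ≤ K) (hΔt : 0 < Δt)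
    {M : ℕ} (hM : M * Δt ≤ T) {φ : ℕ → Grid K}
    (hφ : ∀ n < M, SchemeStep ε κ θ₀ Δt (φ n) (φ (n + 1)))
    (h0 : mean (φ 0) = mean (sample K (projX K (Φ 0))))
    (hb : bdMean (bot (φ 0)) = bdMean (bot (sample K (projX K (Φ 0)))))
    (ht : bdMean (top (φ 0)) = bdMean (top (sample K (projX K (Φ 0))))) {n : ℕ} (hn : n ≤ M) :
    mean (err Φ Δt φ n) = 0 ∧ bdMean (bot (err Φ Δt φ n)) = 0 ∧
      bdMean (top (err Φ Δt φ n)) = 0 := by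
  have key : ∀ n ≤ M, mean (φ n) = mean (φ 0) ∧ bdMean (bot (φ n)) = bdMean (bot (φ 0)) ∧
      bdMean (top (φ n)) = bdMean (top (φ 0)) := by
    intro n
    induction n with
    | zero => intro _; exact ⟨rfl, rfl, rfl⟩
    | succ n ih =>
      intro hn
      obtain ⟨a1, a2, a3⟩ := (hφ n (by omega)).mean_eq hΔt
      obtain ⟨b1, b2, b3⟩ := ih (by omega)
      exact ⟨a1.trans b1, a2.trans b2, a3.trans b3⟩
  obtain ⟨m1, m2, m3⟩ := key n hn
  have htn := time_mem hΔt hM hn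
  have eb : bot (sample K (projX K (Φ 0))) = rowProj K fun x => Φ 0 x 0 := by
    funext i; exact projGrid_zero (Φ 0) i
  have et : top (sample K (projX K (Φ 0))) = rowProj K fun x => Φ 0 x 1 := by
    funext i; exact projGrid_cells (Φ 0) i
  -- In the bulk the mass correction is exact. On the sections it vanishes, and the discrete mean of
  -- the projection is the conserved integral.
  refine ⟨?_, ?_, ?_⟩
  · have e : err Φ Δt φ n = fun i j => corrected K Φ (n * Δt) i j - 1 * φ n i j := by
      funext i j; rw [err, one_mul]
    rw [e, mean_sub_smul, mean_corrected hK, m1, h0, one_mul]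
    exact sub_self _
  · have e : bot (err Φ Δt φ n) = fun i => bot (corrected K Φ (n * Δt)) i - bot (φ n) i := rfl
    rw [e, bdMean_sub, m2, hb, eb, bot_corrected, bdMean_rowProj, bdMean_rowProj,
      hC.mass_bot _ htn, sub_self]
  · have e : top (err Φ Δt φ n) = fun i => top (corrected K Φ (n * Δt)) i - top (φ n) i := rfl
    rw [e, bdMean_sub, m3, ht, et, top_corrected, bdMean_rowProj, bdMean_rowProj,
      hC.mass_top _ htn, sub_self]

/-- The defect vanishes initially and its increments are summed: the spatial part adds up to `2CT
h²`, while the increments of `p` telescope and leave `Δt p(nΔt) ≤ C Δt`. -/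
theorem Consistent.abs_massDefect_le (hC : Consistent ε κ θ₀ T C Φ p q) (hε₀ : 0 < ε₀)
    (hT : 0 < T) (hreg : ClassR T Φ) (hsep : Separated T ε₀ Φ) (hΔt : 0 < Δt) {M : ℕ}
    (hM : M * Δt ≤ T) {n : ℕ} (hn : n ≤ M) :
    |massDefect K Φ (n * Δt)| ≤ (2 * C * T + C) * (Δt + mesh K ^ 2) := by
  have hC0 := hC.const_nonneg hT
  have key : ∀ n ≤ M, |massDefect K Φ (n * Δt)| ≤
      n * Δt * (2 * C * mesh K ^ 2) + Δt * p (n * Δt) := by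
    intro n
    induction n with
    | zero => intro _; simp [massDefect, hC.p_zero]
    | succ n ih =>
      intro hn
      have hst : (n : ℝ) * Δt < ((n + 1 : ℕ) : ℝ) * Δt := by push_cast; linarith
      have h1 := hC.massDefect_increment (K := K) hε₀ hT hreg hsep
        (time_mem hΔt hM (by omega : n ≤ M)) (time_mem hΔt hM hn) hst
      have h2 := ih (by omega)
      have h3 := abs_sub_abs_le_abs_sub (massDefect K Φ ((n + 1 : ℕ) * Δt))
        (massDefect K Φ (n * Δt))
      have e : ((n + 1 : ℕ) : ℝ) * Δt - n * Δt = Δt := by push_cast; ring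
      rw [e] at h1
      have e2 : ((n + 1 : ℕ) : ℝ) * Δt * (2 * C * mesh K ^ 2) =
        n * Δt * (2 * C * mesh K ^ 2) + Δt * (2 * C * mesh K ^ 2) := by push_cast; ring
      rw [e2]
      linarith
  have htn := time_mem hΔt hM hn
  have h1 := key n hn
  have h2 : n * Δt * (2 * C * mesh K ^ 2) ≤ T * (2 * C * mesh K ^ 2) :=
    mul_le_mul_of_nonneg_right htn.2 (by positivity)
  have h3 : Δt * p (n * Δt) ≤ Δt * C := mul_le_mul_of_nonneg_left (hC.p_le _ htn) hΔt.le
  have h4 : 0 ≤ C * mesh K ^ 2 := by positivity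
  have h5 : 0 ≤ 2 * C * T * Δt := by positivity
  linarith

/-- Cauchy-Schwarz on each step, then telescoping of `q`. With the further factor `Δt` in the
Gronwall sum this is of order `Δt²`, so square integrability of the second time derivative is
enough. -/
theorem Consistent.sum_sq_increment_le (hC : Consistent ε κ θ₀ T C Φ p q) (hΔt : 0 < Δt)
    {M : ℕ} (hM : M * Δt ≤ T) {n : ℕ} (hn : n ≤ M) :
    ∑ k ∈ range n, (p ((k + 1 : ℕ) * Δt) - p (k * Δt)) ^ 2 ≤ C * Δt := by
  have h1 : ∀ k ∈ range n, (p ((k + 1 : ℕ) * Δt) - p (k * Δt)) ^ 2 ≤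
      Δt * (q ((k + 1 : ℕ) * Δt) - q (k * Δt)) := by
    intro k hk
    rw [mem_range] at hk
    have e : ((k + 1 : ℕ) : ℝ) * Δt - k * Δt = Δt := by push_cast; ring
    have := hC.sq_le _ (time_mem hΔt hM (by omega : k ≤ M)) _
      (time_mem hΔt hM (by omega : k + 1 ≤ M)) (by push_cast; linarith)
    rwa [e] at this
  refine (sum_le_sum h1).trans ?_
  rw [← mul_sum, sum_range_sub fun k : ℕ => q (k * Δt)]
  simp only [Nat.cast_zero, zero_mul, hC.q_zero, sub_zero]
  rw [mul_comm]
  exact mul_le_mul_of_nonneg_right (hC.q_le _ (time_mem hΔt hM hn)) hΔt.le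

theorem dissip_nonneg (hε : 0 < ε) (hκ : 0 < κ) (e : Grid K) : 0 ≤ dissip ε κ e := by
  have h1 := gradSq_nonneg e
  have h2 : 0 ≤ surfGradSq e := add_nonneg (bdGradSq_nonneg _) (bdGradSq_nonneg _)
  unfold dissip
  positivity

theorem energy_nonneg (e : Grid K) : 0 ≤ energy e := add_nonneg (sq_nonneg _) (sq_nonneg _)

/-- A constant for the accumulated residuals. -/
noncomputable def stepConst (ε κ θ₀ ε₀ T C : ℝ) : ℝ :=
  residualConst ε κ θ₀ ε₀ * (C + 2 * (2 * C * T + C)) + 5 * C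

/-- The energy of the error and the accumulated dissipation are of the squared order of
consistency. -/
theorem Consistent.energy_err_le (hC : Consistent ε κ θ₀ T C Φ p q) (hT : 0 < T)
    (hε : 0 < ε) (hκ : 0 < κ) (hε₀ : 0 < ε₀) (hreg : ClassR T Φ) (hsep : Separated T ε₀ Φ)
    (hK : 1 ≤ K) (hΔt : 0 < Δt)
    (hsmall : (C + 2 * (2 * C * T + C)) * (Δt + mesh K ^ 2) ≤ ε₀ / 2)
    (hstep : energyConst ε κ θ₀ * Δt ≤ 1 / 2)
    {M : ℕ} (hM : M * Δt ≤ T) {φ : ℕ → Grid K}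
    (hφ : ∀ n < M, SchemeStep ε κ θ₀ Δt (φ n) (φ (n + 1)))
    (hmean : ∀ n ≤ M, mean (err Φ Δt φ n) = 0 ∧ bdMean (bot (err Φ Δt φ n)) = 0 ∧
      bdMean (top (err Φ Δt φ n)) = 0) {n : ℕ} (hn : n ≤ M) :
    energy (err Φ Δt φ n) + Δt * ∑ k ∈ Icc 1 n, dissip ε κ (err Φ Δt φ k) ≤
      Real.exp (4 * energyConst ε κ θ₀ * T) * (energy (err Φ Δt φ 0) +
        2 * energyConst ε κ θ₀ * ((2 * stepConst ε κ θ₀ ε₀ T C ^ 2 * T + 18 * C) *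
          (Δt + mesh K ^ 2) ^ 2)) := by
  have hC0 := hC.const_nonneg hT
  have hm := mesh_pos K
  have hc := energyConst_pos hε hκ θ₀
  set X := Δt + mesh K ^ 2 with hX
  have hX0 : 0 ≤ X := by positivity
  set D := 2 * C * T + C with hD
  have hQ : 0 ≤ residualConst ε κ θ₀ ε₀ := by unfold residualConst; positivity
  have hd : ∀ k ≤ M, |massDefect K Φ (k * Δt)| ≤ D * X := fun k hk =>
    hC.abs_massDefect_le hε₀ hT hreg hsep hΔt hM hk
  set σ : ℕ → ℝ := fun k => residualBound ε κ θ₀ ε₀ C Φ p K (k * Δt) ((k + 1 : ℕ) * Δt) with hσ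
  have hτ : ∀ k < M, 0 ≤ p ((k + 1 : ℕ) * Δt) - p (k * Δt) := fun k hk =>
    sub_nonneg.2 (hC.p_mono _ (time_mem hΔt hM hk.le) _ (time_mem hΔt hM hk)
      (by push_cast; linarith))
  have hdt : ∀ k : ℕ, ((k + 1 : ℕ) : ℝ) * Δt - k * Δt = Δt := fun k => by push_cast; ring
  have hσle : ∀ k < M, 0 ≤ σ k ∧ σ k ≤ stepConst ε κ θ₀ ε₀ T C * X +
      3 * (p ((k + 1 : ℕ) * Δt) - p (k * Δt)) := by
    intro k hk
    have h1 := hd k hk.le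
    have h2 := hd (k + 1) hk
    have h3 := hτ k hk
    simp only [hσ, residualBound, hdt]
    constructor
    · positivity
    · have h4 : C * mesh K ^ 2 + C * Δt + |massDefect K Φ (k * Δt)| +
          |massDefect K Φ ((k + 1 : ℕ) * Δt)| ≤ (C + 2 * D) * X := by
        rw [hX] at h1 h2 ⊢; linarith
      have h5 := mul_le_mul_of_nonneg_left h4 hQ
      have h6 : 0 ≤ C * Δt := by positivity
      have h7 : C * X = C * Δt + C * mesh K ^ 2 := by rw [hX]; ring
      rw [stepConst, ← hD]
      linarith
  have hE : ∀ k < M, energy (err Φ Δt φ (k + 1)) + Δt * dissip ε κ (err Φ Δt φ (k + 1)) ≤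
      energy (err Φ Δt φ k) + Δt * (energyConst ε κ θ₀ *
        (energy (err Φ Δt φ k) + energy (err Φ Δt φ (k + 1)) + σ k ^ 2)) := by
    intro k hk
    have hst : (k : ℝ) * Δt < ((k + 1 : ℕ) : ℝ) * Δt := by push_cast; linarith
    -- The smallness of `Δt + h²` enters here: it keeps the corrected solution separated from `±1`.
    have hb : C * mesh K ^ 2 + 2 * |massDefect K Φ ((k + 1 : ℕ) * Δt)| ≤ ε₀ / 2 := by
      have h1 := hd (k + 1) hk
      have h2 : 0 ≤ C * Δt := by positivity
      refine le_trans ?_ hsmall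
      rw [hX] at h1 ⊢
      linarith
    obtain ⟨R, S, RB, RT, SB, ST, hU, hR, hS, hRB, hRT, hSB, hST⟩ :=
      hC.exists_perturbedStep hT hε hκ hε₀ hreg hsep hK (time_mem hΔt hM hk.le)
        (time_mem hΔt hM hk) hst hb
    rw [hdt] at hU
    obtain ⟨m1, m3, m5⟩ := hmean k hk.le
    obtain ⟨m2, m4, m6⟩ := hmean (k + 1) hk
    exact energy_step hε hκ hΔt (hσle k hk).1 hU (hφ k hk).perturbedStep
      (fun j hj => (hR j hj).2) (fun j hj => (hS j hj).2) hRB.2 hRT.2 hSB.2 hST.2 rfl rfl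
      m1 m2 m3 m4 m5 m6
  have hG := energy_gronwall (E := fun k => energy (err Φ Δt φ k))
    (D := fun k => dissip ε κ (err Φ Δt φ k)) (σ := fun k => σ k ^ 2) hc.le hΔt hstep
    (fun k => energy_nonneg _) (fun k => dissip_nonneg hε hκ _) (fun k => sq_nonneg _) hE hn
  have hsum : Δt * ∑ k ∈ range n, σ k ^ 2 ≤
      (2 * stepConst ε κ θ₀ ε₀ T C ^ 2 * T + 18 * C) * X ^ 2 := by
    -- By `(x + y)² ≤ 2x² + 2y²` with `y = 3τ`, whence the factor `18`.
    have h1 : ∀ k ∈ range n, σ k ^ 2 ≤ 2 * (stepConst ε κ θ₀ ε₀ T C * X) ^ 2 +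
        18 * (p ((k + 1 : ℕ) * Δt) - p (k * Δt)) ^ 2 := by
      intro k hk
      rw [mem_range] at hk
      obtain ⟨h2, h3⟩ := hσle k (by omega)
      refine (pow_le_pow_left₀ h2 h3 2).trans ?_
      nlinarith [sq_nonneg (stepConst ε κ θ₀ ε₀ T C * X -
        3 * (p ((k + 1 : ℕ) * Δt) - p (k * Δt)))]
    have h2 := sum_le_sum h1
    rw [sum_add_distrib, sum_const, ← mul_sum, card_range, nsmul_eq_mul] at h2
    have h3 := hC.sum_sq_increment_le hΔt hM hn
    have h4 : n * Δt ≤ T := (time_mem hΔt hM hn).2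
    have h5 : n * Δt * (2 * (stepConst ε κ θ₀ ε₀ T C * X) ^ 2) ≤
        T * (2 * (stepConst ε κ θ₀ ε₀ T C * X) ^ 2) :=
      mul_le_mul_of_nonneg_right h4 (by positivity)
    have h6 : Δt ≤ X := by rw [hX]; linarith [sq_nonneg (mesh K)]
    have h7 : Δt * Δt ≤ X ^ 2 := by nlinarith
    have h8 : C * (Δt * Δt) ≤ C * X ^ 2 := mul_le_mul_of_nonneg_left h7 hC0
    calc Δt * ∑ k ∈ range n, σ k ^ 2 ≤ Δt * (n * (2 * (stepConst ε κ θ₀ ε₀ T C * X) ^ 2) +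
          18 * (C * Δt)) := mul_le_mul_of_nonneg_left (by linarith) hΔt.le
      _ = n * Δt * (2 * (stepConst ε κ θ₀ ε₀ T C * X) ^ 2) + 18 * (C * (Δt * Δt)) := by ring
      _ ≤ T * (2 * (stepConst ε κ θ₀ ε₀ T C * X) ^ 2) + 18 * (C * X ^ 2) := by linarith
      _ = _ := by ring
  refine hG.trans (mul_le_mul ?_ ?_ ?_ (Real.exp_pos _).le)
  · exact Real.exp_le_exp.2 (mul_le_mul_of_nonneg_left (time_mem hΔt hM hn).2 (by positivity))
  · exact add_le_add le_rfl (mul_le_mul_of_nonneg_left hsum (by positivity))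
  · exact add_nonneg (energy_nonneg _) (mul_nonneg (by positivity)
      (mul_nonneg hΔt.le (sum_nonneg fun _ _ => sq_nonneg _)))

/-- Excludes the one-cell grid, on which neither the Fourier tail estimate nor the unit mean of the
cosine profile is available. -/
theorem one_le_of_mesh_le (h : mesh K ≤ 1 / 3) : 1 ≤ K := by
  by_contra hK
  have : K = 0 := by omega
  subst this
  norm_num [mesh] at h

end
theorem theorem1 (ε κ θ₀ T ε₀ : ℝ) (hε : 0 < ε) (hκ : 0 < κ) (hT : 0 < T) (hε₀ : 0 < ε₀)
    (Φ : ℝ → ℝ → ℝ → ℝ)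
    (hreg : ClassR T Φ)
    (hsol : SolvesCahnHilliard ε κ θ₀ T Φ)
    (hsep : ∀ t ∈ Set.Icc 0 T, ∀ x : ℝ, ∀ y ∈ Set.Icc (0 : ℝ) 1,
      ε₀ ≤ 1 + Φ t x y ∧ ε₀ ≤ 1 - Φ t x y)
    (C₀ : ℝ) :
    ∃ C Δt₀ h₀ : ℝ, 0 < C ∧ 0 < Δt₀ ∧ 0 < h₀ ∧
      ∀ (K : ℕ) (Δt : ℝ), mesh K ≤ h₀ → 0 < Δt → Δt ≤ Δt₀ →
      ∀ M : ℕ, M * Δt ≤ T →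
      ∀ φ : ℕ → Grid K,
        -- the numerical solution
        (∀ n < M, SchemeStep ε κ θ₀ Δt (φ n) (φ (n + 1))) →
        -- its initial datum has the masses of the projected exact one, and approximates it
        mean (φ 0) = mean (sample K (projX K (Φ 0))) →
        bdMean (bot (φ 0)) = bdMean (bot (sample K (projX K (Φ 0)))) →
        bdMean (top (φ 0)) = bdMean (top (sample K (projX K (Φ 0)))) →
        negNorm (err Φ Δt φ 0) + surfNegNorm (err Φ Δt φ 0) ≤ C₀ * (Δt + mesh K ^ 2) →
        ∀ n < M,
          -- the error has mean zero, so that its negative norms are well defined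
          (mean (err Φ Δt φ (n + 1)) = 0 ∧ bdMean (bot (err Φ Δt φ (n + 1))) = 0 ∧
            bdMean (top (err Φ Δt φ (n + 1))) = 0) ∧
          -- the error bound
          negNorm (err Φ Δt φ (n + 1)) + surfNegNorm (err Φ Δt φ (n + 1))
            + Δt * ∑ k ∈ Finset.Icc 1 n,
                (ε ^ 2 * gradSq (err Φ Δt φ k) + ε * κ * surfGradSq (err Φ Δt φ k))
            ≤ C * (Δt + mesh K ^ 2) ∧
          -- the bound of the discrete `ℓ²(0,T;H¹)` norm
          Real.sqrt (Δt * ∑ k ∈ Finset.Icc 1 (n + 1),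
                (ε ^ 2 * gradSq (err Φ Δt φ k) + ε * κ * surfGradSq (err Φ Δt φ k)))
            ≤ C * (Δt + mesh K ^ 2) := by
  obtain ⟨A, p, q, hA⟩ := exists_consistent hT hε hκ hε₀ hreg hsol hsep
  have hA0 := hA.const_nonneg hT
  have hc := energyConst_pos hε hκ θ₀
  set c := energyConst ε κ θ₀ with hcdef
  set B := A + 2 * (2 * A * T + A) with hB
  have hB0 : 0 ≤ B := by positivity
  set W := Real.exp (4 * c * T) *
    (C₀ ^ 2 + 2 * c * (2 * stepConst ε κ θ₀ ε₀ T A ^ 2 * T + 18 * A)) with hW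
  have hW0 : 0 ≤ W := by positivity
  -- Chosen so that `Δt ≤ δ` and `h² ≤ h ≤ δ` give `(B + 1) (Δt + h²) ≤ ε₀/2`; the `+ 1` keeps the
  -- denominator positive.
  set δ := ε₀ / (4 * (B + 1)) with hδ
  have hδ0 : 0 < δ := by positivity
  -- Each of the two norms costs `√W`, the accumulated dissipation `2W`, and `1` ensures positivity.
  -- The restriction `Δt ≤ 1/(2c)` is for Gronwall, and `h ≤ 1/3` forces `K ≥ 1`.
  refine ⟨2 * Real.sqrt W + 2 * W + 1, min 1 (min δ (1 / (2 * c))), min (1 / 3) δ, ?_, ?_, ?_, ?_⟩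
  · positivity
  · exact lt_min one_pos (lt_min hδ0 (by positivity))
  · exact lt_min (by norm_num) hδ0
  intro K Δt hh hΔt hΔt₀ M hM φ hφ h0 hb ht hinit n hn
  obtain ⟨hh1, hh2⟩ := le_min_iff.1 hh
  obtain ⟨ht1, ht2⟩ := le_min_iff.1 hΔt₀
  obtain ⟨ht3, ht4⟩ := le_min_iff.1 ht2
  have hK := one_le_of_mesh_le hh1
  have hm := mesh_pos K
  have hmsq : mesh K ^ 2 ≤ mesh K := by nlinarith
  have hmean : ∀ k ≤ M, mean (err Φ Δt φ k) = 0 ∧ bdMean (bot (err Φ Δt φ k)) = 0 ∧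
      bdMean (top (err Φ Δt φ k)) = 0 := fun k hk => hA.mean_err hK hΔt hM hφ h0 hb ht hk
  set X := Δt + mesh K ^ 2 with hX
  have hX0 : 0 ≤ X := by positivity
  have hX2 : X ≤ 2 := by linarith
  have hXδ : X ≤ 2 * δ := by linarith
  have hsmall : B * X ≤ ε₀ / 2 := by
    have h1 : (B + 1) * X ≤ (B + 1) * (2 * δ) := mul_le_mul_of_nonneg_left hXδ (by linarith)
    have h2 : (B + 1) * (2 * δ) = ε₀ / 2 := by rw [hδ]; field_simp; norm_num
    linarith
  have hstep : c * Δt ≤ 1 / 2 := by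
    have := mul_le_mul_of_nonneg_left ht4 hc.le
    rwa [show c * (1 / (2 * c)) = 1 / 2 by field_simp] at this
  have hE0 : energy (err Φ Δt φ 0) ≤ C₀ ^ 2 * X ^ 2 := by
    have h1 := negNorm_nonneg (err Φ Δt φ 0)
    have h2 := surfNegNorm_nonneg (err Φ Δt φ 0)
    rw [← mul_pow]
    refine le_trans ?_ (pow_le_pow_left₀ (add_nonneg h1 h2) hinit 2)
    unfold energy
    nlinarith
  have hmain := hA.energy_err_le hT hε hκ hε₀ hreg hsep hK hΔt hsmall hstep hM hφ hmean
    (show n + 1 ≤ M from hn)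
  have hEW : energy (err Φ Δt φ (n + 1)) +
      Δt * ∑ k ∈ Icc 1 (n + 1), dissip ε κ (err Φ Δt φ k) ≤ W * X ^ 2 := by
    have h1 : energy (err Φ Δt φ 0) +
        2 * c * ((2 * stepConst ε κ θ₀ ε₀ T A ^ 2 * T + 18 * A) * X ^ 2) ≤
        (C₀ ^ 2 + 2 * c * (2 * stepConst ε κ θ₀ ε₀ T A ^ 2 * T + 18 * A)) * X ^ 2 := by
      linarith
    refine hmain.trans ((mul_le_mul_of_nonneg_left h1 (Real.exp_pos _).le).trans_eq ?_)
    rw [hW, mul_assoc (Real.exp _)]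
  have hD : ∀ k, 0 ≤ dissip ε κ (err Φ Δt φ k) := fun k => dissip_nonneg hε hκ _
  have hsum : 0 ≤ Δt * ∑ k ∈ Icc 1 (n + 1), dissip ε κ (err Φ Δt φ k) :=
    mul_nonneg hΔt.le (sum_nonneg fun k _ => hD k)
  have hE := energy_nonneg (err Φ Δt φ (n + 1))
  have hsq : Real.sqrt (W * X ^ 2) = Real.sqrt W * X := by
    rw [Real.sqrt_mul hW0, Real.sqrt_sq hX0]
  have hWX := mul_nonneg hW0 hX0
  have hsX := mul_nonneg (Real.sqrt_nonneg W) hX0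
  refine ⟨hmean (n + 1) hn, ?_, ?_⟩
  · have h1 : negNorm (err Φ Δt φ (n + 1)) ≤ Real.sqrt W * X := by
      rw [← hsq]
      refine Real.le_sqrt_of_sq_le ?_
      have := sq_nonneg (surfNegNorm (err Φ Δt φ (n + 1)))
      rw [energy] at hEW
      linarith
    have h2 : surfNegNorm (err Φ Δt φ (n + 1)) ≤ Real.sqrt W * X := by
      rw [← hsq]
      refine Real.le_sqrt_of_sq_le ?_
      have := sq_nonneg (negNorm (err Φ Δt φ (n + 1)))
      rw [energy] at hEW
      linarith
    have h3 : Δt * ∑ k ∈ Icc 1 n, dissip ε κ (err Φ Δt φ k) ≤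
        Δt * ∑ k ∈ Icc 1 (n + 1), dissip ε κ (err Φ Δt φ k) :=
      mul_le_mul_of_nonneg_left (sum_le_sum_of_subset_of_nonneg
        (Icc_subset_Icc le_rfl (Nat.le_succ n)) fun k _ _ => hD k) hΔt.le
    -- The first estimate contains the dissipation without a square root. It is of second order, so
    -- one factor `X ≤ 2` is given away.
    have h4 : W * X ^ 2 ≤ W * X * 2 := by
      rw [pow_two, ← mul_assoc]
      exact mul_le_mul_of_nonneg_left hX2 hWX
    change _ + Δt * ∑ k ∈ Icc 1 n, dissip ε κ (err Φ Δt φ k) ≤ _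
    have h5 : Δt * ∑ k ∈ Icc 1 n, dissip ε κ (err Φ Δt φ k) ≤ W * X * 2 := by linarith
    calc _ ≤ Real.sqrt W * X + Real.sqrt W * X + W * X * 2 := add_le_add (add_le_add h1 h2) h5
      _ = (2 * Real.sqrt W + 2 * W) * X := by ring
      _ ≤ _ := mul_le_mul_of_nonneg_right (by linarith) hX0
  · refine (Real.sqrt_le_sqrt (y := W * X ^ 2) ?_).trans ?_
    · change Δt * ∑ k ∈ Icc 1 (n + 1), dissip ε κ (err Φ Δt φ k) ≤ _
      linarith
    · rw [hsq]
      exact mul_le_mul_of_nonneg_right (by linarith [Real.sqrt_nonneg W]) hX0
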